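/- **Definitions.** For a finite nonempty set $S\subset\mathbb{R}^d$, a *median* of $S$ is a point $m\in\mathbb{R}^d$ such that for every coordinate $i$ each of the sets $\{c\in S: c_i<m_i\}$ and $\{c\in S: c_i>m_i\}$ contains at most half of the points of $S$. A *threshold tree* is a binary tree whose internal nodes carry cuts $(i,\xi)$ with $i\in\{1,\dots,d\}$, $\xi\in\mathbb{R}$; a point $x$ goes to the left child if $x_i\le \xi$ and to the right child if $x_i>\xi$. Norms are Euclidean, and $\log$ is the natural logarithm. **Algorithm (randomized Divide-and-Share).** Let $k\ge 2$ and $d\ge 1$. The input is a set of centers $c^1,\dots,c^k\in\mathbb{R}^d$ and $\delta\in(0,1)$. Put $\varepsilon=\min\{\delta/(15\ln k),1/320\}$, and fix any rule that selects a median $m(S)$ of each finite nonempty set $S$. Start with a tree that consists of a root to which the set $\{c^1,\dots,c^k\}$ is assigned. While some leaf has at least two distinct centers, sample independently and uniformly $i\in\{1,\dots,d\}$, $\theta\in(0,1)$, $\sigma\in\{\pm1\}$ (independently of earlier iterations), and do the following, with the same $(i,\theta,\sigma)$, for every leaf $u$ whose center set $C_u$ has more than one element. Let $m=m(C_u)$,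 $R=\max_{c\in C_u}\|c-m\|$, $\xi=m_i+\sigma\sqrt\theta R$, and $$\mathrm{Left}=\{c\in C_u: c_i\le \xi+\varepsilon\sqrt\theta R\},\qquad \mathrm{Right}=\{c\in C_u: c_i\ge \xi-\varepsilon\sqrt\theta R\}.$$ If both sets are nonempty, split $u$ by the cut $(i,\xi)$ and assign $\mathrm{Left}$ to the left child and $\mathrm{Right}$ to the right child; otherwise leave $u$ unchanged. Let $\mathcal{T}$ be the resulting tree, $N(\mathcal T)$ its number of leaves, and $\mathcal{T}(x)$ the center of the leaf of $\mathcal T$ that contains $x$. For a finite set $X\subset\mathbb{R}^d$ let $$\mathrm{cost}(X,\mathcal T)=\sum_{x\in X}\|x-\mathcal T(x)\|^2,\qquad \mathrm{cost}(X,C)=\sum_{x\in X}\min_{1\le j\le k}\|x-c^j\|^2 .$$ **Theorem.** There are absolute constants $K\in\mathbb{R}$ and $p\in\mathbb{N}$ such that for all $d\ge1$, $k\ge2$, all centers $c^1,\dots,c^k\in\mathbb{R}^d$, all $\delta\in(0,1)$ and every median rule, with $$\alpha_{k,\delta}=K\cdot\frac1\delta\,\log^2 k\cdot\max\{1,\log\log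 k\},$$ the following hold. 1. Almost surely the algorithm stops, and every leaf of $\mathcal T$ is then labeled with exactly one of the centers $c^1,\dots,c^k$. 2. For every $x\in\mathbb{R}^d$, $\ \mathbf{E}\big[\|x-\mathcal T(x)\|^2\big]\le \alpha_{k,\delta}\cdot\min_{1\le j\le k}\|x-c^j\|^2$. 3. For every finite data set $X\subset\mathbb{R}^d$, $\ \mathbf{E}[\mathrm{cost}(X,\mathcal T)]\le \alpha_{k,\delta}\cdot\mathrm{cost}(X,C)$. 4. $\mathbf{E}[N(\mathcal T)]\le(1+\delta)k$. 5. The algorithm runs in expected polynomial time: the expected number of operations is at most $K(dk)^p$. Here an iteration is charged $3$ operations for its random draws and, for every call of the splitting procedure on a leaf with $n$ centers, $2dn^2+n(3d+2)+8+2n$ operations on real numbers (finding a median by pairwise comparisons in each coordinate, computing $R$, the cut and the ends of the shared strip, and forming $\mathrm{Left}$ and $\mathrm{Right}$). All random variables whose expectations appear are integrable. -/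

import Mathlib

open MeasureTheory

noncomputable section

namespace DivideAndShare

/-- Points of `ℝ^d`, with the Euclidean norm. -/
abbrev Point (d : ℕ) : Type := EuclideanSpace ℝ (Fin d)

/-- A partially built threshold tree on `ℝ^d`. A leaf carries its finite set of centers. An internal
node carries a threshold cut `(i, ξ)`: points with `x i ≤ ξ` go to the first (left) subtree, points
with `x i > ξ` go to the second (right) subtree. -/
inductive ThresholdTree (d : ℕ) : Type
  | leaf (S : Finset (Point d)) : ThresholdTree d
  | node (i : Fin d) (ξ : ℝ) (left right : ThresholdTree d) : ThresholdTree d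

namespace ThresholdTree

variable {d : ℕ}

/-- The center sets of the leaves of the tree, one entry for each leaf. -/
def leaves : ThresholdTree d → List (Finset (Point d))
  | leaf S => [S]
  | node _ _ l r => l.leaves ++ r.leaves

/-- The number of leaves. -/
def numLeaves (T : ThresholdTree d) : ℕ := T.leaves.length

/-- The center set of the unique leaf whose cell contains `x`. -/
def centersAt : ThresholdTree d → Point d → Finset (Point d)
  | leaf S, _ => S
  | node i ξ l r, x => if x i ≤ ξ then l.centersAt x else r.centersAt x

/-- No leaf contains two distinct centers. -/
def Finished (T : ThresholdTree d) : Prop := ∀ S ∈ T.leaves, S.card ≤ 1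

open Classical in
/-- The center assigned to `x`: the center of the leaf that contains `x`. It is used only for trees
all of whose leaves carry exactly one center. -/
def assign (T : ThresholdTree d) (x : Point d) : Point d :=
  if h : (T.centersAt x).Nonempty then h.choose else 0

/-- The `k`-means cost of the clustering of the data set `X` defined by the tree. -/
def cost (X : Finset (Point d)) (T : ThresholdTree d) : ℝ :=
  ∑ x ∈ X, ‖x - T.assign x‖ ^ 2

end ThresholdTree

/-- The squared distance from `x` to the nearest of the centers `c 0, …, c (k - 1)`. -/
def sqDistToCenters {d k : ℕ} (c : Fin k → Point d) (x : Point d) : ℝ :=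
  ⨅ j : Fin k, ‖x - c j‖ ^ 2

/-- The unconstrained `k`-means cost of the data set `X` for the centers `c`. -/
def centersCost {d k : ℕ} (X : Finset (Point d)) (c : Fin k → Point d) : ℝ :=
  ∑ x ∈ X, sqDistToCenters c x

open Classical in
/-- `m` is a (coordinatewise) median of the finite set `S`: in every coordinate at most half of the
points of `S` are strictly below `m`, and at most half are strictly above `m`. -/
def IsMedian {d : ℕ} (S : Finset (Point d)) (m : Point d) : Prop :=
  ∀ i : Fin d, 2 * (S.filter fun c => c i < m i).card ≤ S.card ∧
    2 * (S.filter fun c => m i < c i).card ≤ S.card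

/-- The maximum distance from `m` to a point of the nonempty finite set `S`. -/
def radius {d : ℕ} (S : Finset (Point d)) (m : Point d) : ℝ :=
  ⨆ c : S, ‖(c : Point d) - m‖

/-- The random choices `(i, θ, σ)` of one step: a coordinate, a threshold, and a sign (`true` stands
for `+1` and `false` for `-1`). -/
abbrev Seed (d : ℕ) : Type := Fin d × ℝ × Bool

/-- The sign `σ ∈ {1, -1}`. -/
def sgn (b : Bool) : ℝ := if b then 1 else -1

open Classical in
/-- The centers of `S` that are passed to the left child by the cut `(i, ξ)` with margin `w`. -/
def leftPart {d : ℕ} (S : Finset (Point d)) (i : Fin d) (ξ w : ℝ) : Finset (Point d) :=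
  S.filter fun c => c i ≤ ξ + w

open Classical in
/-- The centers of `S` that are passed to the right child by the cut `(i, ξ)` with margin `w`. -/
def rightPart {d : ℕ} (S : Finset (Point d)) (i : Fin d) (ξ w : ℝ) : Finset (Point d) :=
  S.filter fun c => ξ - w ≤ c i

open Classical in
/-- The function Divide-and-Share, applied to a leaf with center set `S`, where `med` is the rule
that selects a median. Centers close to the cut are given to both children. If one of the two parts
is empty, the leaf is returned unchanged. -/
def divideAndShare {d : ℕ} (med : Finset (Point d) → Point d) (ε : ℝ) (s : Seed d)
    (S : Finset (Point d)) : ThresholdTree d :=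
  let i := s.1
  let θ := s.2.1
  let σ := sgn s.2.2
  let m := med S
  let R := radius S m
  let ξ := m i + σ * √θ * R
  let w := ε * √θ * R
  if (leftPart S i ξ w).Nonempty ∧ (rightPart S i ξ w).Nonempty then
    .node i ξ (.leaf (leftPart S i ξ w)) (.leaf (rightPart S i ξ w))
  else .leaf S

/-- One iteration of the main loop: Divide-and-Share is applied, with the same random choices, to
every leaf with more than one center. -/
def step {d : ℕ} (med : Finset (Point d) → Point d) (ε : ℝ) (s : Seed d) :
    ThresholdTree d → ThresholdTree d
  | .leaf S => if 1 < S.card then divideAndShare med ε s S else .leaf S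
  | .node i ξ l r => .node i ξ (step med ε s l) (step med ε s r)

/-- The parameter `ε = min {δ / (15 ln k), 1 / 320}`. -/
def margin (k : ℕ) (δ : ℝ) : ℝ := min (δ / (15 * Real.log k)) (1 / 320)

section Algorithm

variable {d k : ℕ} (med : Finset (Point d) → Point d) (δ : ℝ) (c : Fin k → Point d)

open Classical in
/-- The tree built in the first `t` iterations, as a function of the sequence `ω` of random choices.
At the start the tree is a root to which all centers are assigned. -/
def treeAt (ω : ℕ → Seed d) : ℕ → ThresholdTree d
  | 0 => .leaf (Finset.univ.image c)
  | t + 1 => step med (margin k δ) (ω t) (treeAt ω t)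

/-- The number of iterations of the main loop: the first time when no leaf contains two distinct
centers (`0` if there is no such time). -/
def haltTime (ω : ℕ → Seed d) : ℕ := sInf {t | (treeAt med δ c ω t).Finished}

/-- The tree returned by the algorithm. -/
def finalTree (ω : ℕ → Seed d) : ThresholdTree d := treeAt med δ c ω (haltTime med δ c ω)

/-- Unit-cost count of the operations on reals (arithmetic, square roots, comparisons) charged to
one call of Divide-and-Share on `n` centers in `ℝ^d`: in each coordinate, all ordered pairs of
centers are compared twice to find a median; `n` distances to the median are computed, each with
`d` subtractions, `d` multiplications, `d` additions and a square root, and their maximum is taken;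
the cut and the two ends of the shared strip are computed; every center is compared with both
ends. -/
def callOps (d n : ℕ) : ℕ := 2 * d * n ^ 2 + n * (3 * d + 2) + 8 + 2 * n

/-- The operations of one iteration on the tree `T`: three random draws, and one call of
Divide-and-Share for every leaf with more than one center. -/
def iterationOps (T : ThresholdTree d) : ℕ :=
  3 + ((T.leaves.filter fun S => 1 < S.card).map fun S => callOps d S.card).sum

/-- The number of operations executed before the algorithm stops. -/
def runningTime (ω : ℕ → Seed d) : ℕ :=
  ∑ t ∈ Finset.range (haltTime med δ c ω), iterationOps (treeAt med δ c ω t)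

end Algorithm

instance isProbabilityMeasure_Ioo :
    IsProbabilityMeasure ((volume : Measure ℝ).restrict (Set.Ioo 0 1)) := ⟨by simp⟩

/-- The law of the random choices of one step: `i`, `θ`, `σ` are independent and uniform in
`{1, …, d}`, `(0, 1)` and `{1, -1}`. -/
def seedLaw (d : ℕ) [NeZero d] : Measure (Seed d) :=
  (PMF.uniformOfFintype (Fin d)).toMeasure.prod
    (((volume : Measure ℝ).restrict (Set.Ioo 0 1)).prod (PMF.uniformOfFintype Bool).toMeasure)

instance isProbabilityMeasure_seedLaw (d : ℕ) [NeZero d] : IsProbabilityMeasure (seedLaw d) := by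
  unfold seedLaw; infer_instance

/-- The law of the whole sequence of random choices: the steps are independent. -/
def randomness (d : ℕ) [NeZero d] : Measure (ℕ → Seed d) :=
  Measure.infinitePi fun _ => seedLaw d

end DivideAndShare

end

/-! Every bound comes from a potential that does not increase in expectation. The draws of an
iteration are independent of the current tree, so a function that is superharmonic for one call of
Divide-and-Share has expectation at most its initial value at every time (`lintegral_chain_le`);
Fatou's lemma carries this to the halting time. Since `θ` is uniform, `√θ` lies in `(u, v)` with
probability `v² - u²`. One-coordinate probabilities are therefore quadratic in the offsets, and sums
over coordinates become squared Euclidean lengths.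

Leaves and running time: the potential is `n (1 + β log n)` per leaf, with `β = δ / log k`. The
child away from the median has at most half of the centers, so each center in it releases `β log 2`,
while a shared center costs `1 + β log n ≤ 2`. A center is shared at most about `4 ε` times as often
as it enters the far child (`volume_shared_le`), and `ε` is small enough for the release to pay. A
leaf with two centers splits with probability at least `1 / (50 d)`, so the bounded expected number
of leaves also bounds the expected total number of calls on splittable leaves; this gives
termination and the running time.

Cost: follow the cell of a point `x`. Its diameter is replaced by the `ℓ^p` norm `M` of the pairwise
distances, with `p` of order `log k`. By the median property the radius `R` satisfies `R² ≤ 2 M²`,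
without a dimension factor, and pairs at distance comparable to `R` are separated with probability
of order `1 / d`; hence `M` contracts by `1 - 1 / (100 d p)` on average (`avg_spread_le`). Let `c`
be a center at distance `D` from `x`. When `D < R`, the cell loses `c` with probability of order `D
/ (d R)`, at a cost of order `R²`. Against the contraction of `M` this gives a potential of order
`D² + p D M` (`avg_linPot_le`).

Sharing improves this. A loss through coordinate `i` forces the half-width `ε √θ R` to be at most
`|x i - c i|`, so the loss probability is of order `D² / (ε d R²)`, quadratic in `D`
(`next_prob_le`). If the nearest center that remains is at distance `r`, the later cost is at most
of order `min (R², L r R)`, where `L` is of order `p`, by the linear potential of that center. As `r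
≤ 3 R`, only scales between `r` and `L r` matter, which is the role of `logRatio`. Thresholds are
grouped by the set `A` of centers they leave, with total weight at most `D²`, and the result is `(p
/ ε) log L · D²`, that is `log² k · log log k / δ` times `D²` (`avg_costPot_le`, `costPot_le`). -/

namespace DivideAndShare

/-! ### Markov chains with countably many states, driven by independent draws -/

section Chain

variable {σ E : Type*}

/-- The deterministic recursion `X (t + 1) = F (X t) (ω t)` driven by the sequence `ω`. -/
def chain (F : E → σ → E) (e₀ : E) (ω : ℕ → σ) : ℕ → E
  | 0 => e₀
  | t + 1 => F (chain F e₀ ω t) (ω t)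

/-- The σ-algebra generated by the first `t` terms of a sequence. -/
@[reducible]
def past (σ : Type*) [MeasurableSpace σ] (t : ℕ) : MeasurableSpace (ℕ → σ) :=
  ⨆ i ∈ Set.Iio t, MeasurableSpace.comap (fun ω : ℕ → σ => ω i) inferInstance

variable {F : E → σ → E} {e₀ : E} {I : Set E}

lemma chain_mem (h₀ : e₀ ∈ I) (hF : ∀ e ∈ I, ∀ s, F e s ∈ I) (ω : ℕ → σ) (t : ℕ) :
    chain F e₀ ω t ∈ I := by
  induction t with
  | zero => exact h₀
  | succ t ih => exact hF _ ih _

variable [MeasurableSpace σ]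

lemma past_mono {t u : ℕ} (h : t ≤ u) : past σ t ≤ past σ u :=
  biSup_mono fun _ hi => lt_of_lt_of_le hi h

lemma comap_le_past {t u : ℕ} (h : t < u) :
    MeasurableSpace.comap (fun ω : ℕ → σ => ω t) inferInstance ≤ past σ u :=
  le_biSup (fun i => MeasurableSpace.comap (fun ω : ℕ → σ => ω i) inferInstance) h

lemma past_le (t : ℕ) : past σ t ≤ MeasurableSpace.pi :=
  iSup₂_le fun i _ => (measurable_pi_apply i).comap_le

/-- The event at time `t + 1` is a countable union, over the previous state, of an event of the past
and an event of the draw `ω t`. Countability of `I` replaces a measurable structure on the state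
space. -/
lemma measurableSet_past_chain (hI : I.Countable) (h₀ : e₀ ∈ I) (hF : ∀ e ∈ I, ∀ s, F e s ∈ I)
    (hm : ∀ e ∈ I, ∀ e' ∈ I, MeasurableSet {s | F e s = e'}) (t : ℕ) (e : E) (he : e ∈ I) :
    MeasurableSet[past σ t] {ω | chain F e₀ ω t = e} := by
  induction t generalizing e with
  | zero => exact @MeasurableSet.const _ (past σ 0) (e₀ = e)
  | succ t ih =>
    have : {ω | chain F e₀ ω (t + 1) = e} =
        ⋃ e' ∈ I, {ω | chain F e₀ ω t = e'} ∩ (fun ω : ℕ → σ => ω t) ⁻¹' {s | F e' s = e} := by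
      ext ω
      simp only [Set.mem_ofPred_eq, Set.mem_iUnion, Set.mem_inter_iff, Set.mem_preimage]
      refine ⟨fun h => ⟨_, chain_mem h₀ hF ω t, rfl, h⟩, ?_⟩
      rintro ⟨e', -, rfl, h⟩
      exact h
    rw [this]
    refine MeasurableSet.biUnion hI fun e' he' => MeasurableSet.inter ?_ ?_
    · exact past_mono (Nat.le_succ t) _ (ih e' he')
    · exact comap_le_past (Nat.lt_succ_self t) _ ⟨_, hm e' he' e he, rfl⟩

lemma measurableSet_chain (hI : I.Countable) (h₀ : e₀ ∈ I) (hF : ∀ e ∈ I, ∀ s, F e s ∈ I)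
    (hm : ∀ e ∈ I, ∀ e' ∈ I, MeasurableSet {s | F e s = e'}) (t : ℕ) (B : Set E) :
    MeasurableSet {ω | chain F e₀ ω t ∈ B} := by
  have : {ω | chain F e₀ ω t ∈ B} = ⋃ e ∈ I ∩ B, {ω | chain F e₀ ω t = e} := by
    ext ω
    simp only [Set.mem_ofPred_eq, Set.mem_iUnion, Set.mem_inter_iff]
    refine ⟨fun h => ⟨_, ⟨chain_mem h₀ hF ω t, h⟩, rfl⟩, ?_⟩
    rintro ⟨e', ⟨-, h⟩, rfl⟩
    exact h
  rw [this]
  exact MeasurableSet.biUnion (hI.mono Set.inter_subset_left) fun e he =>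
    past_le t _ (measurableSet_past_chain hI h₀ hF hm t e he.1)

lemma measurable_comp_chain (hI : I.Countable) (h₀ : e₀ ∈ I) (hF : ∀ e ∈ I, ∀ s, F e s ∈ I)
    (hm : ∀ e ∈ I, ∀ e' ∈ I, MeasurableSet {s | F e s = e'}) (t : ℕ) {β : Type*}
    [MeasurableSpace β] (g : E → β) : Measurable fun ω => g (chain F e₀ ω t) := fun B _ =>
  measurableSet_chain hI h₀ hF hm t (g ⁻¹' B)

variable (ν : Measure σ) [IsProbabilityMeasure ν]

/-- The next term of the driving sequence is independent of the current state. -/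
lemma lintegral_chain (hI : I.Countable) (h₀ : e₀ ∈ I) (hF : ∀ e ∈ I, ∀ s, F e s ∈ I)
    (hm : ∀ e ∈ I, ∀ e' ∈ I, MeasurableSet {s | F e s = e'}) (t : ℕ) (G : E → σ → ENNReal)
    (hG : ∀ e ∈ I, Measurable (G e)) :
    ∫⁻ ω, G (chain F e₀ ω t) (ω t) ∂Measure.infinitePi (fun _ => ν) =
      ∫⁻ ω, ∫⁻ s, G (chain F e₀ ω t) s ∂ν ∂Measure.infinitePi (fun _ : ℕ => ν) := by
  set P := Measure.infinitePi (fun _ : ℕ => ν)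
  have hcount : Countable I := hI
  have hmeas : ∀ e : I, MeasurableSet {ω | chain F e₀ ω t = e} := fun e =>
    past_le t _ (measurableSet_past_chain hI h₀ hF hm t e e.2)
  have hdisj : Pairwise (Function.onFun Disjoint fun e : I => {ω | chain F e₀ ω t = e}) := by
    intro e e' hee
    refine Set.disjoint_left.2 fun ω h h' => hee (Subtype.ext ?_)
    exact (h : _ = _).symm.trans h'
  have huniv : (⋃ e : I, {ω | chain F e₀ ω t = e}) = Set.univ := by
    refine Set.eq_univ_of_forall fun ω => Set.mem_iUnion.2 ⟨⟨_, chain_mem h₀ hF ω t⟩, rfl⟩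
  -- Split by the countably many values of the state. On each piece the state is constant, and the
  -- piece belongs to the past, which is independent of `ω t`.
  rw [← setLIntegral_univ, ← setLIntegral_univ (fun ω => ∫⁻ s, G (chain F e₀ ω t) s ∂ν), ← huniv,
    lintegral_iUnion hmeas hdisj, lintegral_iUnion hmeas hdisj]
  congr 1
  ext e
  have h1 : ∫⁻ ω in {ω | chain F e₀ ω t = e}, G (chain F e₀ ω t) (ω t) ∂P =
      ∫⁻ ω in {ω | chain F e₀ ω t = e}, G e (ω t) ∂P :=
    setLIntegral_congr_fun (hmeas e) fun ω (h : _ = _) => by simp only [h]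
  have h2 : ∫⁻ ω in {ω | chain F e₀ ω t = e}, ∫⁻ s, G (chain F e₀ ω t) s ∂ν ∂P =
      ∫⁻ ω in {ω | chain F e₀ ω t = e}, ∫⁻ s, G e s ∂ν ∂P :=
    setLIntegral_congr_fun (hmeas e) fun ω (h : _ = _) => by simp only [h]
  rw [h1, h2, setLIntegral_const]
  have hind : ProbabilityTheory.Indep
      (MeasurableSpace.comap (fun ω : ℕ → σ => ω t) inferInstance) (past σ t) P := by
    have := ProbabilityTheory.indep_iSup_of_disjoint
      (m := fun i : ℕ => MeasurableSpace.comap (fun ω : ℕ → σ => ω i) inferInstance)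
      (S := {t}) (T := Set.Iio t) (μ := P) (fun i => (measurable_pi_apply i).comap_le)
      (ProbabilityTheory.iIndepFun_infinitePi (X := fun _ => id) (fun _ => measurable_id))
      (by simp)
    simpa [past] using this
  have h3 := ProbabilityTheory.lintegral_mul_indicator_eq_lintegral_mul_lintegral_indicator
    (Mf := MeasurableSpace.comap (fun ω : ℕ → σ => ω t) inferInstance) (μ := P)
    (f := fun ω : ℕ → σ => G e (ω t)) (measurable_pi_apply t).comap_le 1 (hmeas e)
    (ProbabilityTheory.indepSets_of_indepSets_of_le_right
      ((ProbabilityTheory.Indep_iff_IndepSets _ _ _).1 hind)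
      (Set.singleton_subset_iff.2 (measurableSet_past_chain hI h₀ hF hm t e e.2)))
    (Measurable.comp (f := fun ω : ℕ → σ => ω t) (hG e e.2) (comap_measurable _))
  have h4 : ∫⁻ ω, G e (ω t) ∂P = ∫⁻ s, G e s ∂ν :=
    (measurePreserving_eval_infinitePi (fun _ : ℕ => ν) t).lintegral_comp (hG e e.2)
  rw [h4] at h3
  rw [← lintegral_indicator (hmeas e)]
  have hs : ∫⁻ ω, {ω | chain F e₀ ω t = e}.indicator (fun _ => (1 : ENNReal)) ω ∂P =
      P {ω | chain F e₀ ω t = e} := by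
    rw [lintegral_indicator_const (hmeas e), one_mul]
  rw [hs] at h3
  rw [← h3]
  refine lintegral_congr fun ω => ?_
  by_cases h : chain F e₀ ω t = e <;> simp [Set.indicator, h]

/-- The expectation of a superharmonic function of the state does not increase. -/
lemma lintegral_chain_le (hI : I.Countable) (h₀ : e₀ ∈ I) (hF : ∀ e ∈ I, ∀ s, F e s ∈ I)
    (hm : ∀ e ∈ I, ∀ e' ∈ I, MeasurableSet {s | F e s = e'}) (g : E → ENNReal)
    (hg : ∀ e ∈ I, ∫⁻ s, g (F e s) ∂ν ≤ g e) (t : ℕ) :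
    ∫⁻ ω, g (chain F e₀ ω t) ∂Measure.infinitePi (fun _ : ℕ => ν) ≤ g e₀ := by
  induction t with
  | zero => simp [chain]
  | succ t ih =>
    refine le_trans (le_of_eq ?_) (le_trans (lintegral_mono fun ω => hg _ (chain_mem h₀ hF ω t)) ih)
    refine lintegral_chain ν hI h₀ hF hm t (fun e s => g (F e s)) fun e he B _ => ?_
    have : (fun s => g (F e s)) ⁻¹' B = ⋃ e' ∈ I ∩ g ⁻¹' B, {s | F e s = e'} := by
      ext s
      simp only [Set.mem_preimage, Set.mem_iUnion, Set.mem_inter_iff, Set.mem_ofPred_eq]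
      refine ⟨fun h => ⟨_, ⟨hF e he s, h⟩, rfl⟩, ?_⟩
      rintro ⟨e', ⟨-, h⟩, rfl⟩
      exact h
    rw [this]
    exact MeasurableSet.biUnion (hI.mono Set.inter_subset_left) fun e' he' => hm e he e' he'.1

end Chain

/-- Fatou's lemma for nonnegative real functions with bounded integrals. -/
lemma integrable_of_tendsto_of_lintegral_le {Ω : Type*} [MeasurableSpace Ω] {P : Measure Ω}
    {f : ℕ → Ω → ℝ} {g : Ω → ℝ} {C : ℝ} (hC : 0 ≤ C) (hf : ∀ n, Measurable (f n))
    (hg : ∀ ω, 0 ≤ g ω)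
    (hlim : ∀ᵐ ω ∂P, Filter.Tendsto (fun n => f n ω) Filter.atTop (nhds (g ω)))
    (hb : ∀ n, ∫⁻ ω, ENNReal.ofReal (f n ω) ∂P ≤ ENNReal.ofReal C) :
    Integrable g P ∧ ∫ ω, g ω ∂P ≤ C := by
  have hgm : AEMeasurable g P :=
    aemeasurable_of_tendsto_metrizable_ae _ (fun n => (hf n).aemeasurable) hlim
  have hle : ∫⁻ ω, ENNReal.ofReal (g ω) ∂P ≤ ENNReal.ofReal C := by
    calc ∫⁻ ω, ENNReal.ofReal (g ω) ∂P
        = ∫⁻ ω, Filter.liminf (fun n => ENNReal.ofReal (f n ω)) Filter.atTop ∂P := by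
          refine lintegral_congr_ae ?_
          filter_upwards [hlim] with ω h
          exact ((ENNReal.continuous_ofReal.tendsto _).comp h).liminf_eq.symm
      _ ≤ Filter.liminf (fun n => ∫⁻ ω, ENNReal.ofReal (f n ω) ∂P) Filter.atTop :=
          lintegral_liminf_le fun n => (hf n).ennreal_ofReal
      _ ≤ ENNReal.ofReal C := by
          refine Filter.liminf_le_of_frequently_le' ?_
          exact Filter.Frequently.of_forall hb
  refine ⟨⟨hgm.aestronglyMeasurable, ?_⟩, ?_⟩
  · rw [hasFiniteIntegral_iff_ofReal (Filter.Eventually.of_forall hg)]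
    exact hle.trans_lt ENNReal.ofReal_lt_top
  · rw [integral_eq_lintegral_of_nonneg_ae (Filter.Eventually.of_forall hg)
      hgm.aestronglyMeasurable]
    exact ENNReal.toReal_le_of_le_ofReal hC hle

end DivideAndShare

namespace DivideAndShare

/-! ### Measures of sets of thresholds described through `√θ` -/

section Volume

lemma sq_sub_sq_le_volume {u v : ℝ} (hv : v ≤ 1) {B : Set ℝ}
    (hB : ∀ θ ∈ Set.Ioo (0 : ℝ) 1, u < √θ → √θ < v → θ ∈ B) :
    max v 0 ^ 2 - max u 0 ^ 2 ≤ volume.real (B ∩ Set.Ioo 0 1) := by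
  by_cases huv : max v 0 ≤ max u 0
  · have : max v 0 ^ 2 ≤ max u 0 ^ 2 := by gcongr
    linarith [measureReal_nonneg (μ := (volume : Measure ℝ)) (s := B ∩ Set.Ioo 0 1)]
  · push Not at huv
    have hv0 : 0 < v := by
      by_contra! h
      rw [max_eq_right h] at huv
      exact absurd huv (not_lt.2 (le_max_right _ _))
    rw [max_eq_left hv0.le] at huv ⊢
    have hu0 : 0 ≤ max u 0 := le_max_right _ _
    have hsub : Set.Ioo (max u 0 ^ 2) (v ^ 2) ⊆ B ∩ Set.Ioo 0 1 := by
      rintro θ ⟨h1, h2⟩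
      have hθ0 : 0 < θ := lt_of_le_of_lt (sq_nonneg _) h1
      have hθ : θ ∈ Set.Ioo (0 : ℝ) 1 := ⟨hθ0, h2.trans_le (pow_le_one₀ hv0.le hv)⟩
      refine ⟨hB θ hθ (lt_of_le_of_lt (le_max_left _ _) (Real.lt_sqrt_of_sq_lt h1)) ?_, hθ⟩
      exact (Real.sqrt_lt' hv0).2 h2
    have h1 : volume.real (Set.Ioo (max u 0 ^ 2) (v ^ 2)) = v ^ 2 - max u 0 ^ 2 := by
      rw [Real.volume_real_Ioo_of_le (by gcongr)]
    rw [← h1]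
    exact measureReal_mono hsub
      (ne_top_of_le_ne_top (by simp) (measure_mono Set.inter_subset_right))

lemma volume_le_sq_sub_sq {u v : ℝ} (hu : 0 ≤ u) (huv : u ≤ v) {B : Set ℝ}
    (hB : ∀ θ ∈ B ∩ Set.Ioo 0 1, u ≤ √θ ∧ √θ ≤ v) :
    volume.real (B ∩ Set.Ioo 0 1) ≤ v ^ 2 - u ^ 2 := by
  have hsub : B ∩ Set.Ioo 0 1 ⊆ Set.Icc (u ^ 2) (v ^ 2) := fun θ hθ =>
    ⟨(Real.le_sqrt hu hθ.2.1.le).1 (hB θ hθ).1, (Real.sqrt_le_left (hu.trans huv)).1 (hB θ hθ).2⟩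
  rw [← Real.volume_real_Icc_of_le (by gcongr : u ^ 2 ≤ v ^ 2)]
  exact measureReal_mono hsub (by simp)

/-- Substituting `ζ = m + κ √θ` gives `θ = ((ζ - m) / κ)²`, which is Lipschitz with constant `2 H /
κ²` where `|ζ - m| ≤ H`. Comparing one-dimensional Hausdorff measures avoids any measurability of
`B` and `Z`. -/
lemma volume_le_of_affine_sqrt {m κ H : ℝ} (hκ : κ ≠ 0) (hH : 0 ≤ H) {B Z : Set ℝ}
    (hZ : volume Z ≠ ⊤)
    (hB : ∀ θ ∈ B ∩ Set.Ioo 0 1, m + κ * √θ ∈ Z ∧ |κ * √θ| ≤ H) :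
    volume.real (B ∩ Set.Ioo 0 1) ≤ 2 * H / κ ^ 2 * volume.real Z := by
  set f : ℝ → ℝ := fun ζ => ((ζ - m) / κ) ^ 2
  set Z' := Z ∩ {ζ | |ζ - m| ≤ H}
  have hsub : B ∩ Set.Ioo 0 1 ⊆ f '' Z' := by
    intro θ hθ
    obtain ⟨h1, h2⟩ := hB θ hθ
    refine ⟨m + κ * √θ, ⟨h1, by simpa using h2⟩, ?_⟩
    simp only [f, add_sub_cancel_left]
    rw [mul_div_cancel_left₀ _ hκ, Real.sq_sqrt hθ.2.1.le]
  have hK : 0 ≤ 2 * H / κ ^ 2 := by positivity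
  have hlip : LipschitzOnWith (2 * H / κ ^ 2).toNNReal f Z' := by
    refine LipschitzOnWith.of_dist_le_mul fun ζ hζ ζ' hζ' => ?_
    rw [Real.coe_toNNReal _ hK, Real.dist_eq, Real.dist_eq]
    have : f ζ - f ζ' = (ζ - ζ') * ((ζ - m) + (ζ' - m)) / κ ^ 2 := by
      simp only [f]; field_simp; ring
    rw [this, abs_div, abs_mul, abs_of_pos (by positivity : 0 < κ ^ 2), div_mul_eq_mul_div]
    gcongr ?_ / _
    rw [mul_comm]
    gcongr
    calc _ ≤ |ζ - m| + |ζ' - m| := abs_add_le _ _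
      _ ≤ 2 * H := by linarith [hζ.2, hζ'.2, show |ζ - m| ≤ H from hζ.2, show |ζ' - m| ≤ H from hζ'.2]
  have h1 := hlip.hausdorffMeasure_image_le (d := 1) zero_le_one
  rw [hausdorffMeasure_real, ENNReal.rpow_one] at h1
  have h2 : volume (B ∩ Set.Ioo 0 1) ≤ ENNReal.ofReal (2 * H / κ ^ 2) * volume Z :=
    (measure_mono hsub).trans (h1.trans (by
      gcongr
      · exact le_rfl
      · exact Set.inter_subset_left))
  have h3 := ENNReal.toReal_mono (ENNReal.mul_ne_top ENNReal.ofReal_ne_top hZ) h2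
  rwa [ENNReal.toReal_mul, ENNReal.toReal_ofReal hK] at h3

end Volume

variable {d : ℕ}

lemma seedLaw_real_eq [NeZero d] {B : Set (Seed d)} (hB : MeasurableSet B) :
    (seedLaw d).real B = 1 / (2 * d) *
      ∑ i : Fin d, ∑ b : Bool, volume.real ({θ | (i, θ, b) ∈ B} ∩ Set.Ioo 0 1) := by
  have h1 : ∀ i, MeasurableSet (Prod.mk i ⁻¹' B) := fun i => measurable_prodMk_left hB
  have h2 : ∀ i b, MeasurableSet ((fun θ : ℝ => (θ, b)) ⁻¹' (Prod.mk i ⁻¹' B)) := fun i b =>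
    measurable_prodMk_right (h1 i)
  have h3 : seedLaw d B = ∑ i : Fin d, (∑ b : Bool,
      volume ({θ | (i, θ, b) ∈ B} ∩ Set.Ioo 0 1) * (2 : ENNReal)⁻¹) * (d : ENNReal)⁻¹ := by
    unfold seedLaw
    rw [Measure.prod_apply hB, lintegral_fintype]
    refine Finset.sum_congr rfl fun i _ => ?_
    rw [PMF.toMeasure_apply_singleton _ _ (MeasurableSet.singleton _), PMF.uniformOfFintype_apply,
      Fintype.card_fin, Measure.prod_apply_symm (h1 i), lintegral_fintype]
    congr 1
    refine Finset.sum_congr rfl fun b _ => ?_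
    rw [PMF.toMeasure_apply_singleton _ _ (MeasurableSet.singleton _), PMF.uniformOfFintype_apply,
      Fintype.card_bool, Measure.restrict_apply (h2 i b)]
    rfl
  have hfin : ∀ C : Set ℝ, volume (C ∩ Set.Ioo 0 1) ≠ ⊤ := fun C =>
    ne_top_of_le_ne_top (by simp) (measure_mono (Set.inter_subset_right (s := C)))
  have hd : (d : ENNReal) ≠ 0 := by simpa using NeZero.ne d
  rw [measureReal_def, h3, ENNReal.toReal_sum, Finset.mul_sum]
  · refine Finset.sum_congr rfl fun i _ => ?_
    rw [ENNReal.toReal_mul, ENNReal.toReal_sum]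
    · simp only [ENNReal.toReal_mul, ENNReal.toReal_inv, ENNReal.toReal_natCast,
        ENNReal.toReal_ofNat, measureReal_def]
      rw [← Finset.sum_mul]
      field_simp
    · intro b _
      exact ENNReal.mul_ne_top (hfin _) (by simp)
  · intro i _
    refine ENNReal.mul_ne_top ((ENNReal.sum_ne_top).2 fun b _ => ?_) (by simpa using hd)
    exact ENNReal.mul_ne_top (hfin _) (by simp)

end DivideAndShare

namespace DivideAndShare

variable {d : ℕ}

/-! ### Radius, diameter and the coordinatewise median -/

section Geometry

lemma abs_coord_le_norm (x : Point d) (i : Fin d) : |x i| ≤ ‖x‖ := by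
  simpa using PiLp.norm_apply_le x i

lemma sum_sq_coord_sub (x y : Point d) : ∑ i, (x i - y i) ^ 2 = ‖x - y‖ ^ 2 := by
  rw [EuclideanSpace.real_norm_sq_eq]; rfl

lemma norm_sub_le_radius {S : Finset (Point d)} {c : Point d} (hc : c ∈ S) (m : Point d) :
    ‖c - m‖ ≤ radius S m :=
  le_ciSup (f := fun c : S => ‖(c : Point d) - m‖) (Set.finite_range _).bddAbove ⟨c, hc⟩

lemma exists_norm_sub_eq_radius {S : Finset (Point d)} (hS : S.Nonempty) (m : Point d) :
    ∃ c ∈ S, ‖c - m‖ = radius S m := by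
  have : Nonempty S := hS.to_subtype
  obtain ⟨c, hc⟩ := exists_eq_ciSup_of_finite (f := fun c : S => ‖(c : Point d) - m‖)
  exact ⟨c, c.2, hc⟩

lemma abs_coord_sub_le_radius {S : Finset (Point d)} {c : Point d} (hc : c ∈ S) (m : Point d)
    (i : Fin d) : |c i - m i| ≤ radius S m :=
  (abs_coord_le_norm (c - m) i).trans (norm_sub_le_radius hc m)

lemma norm_sub_le_two_radius {S : Finset (Point d)} {a b : Point d} (ha : a ∈ S) (hb : b ∈ S)
    (m : Point d) : ‖a - b‖ ≤ 2 * radius S m := by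
  have h : a - b = (a - m) - (b - m) := by abel
  rw [h]
  linarith [norm_sub_le (a - m) (b - m), norm_sub_le_radius ha m, norm_sub_le_radius hb m]

lemma radius_pos {S : Finset (Point d)} (hS : 1 < S.card) (m : Point d) : 0 < radius S m := by
  obtain ⟨a, ha, b, hb, hab⟩ := Finset.one_lt_card.1 hS
  have h1 := norm_sub_le_two_radius ha hb m
  have h2 : 0 < ‖a - b‖ := norm_pos_iff.2 (sub_ne_zero.2 hab)
  linarith

-- At least half of `S` lies weakly on the other side of `m i` from `c i`, and each such point is at
-- least as far from `c` in coordinate `i` as the median is.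
open Classical in
lemma card_mul_sq_coord_sub_median_le {S : Finset (Point d)} {m : Point d} (hm : IsMedian S m)
    (c : Point d) (i : Fin d) :
    (S.card : ℝ) * (c i - m i) ^ 2 ≤ 2 * ∑ c' ∈ S, (c i - c' i) ^ 2 := by
  have key : ∀ p : Point d → Prop, 2 * (S.filter p).card ≤ S.card →
      (∀ c', ¬ p c' → (c i - m i) ^ 2 ≤ (c i - c' i) ^ 2) →
      (S.card : ℝ) * (c i - m i) ^ 2 ≤ 2 * ∑ c' ∈ S, (c i - c' i) ^ 2 := by
    intro p hp h
    have h1 : ((S.filter fun c' => ¬ p c').card : ℝ) * (c i - m i) ^ 2 ≤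
        ∑ c' ∈ S, (c i - c' i) ^ 2 := by
      calc _ = ∑ c' ∈ S.filter (fun c' => ¬ p c'), (c i - m i) ^ 2 := by simp
        _ ≤ ∑ c' ∈ S.filter (fun c' => ¬ p c'), (c i - c' i) ^ 2 :=
          Finset.sum_le_sum fun c' hc' => h c' (Finset.mem_filter.1 hc').2
        _ ≤ _ := Finset.sum_le_sum_of_subset_of_nonneg (Finset.filter_subset _ _)
          fun _ _ _ => sq_nonneg _
    have h2 := Finset.card_filter_add_card_filter_not (s := S) p
    have h3 : (S.card : ℝ) ≤ 2 * ((S.filter fun c' => ¬ p c').card : ℝ) := by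
      exact_mod_cast (by omega : S.card ≤ 2 * (S.filter fun c' => ¬ p c').card)
    nlinarith [sq_nonneg (c i - m i)]
  rcases le_total (m i) (c i) with h | h
  · refine key (fun c' => m i < c' i) (hm i).2 fun c' hc' => ?_
    have := not_lt.1 hc'
    nlinarith
  · refine key (fun c' => c' i < m i) (hm i).1 fun c' hc' => ?_
    have := not_lt.1 hc'
    nlinarith

/-- For a farthest point `c`, the coordinate bounds add up to twice the average of `‖c - c'‖²` over
`S`. Averaging before comparing with the diameter is what avoids a factor of `d`. -/
lemma radius_sq_le {S : Finset (Point d)} (hS : S.Nonempty) {m : Point d} (hm : IsMedian S m)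
    {Δ : ℝ} (hΔ : ∀ a ∈ S, ∀ b ∈ S, ‖a - b‖ ≤ Δ) : radius S m ^ 2 ≤ 2 * Δ ^ 2 := by
  obtain ⟨c, hc, hcR⟩ := exists_norm_sub_eq_radius hS m
  have hcard : (0 : ℝ) < S.card := by exact_mod_cast hS.card_pos
  have h1 : (S.card : ℝ) * radius S m ^ 2 ≤ 2 * ∑ c' ∈ S, ‖c - c'‖ ^ 2 := by
    rw [← hcR, ← sum_sq_coord_sub, Finset.mul_sum]
    calc _ ≤ ∑ i, 2 * ∑ c' ∈ S, (c i - c' i) ^ 2 :=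
          Finset.sum_le_sum fun i _ => card_mul_sq_coord_sub_median_le hm c i
      _ = _ := by
        rw [← Finset.mul_sum, Finset.sum_comm]
        simp only [sum_sq_coord_sub]
  have h2 : ∑ c' ∈ S, ‖c - c'‖ ^ 2 ≤ S.card * Δ ^ 2 := by
    calc _ ≤ ∑ c' ∈ S, Δ ^ 2 := Finset.sum_le_sum fun c' hc' => by
          gcongr
          exact hΔ c hc c' hc'
      _ = _ := by simp
  nlinarith

end Geometry

/-! ### One call of Divide-and-Share, and its measurability -/

section Cut

variable (med : Finset (Point d) → Point d) (ε : ℝ) (S : Finset (Point d)) (s : Seed d)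

/-- The threshold of the cut of a leaf with center set `S`. -/
noncomputable def cut : ℝ := med S s.1 + sgn s.2.2 * √s.2.1 * radius S (med S)

/-- Half the width of the strip around the cut in which centers are shared. -/
noncomputable def width : ℝ := ε * √s.2.1 * radius S (med S)

/-- The centers of the left child. -/
noncomputable def leftSet : Finset (Point d) := leftPart S s.1 (cut med S s) (width med ε S s)

/-- The centers of the right child. -/
noncomputable def rightSet : Finset (Point d) := rightPart S s.1 (cut med S s) (width med ε S s)

/-- The centers in the cell of `x` after one call of Divide-and-Share. -/
noncomputable def next (x : Point d) : Finset (Point d) := (divideAndShare med ε s S).centersAt x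

open Classical in
lemma divideAndShare_eq : divideAndShare med ε s S =
    if (leftSet med ε S s).Nonempty ∧ (rightSet med ε S s).Nonempty then
      .node s.1 (cut med S s) (.leaf (leftSet med ε S s)) (.leaf (rightSet med ε S s))
    else .leaf S := rfl

open Classical in
lemma next_eq (x : Point d) : next med ε S s x =
    if (leftSet med ε S s).Nonempty ∧ (rightSet med ε S s).Nonempty then
      if x s.1 ≤ cut med S s then leftSet med ε S s else rightSet med ε S s
    else S := by
  rw [next, divideAndShare_eq]
  split_ifs <;> simp_all [ThresholdTree.centersAt]

variable {med ε S s}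

lemma mem_leftSet {c : Point d} :
    c ∈ leftSet med ε S s ↔ c ∈ S ∧ c s.1 ≤ cut med S s + width med ε S s := by
  simp [leftSet, leftPart]

lemma mem_rightSet {c : Point d} :
    c ∈ rightSet med ε S s ↔ c ∈ S ∧ cut med S s - width med ε S s ≤ c s.1 := by
  simp [rightSet, rightPart]

lemma leftSet_subset : leftSet med ε S s ⊆ S := fun _ h => (mem_leftSet.1 h).1

lemma rightSet_subset : rightSet med ε S s ⊆ S := fun _ h => (mem_rightSet.1 h).1

lemma next_subset (x : Point d) : next med ε S s x ⊆ S := by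
  rw [next_eq]
  split_ifs
  exacts [leftSet_subset, rightSet_subset, subset_rfl]

lemma next_nonempty (hS : S.Nonempty) (x : Point d) : (next med ε S s x).Nonempty := by
  rw [next_eq]
  split_ifs with h
  exacts [h.1, h.2, hS]

lemma width_nonneg (hε : 0 ≤ ε) (hS : 1 < S.card) : 0 ≤ width med ε S s :=
  mul_nonneg (mul_nonneg hε (Real.sqrt_nonneg _)) (radius_pos hS _).le

section Measurability

lemma measurable_coord (c : Point d) : Measurable fun s : Seed d => c s.1 :=
  (Measurable.of_discrete (f := fun i : Fin d => c i)).comp measurable_fst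

lemma measurable_cut : Measurable (cut med S) := by
  unfold cut
  have h : Measurable fun s : Seed d => sgn s.2.2 :=
    (Measurable.of_discrete (f := sgn)).comp (measurable_snd.comp measurable_snd)
  exact (measurable_coord _).add ((h.mul (measurable_fst.comp measurable_snd).sqrt).mul_const _)

lemma measurable_width : Measurable (width med ε S) := by
  unfold width
  exact ((measurable_fst.comp measurable_snd).sqrt.const_mul _).mul_const _

open Classical in
lemma measurableSet_filter_eq {Ω α : Type*} [MeasurableSpace Ω] (S : Finset α) {p : Ω → α → Prop}
    (hp : ∀ c ∈ S, MeasurableSet {s | p s c}) (A : Finset α) :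
    MeasurableSet {s | S.filter (p s) = A} := by
  by_cases hA : A ⊆ S
  · have : {s | S.filter (p s) = A} = ⋂ c ∈ S, if c ∈ A then {s | p s c} else {s | p s c}ᶜ := by
      ext s
      simp only [Set.mem_iInter, Set.mem_ofPred_eq]
      constructor
      · rintro rfl c hc
        by_cases h : p s c <;> simp [hc, h]
      · intro h
        ext c
        rw [Finset.mem_filter]
        constructor
        · rintro ⟨hc, hpc⟩
          by_contra hcA
          have := h c hc
          rw [if_neg hcA] at this
          exact this hpc
        · intro hcA
          have := h c (hA hcA)
          rw [if_pos hcA] at this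
          exact ⟨hA hcA, this⟩
    rw [this]
    refine Finset.measurableSet_biInter S fun c hc => ?_
    split_ifs
    exacts [hp c hc, (hp c hc).compl]
  · have : {s | S.filter (p s) = A} = ∅ := by
      refine Set.eq_empty_of_forall_notMem fun s h => hA ?_
      rw [← (h : _ = A)]
      exact Finset.filter_subset _ _
    rw [this]
    exact MeasurableSet.empty

/-- The two sides take only finitely many values, so `P` can be arbitrary. -/
lemma measurableSet_sides (P : Finset (Point d) → Finset (Point d) → Prop) :
    MeasurableSet {s | P (leftSet med ε S s) (rightSet med ε S s)} := by
  classical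
  have : {s | P (leftSet med ε S s) (rightSet med ε S s)} =
      ⋃ A ∈ S.powerset ×ˢ S.powerset, {s | P A.1 A.2} ∩
        ({s | leftSet med ε S s = A.1} ∩ {s | rightSet med ε S s = A.2}) := by
    ext s
    simp only [Set.mem_iUnion, Set.mem_inter_iff, Set.mem_ofPred_eq, Finset.mem_product,
      Finset.mem_powerset]
    constructor
    · intro h
      exact ⟨(_, _), ⟨leftSet_subset, rightSet_subset⟩, h, rfl, rfl⟩
    · rintro ⟨⟨A, B⟩, -, h, rfl, rfl⟩
      exact h
  rw [this]
  refine Finset.measurableSet_biUnion _ fun A _ => (MeasurableSet.const _).inter (.inter ?_ ?_)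
  · exact measurableSet_filter_eq S (fun c _ =>
      measurableSet_le (measurable_coord c) (measurable_cut.add measurable_width)) _
  · exact measurableSet_filter_eq S (fun c _ =>
      measurableSet_le (measurable_cut.sub measurable_width) (measurable_coord c)) _

lemma measurableSet_next (x : Point d) (Q : Finset (Point d) → Prop) :
    MeasurableSet {s | Q (next med ε S s x)} := by
  classical
  have hx : MeasurableSet {s : Seed d | x s.1 ≤ cut med S s} :=
    measurableSet_le (measurable_coord x) measurable_cut
  have : {s | Q (next med ε S s x)} =
      ({s : Seed d | x s.1 ≤ cut med S s} ∩ {s | Q (if (leftSet med ε S s).Nonempty ∧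
        (rightSet med ε S s).Nonempty then leftSet med ε S s else S)}) ∪
      ({s : Seed d | x s.1 ≤ cut med S s}ᶜ ∩ {s | Q (if (leftSet med ε S s).Nonempty ∧
        (rightSet med ε S s).Nonempty then rightSet med ε S s else S)}) := by
    ext s
    by_cases h : x s.1 ≤ cut med S s <;> simp [next_eq, h]
  rw [this]
  exact (hx.inter (measurableSet_sides fun A B => Q (if A.Nonempty ∧ B.Nonempty then A else S))).union
    (hx.compl.inter (measurableSet_sides fun A B => Q (if A.Nonempty ∧ B.Nonempty then B else S)))

end Measurability

end Cut

end DivideAndShare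

namespace DivideAndShare

variable {d : ℕ} {med : Finset (Point d) → Point d} {ε : ℝ} {S : Finset (Point d)} {s : Seed d}

/-! ### Distant centers are separated with probability of order `1 / d` -/

section Separation

/-- The centers `a` and `b` are on different sides of the shared strip. -/
def Separates (med : Finset (Point d) → Point d) (ε : ℝ) (S : Finset (Point d)) (a b : Point d)
    (s : Seed d) : Prop :=
  (a s.1 < cut med S s - width med ε S s ∧ cut med S s + width med ε S s < b s.1) ∨
    (b s.1 < cut med S s - width med ε S s ∧ cut med S s + width med ε S s < a s.1)

lemma measurableSet_separates (a b : Point d) : MeasurableSet {s | Separates med ε S a b s} := by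
  have h : ∀ a b : Point d, MeasurableSet {s | a s.1 < cut med S s - width med ε S s ∧
      cut med S s + width med ε S s < b s.1} := fun a b =>
    (measurableSet_lt (measurable_coord a) (measurable_cut.sub measurable_width)).inter
      (measurableSet_lt (measurable_cut.add measurable_width) (measurable_coord b))
  exact (h a b).union (h b a)

lemma Separates.nonempty (hε : 0 ≤ ε) (hS : 1 < S.card) {a b : Point d} (ha : a ∈ S) (hb : b ∈ S)
    (h : Separates med ε S a b s) :
    (leftSet med ε S s).Nonempty ∧ (rightSet med ε S s).Nonempty := by
  have hw : 0 ≤ width med ε S s := width_nonneg hε hS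
  rcases h with h | h
  · exact ⟨⟨a, mem_leftSet.2 ⟨ha, by linarith⟩⟩, ⟨b, mem_rightSet.2 ⟨hb, by linarith⟩⟩⟩
  · exact ⟨⟨b, mem_leftSet.2 ⟨hb, by linarith⟩⟩, ⟨a, mem_rightSet.2 ⟨ha, by linarith⟩⟩⟩

lemma Separates.not_mem_next (hε : 0 ≤ ε) (hS : 1 < S.card) {a b : Point d} (ha : a ∈ S)
    (hb : b ∈ S) (h : Separates med ε S a b s) (x : Point d) :
    ¬ (a ∈ next med ε S s x ∧ b ∈ next med ε S s x) := by
  classical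
  rw [next_eq, if_pos (h.nonempty hε hS ha hb)]
  split_ifs
  · rw [mem_leftSet, mem_leftSet]
    rintro ⟨⟨-, h1⟩, ⟨-, h2⟩⟩
    rcases h with h | h <;> linarith
  · rw [mem_rightSet, mem_rightSet]
    rintro ⟨⟨-, h1⟩, ⟨-, h2⟩⟩
    rcases h with h | h <;> linarith

/-- Without the strip, the two signs together contribute `|β² - α²|` if both offsets are on the same
side of the median and `α² + β²` otherwise; both are at least `(β - α)² / 2`. The strip rescales the
endpoints by `1 ± ε`, and `(1 + ε)⁻² ≥ 1 - 2 ε`, `(1 - ε)⁻² ≤ 1 + 2.1 ε` bound what it takes away.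
-/
lemma separation_volume {R α β : ℝ} (hR : 0 < R) (hε : 0 ≤ ε) (hε' : ε ≤ 1 / 320)
    (hαβ : α ≤ β) (hα : |α| ≤ R) (hβ : |β| ≤ R) {B : Bool → Set ℝ}
    (hB : ∀ b, ∀ θ ∈ Set.Ioo (0 : ℝ) 1, α < sgn b * √θ * R - ε * √θ * R →
      sgn b * √θ * R + ε * √θ * R < β → θ ∈ B b) :
    ((β - α) ^ 2 / 2 - 21 / 10 * ε * (α ^ 2 + β ^ 2)) / R ^ 2 ≤
      ∑ b, volume.real (B b ∩ Set.Ioo 0 1) := by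
  have hp : 0 < 1 + ε := by linarith
  have hn : 0 < 1 - ε := by linarith
  obtain ⟨hα1, hα2⟩ := abs_le.1 hα
  obtain ⟨hβ1, hβ2⟩ := abs_le.1 hβ
  have h1 : max (β / ((1 + ε) * R)) 0 ^ 2 - max (α / ((1 - ε) * R)) 0 ^ 2 ≤
      volume.real (B true ∩ Set.Ioo 0 1) := by
    refine sq_sub_sq_le_volume ?_ fun θ hθ h1 h2 => hB true θ hθ ?_ ?_
    · rw [div_le_one (by positivity)]; nlinarith
    · rw [div_lt_iff₀ (by positivity)] at h1
      simp only [sgn, if_true]; linarith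
    · rw [lt_div_iff₀ (by positivity)] at h2
      simp only [sgn, if_true]; linarith
  have h2 : max (-α / ((1 + ε) * R)) 0 ^ 2 - max (-β / ((1 - ε) * R)) 0 ^ 2 ≤
      volume.real (B false ∩ Set.Ioo 0 1) := by
    refine sq_sub_sq_le_volume ?_ fun θ hθ h1 h2 => hB false θ hθ ?_ ?_
    · rw [div_le_one (by positivity)]; nlinarith
    · rw [lt_div_iff₀ (by positivity)] at h2
      simp only [sgn]; norm_num; linarith
    · rw [div_lt_iff₀ (by positivity)] at h1
      simp only [sgn]; norm_num; linarith
  have hlow : ∀ y : ℝ, (1 - 2 * ε) * max y 0 ^ 2 / R ^ 2 ≤ max (y / ((1 + ε) * R)) 0 ^ 2 := by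
    intro y
    have h3 : max (y / ((1 + ε) * R)) 0 = max y 0 / ((1 + ε) * R) := by
      rw [← max_div_div_right (by positivity), zero_div]
    rw [h3, div_pow, mul_pow, div_le_div_iff₀ (by positivity) (by positivity)]
    have h4 : (1 - 2 * ε) * (1 + ε) ^ 2 ≤ 1 := by nlinarith [mul_nonneg hε hε, mul_nonneg hε (mul_nonneg hε hε)]
    have h5 : 0 ≤ max y 0 ^ 2 * R ^ 2 := by positivity
    nlinarith
  have hup : ∀ y : ℝ, max (y / ((1 - ε) * R)) 0 ^ 2 ≤ (1 + 21 / 10 * ε) * max y 0 ^ 2 / R ^ 2 := by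
    intro y
    have h3 : max (y / ((1 - ε) * R)) 0 = max y 0 / ((1 - ε) * R) := by
      rw [← max_div_div_right (by positivity), zero_div]
    rw [h3, div_pow, mul_pow, div_le_div_iff₀ (by positivity) (by positivity)]
    have h4 : 1 ≤ (1 + 21 / 10 * ε) * (1 - ε) ^ 2 := by nlinarith [mul_nonneg hε hε, mul_nonneg hε (mul_nonneg hε hε)]
    have h5 : 0 ≤ max y 0 ^ 2 * R ^ 2 := by positivity
    nlinarith
  rw [Fintype.sum_bool]
  refine le_trans ?_ (add_le_add h1 h2)
  have h3 := hlow β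
  have h4 := hlow (-α)
  have h5 := hup α
  have h6 := hup (-β)
  have h7 : ((β - α) ^ 2 / 2 - 21 / 10 * ε * (α ^ 2 + β ^ 2)) / R ^ 2 ≤
      (1 - 2 * ε) * max β 0 ^ 2 / R ^ 2 - (1 + 21 / 10 * ε) * max α 0 ^ 2 / R ^ 2 +
      ((1 - 2 * ε) * max (-α) 0 ^ 2 / R ^ 2 - (1 + 21 / 10 * ε) * max (-β) 0 ^ 2 / R ^ 2) := by
    rw [← sub_div, ← sub_div, ← add_div]
    gcongr
    have hα0 := mul_nonneg hε (sq_nonneg α)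
    have hβ0 := mul_nonneg hε (sq_nonneg β)
    rcases le_total 0 α with ha | ha
    · have hb : 0 ≤ β := ha.trans hαβ
      rw [max_eq_left ha, max_eq_left hb, max_eq_right (neg_nonpos.2 ha),
        max_eq_right (neg_nonpos.2 hb)]
      nlinarith [mul_nonneg (sub_nonneg.2 hαβ) ha, mul_nonneg (sub_nonneg.2 hαβ) hb]
    · rcases le_total 0 β with hb | hb
      · rw [max_eq_right ha, max_eq_left hb, max_eq_left (neg_nonneg.2 ha),
          max_eq_right (neg_nonpos.2 hb)]
        nlinarith [sq_nonneg (α + β)]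
      · rw [max_eq_right ha, max_eq_right hb, max_eq_left (neg_nonneg.2 ha),
          max_eq_left (neg_nonneg.2 hb)]
        nlinarith [mul_nonneg (sub_nonneg.2 hαβ) (neg_nonneg.2 ha),
          mul_nonneg (sub_nonneg.2 hαβ) (neg_nonneg.2 hb)]
  linarith

lemma separates_prob [NeZero d] (hε : 0 ≤ ε) (hε' : ε ≤ 1 / 320) (hS : 1 < S.card)
    {a b : Point d} (ha : a ∈ S) (hb : b ∈ S) (hab : radius S (med S) ^ 2 ≤ 8 * ‖a - b‖ ^ 2) :
    1 / (50 * d) ≤ (seedLaw d).real {s | Separates med ε S a b s} := by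
  set m := med S
  set R := radius S m
  have hR : 0 < R := radius_pos hS m
  have hd : (0 : ℝ) < d := by exact_mod_cast Nat.pos_of_ne_zero (NeZero.ne d)
  rw [seedLaw_real_eq (measurableSet_separates a b)]
  have key : ∀ i : Fin d, (((a i - b i) ^ 2) / 2 - 21 / 10 * ε *
      ((a i - m i) ^ 2 + (b i - m i) ^ 2)) / R ^ 2 ≤ ∑ σ : Bool,
      volume.real ({θ | (i, θ, σ) ∈ {s | Separates med ε S a b s}} ∩ Set.Ioo 0 1) := by
    intro i
    rcases le_total (a i) (b i) with h | h
    · have := separation_volume (α := a i - m i) (β := b i - m i) hR hε hε' (by linarith)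
        (abs_coord_sub_le_radius ha m i) (abs_coord_sub_le_radius hb m i)
        (B := fun σ => {θ | (i, θ, σ) ∈ {s | Separates med ε S a b s}}) (by
          intro σ θ hθ h1 h2
          refine Or.inl ⟨?_, ?_⟩ <;> simp only [cut, width] <;> linarith)
      refine le_trans (le_of_eq ?_) this
      ring
    · have := separation_volume (α := b i - m i) (β := a i - m i) hR hε hε' (by linarith)
        (abs_coord_sub_le_radius hb m i) (abs_coord_sub_le_radius ha m i)
        (B := fun σ => {θ | (i, θ, σ) ∈ {s | Separates med ε S a b s}}) (by
          intro σ θ hθ h1 h2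
          refine Or.inr ⟨?_, ?_⟩ <;> simp only [cut, width] <;> linarith)
      refine le_trans (le_of_eq ?_) this
      ring
  have hsum := Finset.sum_le_sum fun i (_ : i ∈ Finset.univ) => key i
  rw [← Finset.sum_div, Finset.sum_sub_distrib, ← Finset.sum_div, ← Finset.mul_sum,
    Finset.sum_add_distrib, sum_sq_coord_sub, sum_sq_coord_sub, sum_sq_coord_sub] at hsum
  have hA : ‖a - m‖ ^ 2 ≤ R ^ 2 := by
    have := norm_sub_le_radius ha m
    gcongr
  have hB : ‖b - m‖ ^ 2 ≤ R ^ 2 := by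
    have := norm_sub_le_radius hb m
    gcongr
  -- The main term is at least `1 / 16` by `hab`, and the strip costs at most `4.2 / 320`.
  have h1 : 1 / 25 ≤ (‖a - b‖ ^ 2 / 2 - 21 / 10 * ε * (‖a - m‖ ^ 2 + ‖b - m‖ ^ 2)) / R ^ 2 := by
    rw [le_div_iff₀ (by positivity)]
    nlinarith [sq_nonneg R, mul_nonneg hε (sub_nonneg.2 hA), mul_nonneg hε (sub_nonneg.2 hB),
      mul_nonneg (sub_nonneg.2 hε') (sq_nonneg R)]
  calc (1 : ℝ) / (50 * d) = 1 / (2 * d) * (1 / 25) := by field_simp; norm_num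
    _ ≤ _ := by
      gcongr
      exact h1.trans hsum

end Separation

/-! ### The probability that a center disappears from the cell of `x` -/

section Loss

/-- The condition `c' i ≤ ζ` or `ζ ≤ c' i`, whichever holds for `x` when `ζ` is strictly between
`x i` and `c i`. -/
def OnSide (x c : Point d) (i : Fin d) (ζ : ℝ) (c' : Point d) : Prop :=
  if x i < c i then c' i ≤ ζ else ζ ≤ c' i

open Classical in
/-- If `c` is lost in the cell of `x`, then the centers that remain are those on the side of `x`
of a threshold between `x` and `c`. -/
lemma next_eq_filter_of_not_mem (hε : 0 ≤ ε) (hS : 1 < S.card) {x c : Point d} (hc : c ∈ S)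
    (h : c ∉ next med ε S s x) {ζ : ℝ}
    (hζ : ζ = med S s.1 + (if x s.1 < c s.1 then sgn s.2.2 + ε else sgn s.2.2 - ε) *
      radius S (med S) * √s.2.1) :
    ζ ∈ Set.uIcc (x s.1) (c s.1) ∧ next med ε S s x = S.filter (OnSide x c s.1 ζ) ∧
      width med ε S s ≤ |x s.1 - c s.1| := by
  have hw : 0 ≤ width med ε S s := width_nonneg hε hS
  rw [next_eq] at h ⊢
  by_cases hsplit : (leftSet med ε S s).Nonempty ∧ (rightSet med ε S s).Nonempty
  swap
  · rw [if_neg hsplit] at h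
    exact absurd hc h
  rw [if_pos hsplit] at h ⊢
  by_cases hx : x s.1 ≤ cut med S s
  · rw [if_pos hx] at h ⊢
    rw [mem_leftSet, not_and, not_le] at h
    have h := h hc
    have hxc : x s.1 < c s.1 := by linarith
    rw [if_pos hxc] at hζ
    have hζ' : ζ = cut med S s + width med ε S s := by
      rw [hζ, cut, width]; ring
    refine ⟨?_, ?_, ?_⟩
    · rw [Set.uIcc_of_le hxc.le]
      exact ⟨by linarith, by linarith⟩
    · ext c'
      rw [mem_leftSet, Finset.mem_filter, OnSide, if_pos hxc, hζ']
    · rw [abs_sub_comm, abs_of_pos (by linarith)]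
      linarith
  · rw [if_neg hx] at h ⊢
    rw [mem_rightSet, not_and, not_le] at h
    have h := h hc
    rw [not_le] at hx
    have hxc : ¬ x s.1 < c s.1 := by linarith
    rw [if_neg hxc] at hζ
    have hζ' : ζ = cut med S s - width med ε S s := by
      rw [hζ, cut, width]; ring
    refine ⟨?_, ?_, ?_⟩
    · rw [Set.uIcc_of_ge (not_lt.1 hxc)]
      exact ⟨by linarith, by linarith⟩
    · ext c'
      rw [mem_rightSet, Finset.mem_filter, OnSide, if_neg hxc, hζ']
    · rw [abs_of_pos (by linarith)]
      linarith

/-- A bound in one coordinate for the probability that `c` is lost. -/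
lemma volume_lost_le (hε : 0 ≤ ε) (hε' : ε ≤ 1 / 320) (hS : 1 < S.card) {x c : Point d}
    (hc : c ∈ S) (i : Fin d) (σ : Bool) {B Z : Set ℝ} {H : ℝ} (hH : 0 ≤ H)
    (hZ : volume Z ≠ ⊤)
    (hB : ∀ θ ∈ B, c ∉ next med ε S (i, θ, σ) x)
    (hBZ : ∀ θ ∈ B, ∀ ζ, ζ ∈ Set.uIcc (x i) (c i) →
      (next med ε S (i, θ, σ) x = by classical exact S.filter (OnSide x c i ζ)) → ζ ∈ Z)
    (hBH : ∀ θ ∈ B, ∀ ζ, ζ ∈ Set.uIcc (x i) (c i) →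
      |ζ - med S i| ≤ (1 + ε) * radius S (med S) * √θ →
      width med ε S (i, θ, σ) ≤ |x i - c i| → |ζ - med S i| ≤ H) :
    volume.real (B ∩ Set.Ioo 0 1) ≤ 202 / 100 * H / radius S (med S) ^ 2 * volume.real Z := by
  classical
  set R := radius S (med S)
  have hR : 0 < R := radius_pos hS _
  -- The edge of the shared strip towards `c` is `med S i + τ R √θ` with `τ = ±1 ± ε`; the
  -- substitution has slope `τ R`, and `2 / (1 - ε)² ≤ 2.02`.
  set τ : ℝ := if x i < c i then sgn σ + ε else sgn σ - ε with hτdef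
  have hsg : sgn σ = 1 ∨ sgn σ = -1 := by cases σ <;> simp [sgn]
  have hτ : (1 - ε) ^ 2 ≤ τ ^ 2 ∧ |τ| ≤ 1 + ε := by
    rw [abs_le]
    rcases hsg with h | h <;> by_cases hxc : x i < c i <;> simp only [hτdef, hxc, h, if_true, if_false] <;>
      refine ⟨by nlinarith, by linarith, by linarith⟩
  have hτ0 : 0 < (1 - ε) ^ 2 := by
    have : 0 < 1 - ε := by linarith
    positivity
  have hτne : τ ≠ 0 := by
    intro h
    rw [h] at hτ
    linarith [hτ.1]
  have h1 : volume.real (B ∩ Set.Ioo 0 1) ≤ 2 * H / (τ * R) ^ 2 * volume.real Z := by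
    refine volume_le_of_affine_sqrt (m := med S i) (mul_ne_zero hτne hR.ne') hH hZ ?_
    rintro θ ⟨hθ, -⟩
    obtain ⟨h2, h3, h4⟩ := next_eq_filter_of_not_mem hε hS hc (hB θ hθ) rfl
    refine ⟨hBZ θ hθ _ h2 ?_, ?_⟩
    · rw [h3]
    · have := hBH θ hθ _ h2 ?_ h4
      · rwa [add_sub_cancel_left] at this
      · rw [add_sub_cancel_left, abs_mul, abs_mul, abs_of_pos hR, abs_of_nonneg (Real.sqrt_nonneg _)]
        gcongr
        exact hτ.2
  refine h1.trans ?_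
  gcongr ?_ * _
  rw [mul_pow, div_le_div_iff₀ (mul_pos (hτ0.trans_le hτ.1) (by positivity)) (by positivity)]
  have h5 : 2 ≤ 202 / 100 * (1 - ε) ^ 2 := by nlinarith
  have h6 : 2 * H ≤ 202 / 100 * H * τ ^ 2 := by nlinarith [hτ.1]
  calc 2 * H * R ^ 2 ≤ 202 / 100 * H * τ ^ 2 * R ^ 2 := by gcongr
    _ = _ := by ring

lemma measureReal_uIcc (a b : ℝ) : volume.real (Set.uIcc a b) = |a - b| := by
  rw [Real.volume_real_interval, abs_sub_comm]

/-- The critical threshold lies between `x i` and `c i`, hence within `|c i - m i| + |x i - c i|` of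
the median, where the density is controlled. The sum over coordinates is bounded by Cauchy–Schwarz.
This estimate does not use the gain from sharing. -/
lemma lost_prob_le [NeZero d] (hε : 0 ≤ ε) (hε' : ε ≤ 1 / 320) (hS : 1 < S.card) {x c : Point d}
    (hc : c ∈ S) :
    (seedLaw d).real {s | c ∉ next med ε S s x} ≤
      3 * (radius S (med S) * ‖x - c‖ + ‖x - c‖ ^ 2) / (d * radius S (med S) ^ 2) := by
  classical
  set m := med S
  set R := radius S m
  have hR : 0 < R := radius_pos hS m
  have hd : (0 : ℝ) < d := by exact_mod_cast Nat.pos_of_ne_zero (NeZero.ne d)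
  rw [seedLaw_real_eq (measurableSet_next x fun T => c ∉ T)]
  have key : ∀ (i : Fin d) (σ : Bool),
      volume.real ({θ | (i, θ, σ) ∈ {s | c ∉ next med ε S s x}} ∩ Set.Ioo 0 1) ≤
        202 / 100 * (|c i - m i| + |x i - c i|) / R ^ 2 * |x i - c i| := by
    intro i σ
    rw [← measureReal_uIcc (x i)]
    refine volume_lost_le (H := |c i - m i| + volume.real (Set.uIcc (x i) (c i))) hε hε' hS hc i σ
      (by positivity) ?_
      (fun θ hθ => hθ) (fun θ _ ζ hζ _ => hζ) ?_
    · rw [Real.volume_interval]; exact ENNReal.ofReal_ne_top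
    · intro θ _ ζ hζ _ _
      rw [measureReal_uIcc]
      have h1 : |ζ - c i| ≤ |x i - c i| := by
        rw [abs_sub_comm, abs_sub_comm (x i)]
        exact Set.abs_sub_right_of_mem_uIcc hζ
      have h2 : ζ - m i = (ζ - c i) + (c i - m i) := by ring
      rw [h2]
      linarith [abs_add_le (ζ - c i) (c i - m i)]
  have hsum : ∑ i : Fin d, ∑ σ : Bool,
      volume.real ({θ | (i, θ, σ) ∈ {s | c ∉ next med ε S s x}} ∩ Set.Ioo 0 1) ≤
      404 / 100 / R ^ 2 * ∑ i : Fin d, (|c i - m i| * |x i - c i| + (x i - c i) ^ 2) := by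
    rw [Finset.mul_sum]
    refine Finset.sum_le_sum fun i _ => ?_
    refine (Finset.sum_le_sum fun σ _ => key i σ).trans (le_of_eq ?_)
    rw [Fintype.sum_bool, ← sq_abs (x i - c i)]
    ring
  have hcs : ∑ i : Fin d, |c i - m i| * |x i - c i| ≤ R * ‖x - c‖ := by
    have h := Finset.sum_mul_sq_le_sq_mul_sq Finset.univ (fun i => |c i - m i|)
      (fun i => |x i - c i|)
    simp only [sq_abs, sum_sq_coord_sub] at h
    rw [← mul_pow] at h
    refine (abs_le_of_sq_le_sq' h (by positivity)).2.trans ?_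
    gcongr
    exact norm_sub_le_radius hc m
  have h2 : ∑ i : Fin d, (|c i - m i| * |x i - c i| + (x i - c i) ^ 2) ≤
      R * ‖x - c‖ + ‖x - c‖ ^ 2 := by
    rw [Finset.sum_add_distrib, sum_sq_coord_sub]
    linarith
  calc _ ≤ 1 / (2 * d) * (404 / 100 / R ^ 2 * (R * ‖x - c‖ + ‖x - c‖ ^ 2)) := by
        gcongr
        exact hsum.trans (by gcongr)
    _ = (202 / 100) * (R * ‖x - c‖ + ‖x - c‖ ^ 2) / (d * R ^ 2) := by field_simp; ring
    _ ≤ _ := by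
        gcongr
        norm_num

open Classical in
/-- The weight of the thresholds between `x` and `c` that leave exactly the set `A` of the centers
in `S₀` on the side of `x`. -/
noncomputable def cutWeight (x c : Point d) (S₀ A : Finset (Point d)) : ℝ :=
  ∑ i, |x i - c i| * volume.real {ζ ∈ Set.uIcc (x i) (c i) | S₀.filter (OnSide x c i ζ) = A}

lemma cutWeight_nonneg (x c : Point d) (S₀ A : Finset (Point d)) : 0 ≤ cutWeight x c S₀ A :=
  Finset.sum_nonneg fun _ _ => mul_nonneg (abs_nonneg _) measureReal_nonneg

open Classical in
lemma measurableSet_onSide (x c : Point d) (S₀ A : Finset (Point d)) (i : Fin d) :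
    MeasurableSet {ζ ∈ Set.uIcc (x i) (c i) | S₀.filter (OnSide x c i ζ) = A} := by
  refine measurableSet_uIcc.inter (measurableSet_filter_eq S₀ (fun c' _ => ?_) A)
  unfold OnSide
  split_ifs
  exacts [measurableSet_Ici, measurableSet_Iic]

/-- In each coordinate the thresholds belonging to different `A` are disjoint parts of a segment of
length `|x i - c i|`; the second factor `|x i - c i|` turns the sum into `‖x - c‖²`. -/
lemma sum_cutWeight_le (x c : Point d) (S₀ : Finset (Point d)) :
    ∑ A ∈ S₀.powerset, cutWeight x c S₀ A ≤ ‖x - c‖ ^ 2 := by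
  classical
  unfold cutWeight
  rw [Finset.sum_comm, ← sum_sq_coord_sub]
  refine Finset.sum_le_sum fun i _ => ?_
  rw [← Finset.mul_sum, ← sq_abs, sq, ← measureReal_uIcc]
  gcongr
  have hfin : ∀ A ∈ S₀.powerset,
      volume {ζ ∈ Set.uIcc (x i) (c i) | S₀.filter (OnSide x c i ζ) = A} ≠ ⊤ := fun A _ =>
    ne_top_of_le_ne_top (by rw [Real.volume_interval]; exact ENNReal.ofReal_ne_top)
      (measure_mono (fun ζ hζ => hζ.1 : _ ⊆ Set.uIcc (x i) (c i)))
  rw [← measureReal_biUnion_finset _ _ hfin]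
  · refine measureReal_mono (Set.iUnion₂_subset fun A _ => fun ζ hζ => hζ.1) ?_
    rw [Real.volume_interval]; exact ENNReal.ofReal_ne_top
  · intro A _ A' _ hAA
    exact Set.disjoint_left.2 fun ζ h h' => hAA (h.2.symm.trans h'.2)
  · exact fun A _ => measurableSet_onSide x c S₀ A i

-- The gain from sharing. If `c` is lost, then `ε √θ R ≤ |x i - c i|`, so the threshold is within
-- `(1 + ε) |x i - c i| / ε` of the median. The density there is itself proportional to `|x i - c
-- i|`, and the probability becomes quadratic. The weights refer to the fixed set `S₀`, so they stay
-- the same while the cell shrinks.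
open Classical in
lemma next_prob_le [NeZero d] (hε : 0 < ε) (hε' : ε ≤ 1 / 320) (hS : 1 < S.card)
    {S₀ : Finset (Point d)} (hSS : S ⊆ S₀) {x c : Point d} (hc : c ∈ S) {T : Finset (Point d)}
    (hT : c ∉ T) :
    (seedLaw d).real {s | next med ε S s x = T} ≤
      3 / (ε * d * radius S (med S) ^ 2) *
        ∑ A ∈ S₀.powerset.filter (fun A => S ∩ A = T), cutWeight x c S₀ A := by
  set m := med S
  set R := radius S m
  have hR : 0 < R := radius_pos hS m
  have hd : (0 : ℝ) < d := by exact_mod_cast Nat.pos_of_ne_zero (NeZero.ne d)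
  have hfin : ∀ (i : Fin d) (Q : ℝ → Prop), volume {ζ ∈ Set.uIcc (x i) (c i) | Q ζ} ≠ ⊤ := by
    intro i Q
    exact ne_top_of_le_ne_top (by rw [Real.volume_interval]; exact ENNReal.ofReal_ne_top)
      (measure_mono (fun ζ hζ => hζ.1 : _ ⊆ Set.uIcc (x i) (c i)))
  rw [seedLaw_real_eq (measurableSet_next x fun T' => T' = T)]
  have key : ∀ (i : Fin d) (σ : Bool),
      volume.real ({θ | (i, θ, σ) ∈ {s | next med ε S s x = T}} ∩ Set.Ioo 0 1) ≤
        202 / 100 * ((1 + ε) * |x i - c i| / ε) / R ^ 2 *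
          volume.real {ζ ∈ Set.uIcc (x i) (c i) | S.filter (OnSide x c i ζ) = T} := by
    intro i σ
    refine volume_lost_le (x := x) hε.le hε' hS hc i σ (by positivity) (hfin i _) ?_ ?_ ?_
    · rintro θ (hθ : _ = _)
      rwa [hθ]
    · rintro θ (hθ : _ = _) ζ hζ h
      exact ⟨hζ, h.symm.trans hθ⟩
    · intro θ _ ζ hζ h1 h2
      refine h1.trans ?_
      rw [le_div_iff₀ hε]
      simp only [width] at h2
      calc (1 + ε) * R * √θ * ε = (1 + ε) * (ε * √θ * R) := by ring
        _ ≤ _ := by gcongr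
  have hZ : ∀ i : Fin d, volume.real {ζ ∈ Set.uIcc (x i) (c i) | S.filter (OnSide x c i ζ) = T} ≤
      ∑ A ∈ S₀.powerset.filter (fun A => S ∩ A = T),
        volume.real {ζ ∈ Set.uIcc (x i) (c i) | S₀.filter (OnSide x c i ζ) = A} := by
    intro i
    refine le_trans (measureReal_mono (s₂ := ⋃ A ∈ S₀.powerset.filter (fun A => S ∩ A = T),
      {ζ ∈ Set.uIcc (x i) (c i) | S₀.filter (OnSide x c i ζ) = A}) ?_ ?_)
      (measureReal_biUnion_finset_le _ _)
    · rintro ζ ⟨hζ, h⟩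
      simp only [Set.mem_iUnion]
      refine ⟨S₀.filter (OnSide x c i ζ), ?_, hζ, rfl⟩
      rw [Finset.mem_filter, Finset.mem_powerset]
      refine ⟨Finset.filter_subset _ _, ?_⟩
      rw [← h, Finset.inter_filter, Finset.inter_eq_left.2 hSS]
    · exact ne_top_of_le_ne_top (by rw [Real.volume_interval]; exact ENNReal.ofReal_ne_top)
        (measure_mono (Set.iUnion₂_subset fun A _ => (fun ζ hζ => hζ.1 : _ ⊆ Set.uIcc (x i) (c i))))
  have hsum : ∑ i : Fin d, ∑ σ : Bool,
      volume.real ({θ | (i, θ, σ) ∈ {s | next med ε S s x = T}} ∩ Set.Ioo 0 1) ≤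
      404 / 100 * (1 + ε) / (ε * R ^ 2) *
        ∑ A ∈ S₀.powerset.filter (fun A => S ∩ A = T), cutWeight x c S₀ A := by
    unfold cutWeight
    rw [Finset.sum_comm (s := S₀.powerset.filter _), Finset.mul_sum]
    refine Finset.sum_le_sum fun i _ => ?_
    refine (Finset.sum_le_sum fun σ _ => key i σ).trans ?_
    rw [Fintype.sum_bool, ← Finset.mul_sum]
    calc _ = 404 / 100 * (1 + ε) / (ε * R ^ 2) * (|x i - c i| *
          volume.real {ζ ∈ Set.uIcc (x i) (c i) | S.filter (OnSide x c i ζ) = T}) := by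
          field_simp; ring
      _ ≤ _ := by
          gcongr
          exact hZ i
  have hw : 0 ≤ ∑ A ∈ S₀.powerset.filter (fun A => S ∩ A = T), cutWeight x c S₀ A :=
    Finset.sum_nonneg fun _ _ => cutWeight_nonneg _ _ _ _
  calc _ ≤ 1 / (2 * d) * (404 / 100 * (1 + ε) / (ε * R ^ 2) *
        ∑ A ∈ S₀.powerset.filter (fun A => S ∩ A = T), cutWeight x c S₀ A) := by gcongr
    _ = 202 / 100 * (1 + ε) / (ε * d * R ^ 2) *
        ∑ A ∈ S₀.powerset.filter (fun A => S ∩ A = T), cutWeight x c S₀ A := by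
        field_simp; ring
    _ ≤ _ := by
        gcongr
        linarith

end Loss

end DivideAndShare

namespace DivideAndShare

variable {d : ℕ} {med : Finset (Point d) → Point d} {ε : ℝ} {S : Finset (Point d)} {x : Point d}

/-! ### The transition operator of the cell of `x` -/

section Average

variable [NeZero d]

variable (med ε x S) in
/-- The probability that `T` is the set of centers in the cell of `x` after one call of
Divide-and-Share on the center set `S`. -/
noncomputable def stepProb (T : Finset (Point d)) : ℝ :=
  (seedLaw d).real {s | next med ε S s x = T}

variable (med ε x) in
/-- The expectation of `g` after one call of Divide-and-Share on the center set `S`. -/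
noncomputable def avg (g : Finset (Point d) → ℝ) (S : Finset (Point d)) : ℝ :=
  ∑ T ∈ S.powerset, stepProb med ε S x T * g T

lemma stepProb_nonneg (T : Finset (Point d)) : 0 ≤ stepProb med ε S x T := measureReal_nonneg

lemma stepProb_empty (hS : S.Nonempty) : stepProb med ε S x ∅ = 0 := by
  have : {s | next med ε S s x = ∅} = ∅ :=
    Set.eq_empty_of_forall_notMem fun s h => (next_nonempty hS x).ne_empty h
  rw [stepProb, this, measureReal_empty]

/-- A cell never loses all of its centers, so the empty set has probability `0` and needs no
comparison. -/
lemma avg_mono (hS : S.Nonempty) {g h : Finset (Point d) → ℝ}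
    (hgh : ∀ T ⊆ S, T.Nonempty → g T ≤ h T) : avg med ε x g S ≤ avg med ε x h S := by
  refine Finset.sum_le_sum fun T hT => ?_
  rcases T.eq_empty_or_nonempty with rfl | hT'
  · simp [stepProb_empty hS]
  · exact mul_le_mul_of_nonneg_left (hgh T (Finset.mem_powerset.1 hT) hT') (stepProb_nonneg T)

lemma sum_stepProb_eq (Q : Finset (Point d) → Prop) [DecidablePred Q] :
    avg med ε x (fun T => if Q T then 1 else 0) S = (seedLaw d).real {s | Q (next med ε S s x)} := by
  have : {s | Q (next med ε S s x)} =
      ⋃ T ∈ S.powerset.filter Q, {s | next med ε S s x = T} := by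
    ext s
    simp only [Set.mem_iUnion, Set.mem_ofPred_eq, Finset.mem_filter, Finset.mem_powerset]
    constructor
    · intro h
      exact ⟨_, ⟨next_subset x, h⟩, rfl⟩
    · rintro ⟨T, ⟨-, h⟩, rfl⟩
      exact h
  rw [this, measureReal_biUnion_finset, avg, Finset.sum_filter]
  · simp [stepProb]
  · intro T _ T' _ hTT
    exact Set.disjoint_left.2 fun s h h' => hTT ((h : _ = _).symm.trans h')
  · exact fun T _ => measurableSet_next x fun T' => T' = T

lemma avg_const (r : ℝ) : avg med ε x (fun _ => r) S = r := by
  have h := sum_stepProb_eq (med := med) (ε := ε) (x := x) (S := S) fun _ => True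
  simp only [if_true, avg, mul_one] at h
  rw [avg, ← Finset.sum_mul, h]
  simp

lemma avg_add (g h : Finset (Point d) → ℝ) :
    avg med ε x (fun T => g T + h T) S = avg med ε x g S + avg med ε x h S := by
  simp only [avg, mul_add, Finset.sum_add_distrib]

lemma avg_const_mul (r : ℝ) (g : Finset (Point d) → ℝ) :
    avg med ε x (fun T => r * g T) S = r * avg med ε x g S := by
  rw [avg, avg, Finset.mul_sum]
  exact Finset.sum_congr rfl fun T _ => by ring

lemma avg_sum {ι : Type*} (A : Finset ι) (g : ι → Finset (Point d) → ℝ) :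
    avg med ε x (fun T => ∑ i ∈ A, g i T) S = ∑ i ∈ A, avg med ε x (g i) S := by
  simp only [avg, Finset.mul_sum]
  exact Finset.sum_comm

lemma avg_le_of_le (hS : S.Nonempty) {g : Finset (Point d) → ℝ} {r : ℝ}
    (h : ∀ T ⊆ S, T.Nonempty → g T ≤ r) : avg med ε x g S ≤ r :=
  (avg_mono hS h).trans_eq (avg_const r)

lemma lintegral_next {g : Finset (Point d) → ℝ} (hg : ∀ T ⊆ S, 0 ≤ g T) :
    ∫⁻ s, ENNReal.ofReal (g (next med ε S s x)) ∂seedLaw d = ENNReal.ofReal (avg med ε x g S) := by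
  classical
  have h1 : ∀ s, ENNReal.ofReal (g (next med ε S s x)) = ∑ T ∈ S.powerset,
      {s | next med ε S s x = T}.indicator (fun _ => ENNReal.ofReal (g T)) s := by
    intro s
    rw [Finset.sum_eq_single (next med ε S s x)]
    · simp
    · intro T _ hT
      rw [Set.indicator_of_notMem]
      exact fun h => hT (h : next med ε S s x = T).symm
    · intro h
      exact absurd (Finset.mem_powerset.2 (next_subset x)) h
  simp_rw [h1]
  rw [lintegral_finsetSum, avg, ENNReal.ofReal_sum_of_nonneg]
  · refine Finset.sum_congr rfl fun T _ => ?_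
    rw [lintegral_indicator_const (measurableSet_next x fun T' => T' = T),
      ENNReal.ofReal_mul (stepProb_nonneg T), stepProb, ofReal_measureReal, mul_comm]
  · exact fun T hT => mul_nonneg (stepProb_nonneg T) (hg T (Finset.mem_powerset.1 hT))
  · exact fun T _ => measurable_const.indicator (measurableSet_next x fun T' => T' = T)

end Average

/-! ### Contraction of the smoothed diameter -/

section Spread

/-- The sum of the `p`-th powers of the distances between the points of `S`. -/
noncomputable def powerSum (p : ℕ) (S : Finset (Point d)) : ℝ :=
  ∑ e ∈ S ×ˢ S, ‖e.1 - e.2‖ ^ p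

/-- The `ℓ^p` norm of the distances between the points of `S`, a smooth substitute for the
diameter. -/
noncomputable def spread (p : ℕ) (S : Finset (Point d)) : ℝ := powerSum p S ^ (1 / (p : ℝ))

variable {p : ℕ}

lemma powerSum_nonneg (S : Finset (Point d)) : 0 ≤ powerSum p S :=
  Finset.sum_nonneg fun _ _ => by positivity

lemma powerSum_mono {T : Finset (Point d)} (h : T ⊆ S) : powerSum p T ≤ powerSum p S :=
  Finset.sum_le_sum_of_subset_of_nonneg (Finset.product_subset_product h h)
    fun _ _ _ => by positivity

lemma spread_nonneg (S : Finset (Point d)) : 0 ≤ spread p S :=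
  Real.rpow_nonneg (powerSum_nonneg S) _

lemma spread_mono {T : Finset (Point d)} (h : T ⊆ S) : spread p T ≤ spread p S :=
  Real.rpow_le_rpow (powerSum_nonneg T) (powerSum_mono h) (by positivity)

open Classical in
lemma pow_norm_sub_le_sum {A : Finset (Point d × Point d)} {a b : Point d} (h : (a, b) ∈ A) :
    ‖a - b‖ ^ p ≤ ∑ e ∈ A, ‖e.1 - e.2‖ ^ p := by
  rw [← Finset.add_sum_erase A (fun e => ‖e.1 - e.2‖ ^ p) h]
  exact le_add_of_nonneg_right (Finset.sum_nonneg fun _ _ => pow_nonneg (norm_nonneg _) _)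

lemma norm_sub_le_spread (hp : p ≠ 0) {a b : Point d} (ha : a ∈ S) (hb : b ∈ S) :
    ‖a - b‖ ≤ spread p S := by
  have h : ‖a - b‖ ^ p ≤ powerSum p S :=
    pow_norm_sub_le_sum (Finset.mk_mem_product ha hb)
  rw [← Real.pow_rpow_inv_natCast (norm_nonneg (a - b)) hp, spread, one_div]
  exact Real.rpow_le_rpow (by positivity) h (by positivity)

/-- There are at most `2 ^ p` pairs, so the `p`-th root of their number is at most `2`. -/
lemma spread_le (hp : p ≠ 0) (hcard : S.card ^ 2 ≤ 2 ^ p) {Δ : ℝ} (hΔ0 : 0 ≤ Δ)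
    (hΔ : ∀ a ∈ S, ∀ b ∈ S, ‖a - b‖ ≤ Δ) : spread p S ≤ 2 * Δ := by
  have h : powerSum p S ≤ (2 * Δ) ^ p := by
    calc powerSum p S ≤ ∑ e ∈ S ×ˢ S, Δ ^ p := by
          refine Finset.sum_le_sum fun e he => ?_
          have := hΔ e.1 (Finset.mem_product.1 he).1 e.2 (Finset.mem_product.1 he).2
          gcongr
      _ = (S.card ^ 2 : ℕ) * Δ ^ p := by simp [sq]
      _ ≤ (2 ^ p : ℕ) * Δ ^ p := by gcongr
      _ = _ := by push_cast; rw [mul_pow]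
  rw [← Real.pow_rpow_inv_natCast (by positivity : 0 ≤ 2 * Δ) hp, spread, one_div]
  exact Real.rpow_le_rpow (powerSum_nonneg S) h (by positivity)

lemma exists_max_dist (hS : S.Nonempty) :
    ∃ a ∈ S, ∃ b ∈ S, ∀ a' ∈ S, ∀ b' ∈ S, ‖a' - b'‖ ≤ ‖a - b‖ := by
  obtain ⟨e, he, h⟩ := Finset.exists_max_image (S ×ˢ S) (fun e => ‖e.1 - e.2‖) (hS.product hS)
  rw [Finset.mem_product] at he
  exact ⟨e.1, he.1, e.2, he.2, fun a' ha' b' hb' => h (a', b') (Finset.mk_mem_product ha' hb')⟩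

lemma spread_le_four_radius (hp : p ≠ 0) (hS : S.Nonempty) (hcard : S.card ^ 2 ≤ 2 ^ p)
    (m : Point d) : spread p S ≤ 4 * radius S m := by
  obtain ⟨a, ha⟩ := hS
  have h0 : 0 ≤ radius S m := (norm_nonneg _).trans (norm_sub_le_radius ha m)
  have := spread_le hp hcard (by positivity : 0 ≤ 2 * radius S m)
    fun a ha b hb => norm_sub_le_two_radius ha hb m
  linarith

lemma radius_sq_le_spread (hp : p ≠ 0) (hS : S.Nonempty) (hm : IsMedian S (med S)) :
    radius S (med S) ^ 2 ≤ 2 * spread p S ^ 2 :=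
  radius_sq_le hS hm fun _ ha _ hb => norm_sub_le_spread hp ha hb

variable [NeZero d]

/-- Pairs with `R² ≤ 8 ‖a - b‖²` are separated with probability at least `1 / (50 d)`. All other
pairs are at most half a diameter apart, and there are at most `2 ^ p` of them, so together they
weigh no more than the single pair realizing the diameter, which is far. Far pairs thus carry half
of the sum. -/
lemma avg_powerSum_le (hε : 0 ≤ ε) (hε' : ε ≤ 1 / 320) (hS : 1 < S.card)
    (hm : IsMedian S (med S)) (hcard : S.card ^ 2 ≤ 2 ^ p) :
    avg med ε x (powerSum p) S ≤ (1 - 1 / (100 * d)) * powerSum p S := by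
  classical
  have hne : S.Nonempty := Finset.card_pos.1 (by omega)
  have hd : (0 : ℝ) < d := by exact_mod_cast Nat.pos_of_ne_zero (NeZero.ne d)
  set R := radius S (med S)
  have hR : 0 < R := radius_pos hS _
  have h1 : avg med ε x (powerSum p) S ≤ ∑ e ∈ S ×ˢ S, ‖e.1 - e.2‖ ^ p *
      (seedLaw d).real {s | e.1 ∈ next med ε S s x ∧ e.2 ∈ next med ε S s x} := by
    have : ∀ T ⊆ S, T.Nonempty → powerSum p T ≤ ∑ e ∈ S ×ˢ S, ‖e.1 - e.2‖ ^ p *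
        (if e.1 ∈ T ∧ e.2 ∈ T then 1 else 0) := by
      intro T hT _
      simp only [mul_ite, mul_one, mul_zero]
      rw [← Finset.sum_filter]
      refine Finset.sum_le_sum_of_subset_of_nonneg (fun e he => ?_) fun _ _ _ => by positivity
      rw [Finset.mem_product] at he
      exact Finset.mem_filter.2 ⟨Finset.mk_mem_product (hT he.1) (hT he.2), he⟩
    refine (avg_mono hne this).trans (le_of_eq ?_)
    rw [avg_sum]
    refine Finset.sum_congr rfl fun e _ => ?_
    rw [avg_const_mul, sum_stepProb_eq fun T => e.1 ∈ T ∧ e.2 ∈ T]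
  set far := (S ×ˢ S).filter fun e => R ^ 2 ≤ 8 * ‖e.1 - e.2‖ ^ 2 with hfar
  have h2 : ∀ e ∈ S ×ˢ S, ‖e.1 - e.2‖ ^ p *
      (seedLaw d).real {s | e.1 ∈ next med ε S s x ∧ e.2 ∈ next med ε S s x} ≤
      ‖e.1 - e.2‖ ^ p - (if R ^ 2 ≤ 8 * ‖e.1 - e.2‖ ^ 2 then
        1 / (50 * d) * ‖e.1 - e.2‖ ^ p else 0) := by
    intro e he
    rw [Finset.mem_product] at he
    have hpow : 0 ≤ ‖e.1 - e.2‖ ^ p := by positivity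
    split_ifs with h
    · have h3 := separates_prob (med := med) hε hε' hS he.1 he.2 h
      have h4 : (seedLaw d).real {s | e.1 ∈ next med ε S s x ∧ e.2 ∈ next med ε S s x} ≤
          (seedLaw d).real {s | Separates med ε S e.1 e.2 s}ᶜ :=
        measureReal_mono fun s hs hsep => (Separates.not_mem_next hε hS he.1 he.2 hsep x) hs
      rw [probReal_compl_eq_one_sub (measurableSet_separates _ _)] at h4
      nlinarith
    · have h4 : (seedLaw d).real {s | e.1 ∈ next med ε S s x ∧ e.2 ∈ next med ε S s x} ≤ 1 :=
        measureReal_le_one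
      nlinarith
  have h3 : avg med ε x (powerSum p) S ≤ powerSum p S -
      1 / (50 * d) * ∑ e ∈ far, ‖e.1 - e.2‖ ^ p := by
    refine h1.trans ((Finset.sum_le_sum h2).trans (le_of_eq ?_))
    rw [Finset.sum_sub_distrib, ← Finset.sum_filter, Finset.mul_sum, powerSum]
  obtain ⟨a, ha, b, hb, hab⟩ := exists_max_dist hne
  have hRab : R ^ 2 ≤ 2 * ‖a - b‖ ^ 2 := radius_sq_le hne hm hab
  have h4 : ∑ e ∈ (S ×ˢ S).filter (fun e => ¬ R ^ 2 ≤ 8 * ‖e.1 - e.2‖ ^ 2), ‖e.1 - e.2‖ ^ p ≤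
      ‖a - b‖ ^ p := by
    calc _ ≤ ∑ e ∈ (S ×ˢ S).filter (fun e => ¬ R ^ 2 ≤ 8 * ‖e.1 - e.2‖ ^ 2),
          (‖a - b‖ / 2) ^ p := by
          refine Finset.sum_le_sum fun e he => ?_
          have he2 := not_le.1 (Finset.mem_filter.1 he).2
          gcongr
          refine abs_le_of_sq_le_sq' (b := ‖a - b‖ / 2) ?_ (by positivity) |>.2
          rw [div_pow]
          linarith
      _ ≤ ∑ e ∈ S ×ˢ S, (‖a - b‖ / 2) ^ p :=
          Finset.sum_le_sum_of_subset_of_nonneg (Finset.filter_subset _ _)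
            fun _ _ _ => by positivity
      _ = (S.card ^ 2 : ℕ) * (‖a - b‖ / 2) ^ p := by simp [sq]
      _ ≤ (2 ^ p : ℕ) * (‖a - b‖ / 2) ^ p := by gcongr
      _ = _ := by push_cast; rw [← mul_pow]; congr 1; ring
  have h5 : ‖a - b‖ ^ p ≤ ∑ e ∈ far, ‖e.1 - e.2‖ ^ p := by
    refine pow_norm_sub_le_sum (Finset.mem_filter.2 ⟨Finset.mk_mem_product ha hb, ?_⟩)
    show R ^ 2 ≤ 8 * ‖a - b‖ ^ 2
    nlinarith [sq_nonneg ‖a - b‖]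
  have h6 : powerSum p S ≤ 2 * ∑ e ∈ far, ‖e.1 - e.2‖ ^ p := by
    rw [powerSum, ← Finset.sum_filter_add_sum_filter_not (S ×ˢ S)
      fun e => R ^ 2 ≤ 8 * ‖e.1 - e.2‖ ^ 2]
    linarith
  refine h3.trans ?_
  have h7 : (1 : ℝ) / (50 * d) = 2 * (1 / (100 * d)) := by field_simp; norm_num
  have h8 : (0 : ℝ) < 1 / (100 * d) := by positivity
  rw [h7]
  nlinarith

/-- By concavity of the `p`-th root (Bernoulli), the contraction of the power sum passes to the root
with rate divided by `p`. -/
lemma avg_spread_le (hp : p ≠ 0) (hε : 0 ≤ ε) (hε' : ε ≤ 1 / 320) (hS : 1 < S.card)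
    (hm : IsMedian S (med S)) (hcard : S.card ^ 2 ≤ 2 ^ p) :
    avg med ε x (spread p) S ≤ (1 - 1 / (100 * d * p)) * spread p S := by
  have hne : S.Nonempty := Finset.card_pos.1 (by omega)
  have hd : (0 : ℝ) < d := by exact_mod_cast Nat.pos_of_ne_zero (NeZero.ne d)
  have hp0 : (0 : ℝ) < p := by exact_mod_cast Nat.pos_of_ne_zero hp
  have hp1 : (1 : ℝ) ≤ p := by exact_mod_cast Nat.one_le_iff_ne_zero.2 hp
  obtain ⟨a, ha, b, hb, hab⟩ := Finset.one_lt_card.1 hS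
  have hM : 0 < spread p S :=
    (norm_pos_iff.2 (sub_ne_zero.2 hab)).trans_le (norm_sub_le_spread hp ha hb)
  have hQ : 0 < powerSum p S := by
    rcases (powerSum_nonneg (p := p) S).eq_or_lt with h | h
    · rw [spread, ← h, Real.zero_rpow (by positivity)] at hM
      exact absurd hM (lt_irrefl _)
    · exact h
  -- The slope of `u ↦ u ^ (1 / p)` at `powerSum p S`.
  set r := spread p S / (p * powerSum p S)
  have hpt : ∀ T ⊆ S, T.Nonempty →
      spread p T ≤ (1 - 1 / (p : ℝ)) * spread p S + r * powerSum p T := by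
    intro T _ _
    have h1 : spread p T = spread p S * (1 + (powerSum p T / powerSum p S - 1)) ^ (1 / (p : ℝ)) := by
      rw [spread, spread, ← Real.mul_rpow hQ.le (by
        have := div_nonneg (powerSum_nonneg (p := p) T) hQ.le; linarith)]
      congr 1
      field_simp
      ring
    rw [h1]
    have h2 := rpow_one_add_le_one_add_mul_self (s := powerSum p T / powerSum p S - 1)
      (p := 1 / (p : ℝ)) (by have := div_nonneg (powerSum_nonneg (p := p) T) hQ.le; linarith)
      (by positivity) (by rw [div_le_one hp0]; exact hp1)
    refine (mul_le_mul_of_nonneg_left h2 hM.le).trans (le_of_eq ?_)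
    simp only [r]
    field_simp
    ring
  refine (avg_mono hne hpt).trans ?_
  rw [avg_add, avg_const, avg_const_mul]
  have h3 := avg_powerSum_le (x := x) hε hε' hS hm hcard
  have hr : 0 ≤ r := by positivity
  refine (add_le_add_right (mul_le_mul_of_nonneg_left h3 hr) _).trans (le_of_eq ?_)
  simp only [r]
  field_simp
  ring

end Spread

end DivideAndShare

namespace DivideAndShare

variable {d : ℕ} {med : Finset (Point d) → Point d} {ε : ℝ} {S : Finset (Point d)} {x : Point d}
  {p : ℕ}

/-! ### Distances from `x` to a set of centers -/

section Distances

/-- The largest squared distance from `x` to a point of `S`. -/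
noncomputable def maxSqDist (x : Point d) (S : Finset (Point d)) : ℝ := ⨆ c : S, ‖x - c‖ ^ 2

/-- The smallest distance from `x` to a point of `S`. -/
noncomputable def minDist (x : Point d) (S : Finset (Point d)) : ℝ := ⨅ c : S, ‖x - c‖

lemma le_maxSqDist {c : Point d} (hc : c ∈ S) : ‖x - c‖ ^ 2 ≤ maxSqDist x S :=
  le_ciSup (f := fun c : S => ‖x - c‖ ^ 2) (Set.finite_range _).bddAbove ⟨c, hc⟩

lemma maxSqDist_le {r : ℝ} (hr : 0 ≤ r) (h : ∀ c ∈ S, ‖x - c‖ ^ 2 ≤ r) : maxSqDist x S ≤ r :=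
  Real.iSup_le (fun c => h c c.2) hr

lemma maxSqDist_nonneg : 0 ≤ maxSqDist x S := Real.iSup_nonneg fun _ => by positivity

lemma maxSqDist_mono {T : Finset (Point d)} (h : T ⊆ S) : maxSqDist x T ≤ maxSqDist x S :=
  maxSqDist_le maxSqDist_nonneg fun _ hc => le_maxSqDist (h hc)

lemma minDist_nonneg : 0 ≤ minDist x S := Real.iInf_nonneg fun _ => norm_nonneg _

lemma minDist_le {c : Point d} (hc : c ∈ S) : minDist x S ≤ ‖x - c‖ :=
  ciInf_le (f := fun c : S => ‖x - c‖) (Set.finite_range _).bddBelow ⟨c, hc⟩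

lemma exists_eq_minDist (hS : S.Nonempty) : ∃ c ∈ S, ‖x - c‖ = minDist x S := by
  have : Nonempty S := hS.to_subtype
  obtain ⟨c, hc⟩ := exists_eq_ciInf_of_finite (f := fun c : S => ‖x - c‖)
  exact ⟨c, c.2, hc⟩

lemma minDist_empty : minDist x (∅ : Finset (Point d)) = 0 := Real.iInf_of_isEmpty _

lemma minDist_anti {T : Finset (Point d)} (hT : T.Nonempty) (h : T ⊆ S) :
    minDist x S ≤ minDist x T := by
  obtain ⟨c, hc, hcd⟩ := exists_eq_minDist (x := x) hT
  rw [← hcd]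
  exact minDist_le (h hc)

lemma dist_le_add_two_radius {c c' : Point d} (hc : c ∈ S) (hc' : c' ∈ S) (m : Point d) :
    ‖x - c'‖ ≤ ‖x - c‖ + 2 * radius S m := by
  have h : x - c' = (x - c) + (c - c') := by abel
  rw [h]
  linarith [norm_add_le (x - c) (c - c'), norm_sub_le_two_radius hc hc' m]

end Distances

/-! ### A potential linear in the distance to `c` -/

section LinearPotential

open Classical in
/-- The potential that bounds the expected cost of `x` by its distance to `c` times the spread. -/
noncomputable def linPot (p : ℕ) (x c : Point d) (S : Finset (Point d)) : ℝ :=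
  if c ∈ S then 9 * ‖x - c‖ ^ 2 + 8000 * p * ‖x - c‖ * spread p S else maxSqDist x S

lemma linPot_nonneg (c : Point d) : 0 ≤ linPot p x c S := by
  unfold linPot
  split_ifs
  · have := spread_nonneg (p := p) S
    positivity
  · exact maxSqDist_nonneg

lemma maxSqDist_le_of_mem {T : Finset (Point d)} (hT : T ⊆ S) {c : Point d} (hc : c ∈ S) (m : Point d) :
    maxSqDist x T ≤ (‖x - c‖ + 2 * radius S m) ^ 2 :=
  maxSqDist_le (sq_nonneg _) fun c' hc' => by
    have := dist_le_add_two_radius (x := x) hc (hT hc') m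
    gcongr

variable [NeZero d]

/-- If `R ≤ D`, all centers are within `3 D` of `x` and the term `9 D²` covers a loss. If `D < R`, a
loss costs at most `9 R²` and has probability at most `6 D / (d R)`, in total `54 D R / d`. The
contraction of the spread releases `80 D M / d`, where `M` is the spread, and `54 R ≤ 80 M` because
`R² ≤ 2 M²`. -/
lemma avg_linPot_le (hp : p ≠ 0) (hε : 0 ≤ ε) (hε' : ε ≤ 1 / 320) (hS : 1 < S.card)
    (hm : IsMedian S (med S)) (hcard : S.card ^ 2 ≤ 2 ^ p) (c : Point d) :
    avg med ε x (linPot p x c) S ≤ linPot p x c S := by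
  classical
  have hne : S.Nonempty := Finset.card_pos.1 (by omega)
  have hd : (0 : ℝ) < d := by exact_mod_cast Nat.pos_of_ne_zero (NeZero.ne d)
  have hp0 : (0 : ℝ) < p := by exact_mod_cast Nat.pos_of_ne_zero hp
  by_cases hc : c ∈ S
  swap
  · rw [linPot, if_neg hc]
    refine avg_le_of_le hne fun T hT _ => ?_
    rw [linPot, if_neg fun h => hc (hT h)]
    exact maxSqDist_mono hT
  set D := ‖x - c‖
  have hD0 : 0 ≤ D := norm_nonneg _
  set R := radius S (med S)
  have hR : 0 < R := radius_pos hS _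
  have hM0 := spread_nonneg (p := p) S
  have hlin : linPot p x c S = 9 * D ^ 2 + 8000 * p * D * spread p S := by rw [linPot, if_pos hc]
  rw [hlin]
  rcases le_or_gt R D with hRD | hRD
  · refine avg_le_of_le hne fun T hT _ => ?_
    rw [linPot]
    split_ifs
    · have := spread_mono (p := p) hT
      gcongr
    · refine (maxSqDist_le_of_mem hT hc (med S)).trans ?_
      have h1 : (D + 2 * R) ^ 2 ≤ (3 * D) ^ 2 := by gcongr; linarith
      have h2 : 0 ≤ 8000 * p * D * spread p S := by positivity
      linarith
  · have hpt : ∀ T ⊆ S, T.Nonempty → linPot p x c T ≤ 9 * D ^ 2 + ((8000 * p * D) * spread p T +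
        9 * R ^ 2 * (if c ∉ T then 1 else 0)) := by
      intro T hT _
      have hMT := spread_nonneg (p := p) T
      rw [linPot]
      split_ifs with h
      · exact le_of_eq (by simp [D])
      · refine (maxSqDist_le_of_mem hT hc (med S)).trans ?_
        have h1 : (D + 2 * R) ^ 2 ≤ (3 * R) ^ 2 := by gcongr; linarith
        have h2 : 0 ≤ 8000 * p * D * spread p T := by positivity
        have h3 := sq_nonneg D
        linarith
    refine (avg_mono hne hpt).trans ?_
    rw [avg_add, avg_const, avg_add, avg_const_mul, avg_const_mul, sum_stepProb_eq fun T => c ∉ T]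
    have h1 := avg_spread_le (x := x) hp hε hε' hS hm hcard
    have h2 := lost_prob_le (med := med) (x := x) hε hε' hS hc
    have h3 : 3 * (R * D + D ^ 2) / (d * R ^ 2) ≤ 6 * D / (d * R) := by
      rw [div_le_div_iff₀ (by positivity) (by positivity)]
      have : 3 * (R * D + D ^ 2) * R ≤ 6 * D * R ^ 2 := by nlinarith [mul_nonneg hD0 hR.le]
      calc _ = d * (3 * (R * D + D ^ 2) * R) := by ring
        _ ≤ d * (6 * D * R ^ 2) := by gcongr
        _ = _ := by ring
    have h4 : 54 * R ≤ 80 * spread p S := by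
      have := radius_sq_le_spread hp hne hm
      refine abs_le_of_sq_le_sq' (b := 80 * spread p S) ?_ (by positivity) |>.2
      nlinarith [sq_nonneg (spread p S)]
    have h5 : 8000 * p * D * avg med ε x (spread p) S ≤
        8000 * p * D * spread p S - 80 * D * spread p S / d := by
      refine (mul_le_mul_of_nonneg_left h1 (by positivity)).trans (le_of_eq ?_)
      field_simp
      ring
    have h6 : 9 * R ^ 2 * (seedLaw d).real {s | c ∉ next med ε S s x} ≤ 80 * D * spread p S / d := by
      refine (mul_le_mul_of_nonneg_left (h2.trans h3) (by positivity)).trans ?_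
      calc 9 * R ^ 2 * (6 * D / (d * R)) = D * (54 * R) / d := by field_simp; ring
        _ ≤ D * (80 * spread p S) / d := by gcongr
        _ = _ := by ring
    linarith

end LinearPotential

/-! ### A potential active on logarithmically many scales -/

section LogPotential

/-- A concave function of `M` that grows like `log (M / δ)` for `M` between `δ` and `L * δ`. -/
noncomputable def logRatio (L δ M : ℝ) : ℝ := Real.log (L * (δ + M) / (L * δ + M))

variable {L δ M : ℝ}

lemma logRatio_nonneg (hL : 1 ≤ L) (hδ : 0 < δ) (hM : 0 ≤ M) : 0 ≤ logRatio L δ M := by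
  refine Real.log_nonneg ?_
  rw [le_div_iff₀ (by positivity)]
  nlinarith

lemma logRatio_le (hL : 1 ≤ L) (hδ : 0 < δ) (hM : 0 ≤ M) : logRatio L δ M ≤ Real.log L := by
  refine Real.log_le_log (by positivity) ?_
  rw [div_le_iff₀ (by positivity)]
  nlinarith [mul_nonneg (sub_nonneg.2 hL) hδ.le]

lemma logRatio_anti (hL : 1 ≤ L) (hδ : 0 < δ) {δ' : ℝ} (h : δ ≤ δ') (hM : 0 ≤ M) :
    logRatio L δ' M ≤ logRatio L δ M := by
  have hδ' : 0 < δ' := hδ.trans_le h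
  refine Real.log_le_log (by positivity) ?_
  rw [div_le_div_iff₀ (by positivity) (by positivity)]
  nlinarith [mul_nonneg (mul_nonneg (mul_nonneg (sub_nonneg.2 hL) (sub_nonneg.2 h)) hM) (zero_le_one.trans hL)]

/-- The slope is the derivative at `M`. The bound follows from `log t ≤ t - 1` for the quotient of
the two arguments, after enlarging `M'` to `M` in a denominator. -/
lemma logRatio_le_tangent (hL : 1 ≤ L) (hδ : 0 < δ) {M' : ℝ} (hM' : 0 ≤ M') (h : M' ≤ M) :
    logRatio L δ M' ≤ logRatio L δ M - (L - 1) * δ / ((δ + M) * (L * δ + M)) * (M - M') := by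
  have hM : 0 ≤ M := hM'.trans h
  set X := L * (δ + M) / (L * δ + M)
  set X' := L * (δ + M') / (L * δ + M')
  have hX : 0 < X := by positivity
  have hX' : 0 < X' := by positivity
  have h1 : Real.log X' - Real.log X ≤ X' / X - 1 := by
    rw [← Real.log_div hX'.ne' hX.ne']
    exact Real.log_le_sub_one_of_pos (by positivity)
  have h2 : X' / X - 1 = -((L - 1) * δ * (M - M') / ((δ + M) * (L * δ + M'))) := by
    simp only [X, X']
    field_simp
    ring
  have h3 : (L - 1) * δ * (M - M') / ((δ + M) * (L * δ + M)) ≤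
      (L - 1) * δ * (M - M') / ((δ + M) * (L * δ + M')) := by
    have : 0 ≤ (L - 1) * δ * (M - M') :=
      mul_nonneg (mul_nonneg (sub_nonneg.2 hL) hδ.le) (sub_nonneg.2 h)
    gcongr
  have h4 : (L - 1) * δ / ((δ + M) * (L * δ + M)) * (M - M') =
      (L - 1) * δ * (M - M') / ((δ + M) * (L * δ + M)) := by ring
  rw [h4]
  change Real.log X' ≤ Real.log X - _
  linarith

open Classical in
/-- `logRatio` at the distance from `x` to the set `T`, and `0` if `T` is empty. -/
noncomputable def logPot (L : ℝ) (x : Point d) (M : ℝ) (T : Finset (Point d)) : ℝ :=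
  if T.Nonempty then logRatio L (minDist x T) M else 0

lemma minDist_pos {T : Finset (Point d)} (hT : T.Nonempty) (hx : x ∉ T) : 0 < minDist x T := by
  obtain ⟨c, hc, hcd⟩ := exists_eq_minDist (x := x) hT
  rw [← hcd, norm_pos_iff, sub_ne_zero]
  rintro rfl
  exact hx hc

lemma logPot_nonneg {T : Finset (Point d)} (hL : 1 ≤ L) (hx : x ∉ T) (hM : 0 ≤ M) :
    0 ≤ logPot L x M T := by
  rw [logPot]
  split_ifs with h
  exacts [logRatio_nonneg hL (minDist_pos h hx) hM, le_rfl]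

lemma logPot_le {T : Finset (Point d)} (hL : 1 ≤ L) (hx : x ∉ T) (hM : 0 ≤ M) :
    logPot L x M T ≤ Real.log L := by
  rw [logPot]
  split_ifs with h
  exacts [logRatio_le hL (minDist_pos h hx) hM, Real.log_nonneg hL]

/-- Removing centers from `T` increases the distance to `x`, which only lowers `logRatio`, and the
value `0` at the empty set is harmless since `logRatio` is nonnegative. So only the decrease of the
spread has to be quantified. -/
lemma logPot_le_tangent {T T' : Finset (Point d)} (hTT : T' ⊆ T) (hT : T.Nonempty) (hL : 1 ≤ L)
    (hx : x ∉ T) {M' : ℝ} (hM' : 0 ≤ M') (h : M' ≤ M) :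
    logPot L x M' T' ≤ logPot L x M T -
      (L - 1) * minDist x T / ((minDist x T + M) * (L * minDist x T + M)) * (M - M') := by
  have h0 := minDist_pos hT hx
  have h1 := logRatio_le_tangent hL h0 hM' h
  rw [logPot, logPot, if_pos hT]
  split_ifs with hT'
  · exact (logRatio_anti hL h0 (minDist_anti hT' hTT) hM').trans h1
  · exact (logRatio_nonneg hL h0 hM').trans h1

lemma logPot_mono {T T' : Finset (Point d)} (hTT : T' ⊆ T) (hL : 1 ≤ L)
    (hx : x ∉ T) {M' : ℝ} (hM' : 0 ≤ M') (h : M' ≤ M) : logPot L x M' T' ≤ logPot L x M T := by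
  by_cases hT : T.Nonempty
  · refine (logPot_le_tangent hTT hT hL hx hM' h).trans (sub_le_self _ ?_)
    have h0 := minDist_pos hT hx
    have hM : 0 ≤ M := hM'.trans h
    have := sub_nonneg.2 hL
    have := sub_nonneg.2 h
    positivity
  · have hT' : ¬ T'.Nonempty := fun h => hT (h.mono hTT)
    rw [logPot, logPot, if_neg hT, if_neg hT']

end LogPotential

end DivideAndShare

namespace DivideAndShare

variable {d : ℕ} {med : Finset (Point d) → Point d} {ε : ℝ} {S S₀ : Finset (Point d)} {x : Point d}
  {p : ℕ}

/-! ### The potential for the cost of a point that is not a center -/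

section CostPotential

/-- The scale ratio beyond which the linear potential is the better bound. -/
noncomputable def ratioBound (p : ℕ) : ℝ := 27 + 32000 * p

lemma one_le_ratioBound : 1 ≤ ratioBound p := by
  unfold ratioBound
  have : (0 : ℝ) ≤ p := p.cast_nonneg
  linarith

/-- The best of the linear potentials. -/
noncomputable def minLinPot (p : ℕ) (x : Point d) (hS₀ : S₀.Nonempty) (T : Finset (Point d)) : ℝ :=
  S₀.inf' hS₀ fun c => linPot p x c T

open Classical in
/-- The potential that bounds the expected cost of `x`. -/
noncomputable def costPot (ε : ℝ) (p : ℕ) (x : Point d) (hS₀ : S₀.Nonempty) (c : Point d) (T : Finset (Point d)) : ℝ :=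
  if c ∈ T then 9 * ‖x - c‖ ^ 2 + 64800 * p / ε * ∑ A ∈ S₀.powerset,
    cutWeight x c S₀ A * logPot (ratioBound p) x (spread p T) (T ∩ A)
  else minLinPot p x hS₀ T

lemma minLinPot_nonneg (hS₀ : S₀.Nonempty) (T : Finset (Point d)) : 0 ≤ minLinPot p x hS₀ T :=
  Finset.le_inf' _ _ fun _ _ => linPot_nonneg _

lemma minLinPot_le (hS₀ : S₀.Nonempty) {c : Point d} (hc : c ∈ S₀) (T : Finset (Point d)) :
    minLinPot p x hS₀ T ≤ linPot p x c T :=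
  Finset.inf'_le _ hc

lemma sq_dist_le_linPot (c c' : Point d) : ‖x - c'‖ ^ 2 ≤ linPot p x c {c'} := by
  rw [linPot]
  split_ifs with h
  · rw [Finset.mem_singleton.1 h]
    have := spread_nonneg (p := p) ({c'} : Finset (Point d))
    have : 0 ≤ 8000 * p * ‖x - c'‖ * spread p {c'} := by positivity
    linarith [sq_nonneg ‖x - c'‖]
  · exact le_maxSqDist (Finset.mem_singleton_self c')

open Classical in
lemma sum_logPot_nonneg (hx : x ∉ S₀) (c : Point d) {T : Finset (Point d)} (hT : T ⊆ S₀) (M : ℝ)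
    (hM : 0 ≤ M) :
    0 ≤ ∑ A ∈ S₀.powerset, cutWeight x c S₀ A * logPot (ratioBound p) x M (T ∩ A) :=
  Finset.sum_nonneg fun _ _ => mul_nonneg (cutWeight_nonneg _ _ _ _)
    (logPot_nonneg one_le_ratioBound (fun h => hx (hT (Finset.mem_inter.1 h).1)) hM)

lemma costPot_nonneg (hε : 0 < ε) (hS₀ : S₀.Nonempty) (hx : x ∉ S₀) (c : Point d)
    {T : Finset (Point d)} (hT : T ⊆ S₀) : 0 ≤ costPot ε p x hS₀ c T := by
  rw [costPot]
  split_ifs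
  · have := sum_logPot_nonneg (p := p) hx c hT _ (spread_nonneg (p := p) T)
    positivity
  · exact minLinPot_nonneg _ _

lemma sq_dist_le_costPot (hε : 0 < ε) (hS₀ : S₀.Nonempty) (hx : x ∉ S₀) (c : Point d) {c' : Point d}
    (hc' : c' ∈ S₀) : ‖x - c'‖ ^ 2 ≤ costPot ε p x hS₀ c {c'} := by
  rw [costPot]
  split_ifs with h
  · have h1 := sum_logPot_nonneg (p := p) hx c (Finset.singleton_subset_iff.2 hc') _
      (spread_nonneg (p := p) {c'})
    rw [Finset.mem_singleton.1 h] at h1 ⊢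
    have := mul_nonneg (by positivity : 0 ≤ 64800 * (p : ℝ) / ε) h1
    linarith [sq_nonneg ‖x - c'‖]
  · exact Finset.le_inf' _ _ fun _ _ => sq_dist_le_linPot _ _

/-- The weights sum to at most `‖x - c‖²`, and each logarithm is at most `log L`. -/
lemma costPot_le (hε : 0 < ε) (hS₀ : S₀.Nonempty) (hx : x ∉ S₀) {c : Point d} (hc : c ∈ S₀) :
    costPot ε p x hS₀ c S₀ ≤ (9 + 64800 * p / ε * Real.log (ratioBound p)) * ‖x - c‖ ^ 2 := by
  rw [costPot, if_pos hc, add_mul, mul_assoc (64800 * (p : ℝ) / ε)]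
  gcongr
  calc _ ≤ ∑ A ∈ S₀.powerset, cutWeight x c S₀ A * Real.log (ratioBound p) := by
        refine Finset.sum_le_sum fun A _ => mul_le_mul_of_nonneg_left ?_ (cutWeight_nonneg _ _ _ _)
        exact logPot_le one_le_ratioBound (fun h => hx (Finset.mem_inter.1 h).1) (spread_nonneg _)
    _ ≤ ‖x - c‖ ^ 2 * Real.log (ratioBound p) := by
        rw [← Finset.sum_mul]
        exact mul_le_mul_of_nonneg_right (sum_cutWeight_le x c S₀)
          (Real.log_nonneg one_le_ratioBound)
    _ = _ := mul_comm _ _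

/-- A bound for the cost after the loss of the center `c`, as a function of the distance `δ` from
`x` to the nearest center that remains. -/
noncomputable def lossBound (L R δ : ℝ) : ℝ := 18 * R ^ 2 * (L * δ) / (9 * R + L * δ)

lemma lossBound_nonneg {L R δ : ℝ} (hL : 0 ≤ L) (hR : 0 ≤ R) (hδ : 0 ≤ δ) :
    0 ≤ lossBound L R δ := by
  unfold lossBound; positivity

/-- Two bounds compete: `9 R²`, since all of `S` is within `3 R` of `x`, and `L δ R`, from the
linear potential of the nearest center left. The loss bound is their harmonic mean, a smooth
majorant of the minimum that matches the slope of `logRatio`. -/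
lemma minLinPot_le_lossBound (hp : p ≠ 0) (hS : S.Nonempty) (hcard : S.card ^ 2 ≤ 2 ^ p) (hSS : S ⊆ S₀)
    (hS₀ : S₀.Nonempty) (hx : x ∉ S₀) {c : Point d} (hc : c ∈ S) {m : Point d}
    (hR : ‖x - c‖ ≤ radius S m) {T : Finset (Point d)} (hT : T ⊆ S) (hTne : T.Nonempty)
    (hcT : c ∉ T) :
    minLinPot p x hS₀ T ≤ lossBound (ratioBound p) (radius S m) (minDist x T) := by
  set R := radius S m
  have hR0 : 0 ≤ R := (norm_nonneg _).trans hR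
  have hδ := minDist_pos hTne fun h => hx (hSS (hT h))
  obtain ⟨c₂, hc₂, hc₂d⟩ := exists_eq_minDist (x := x) hTne
  set δ := minDist x T
  have hδR : δ ≤ 3 * R := by
    rw [← hc₂d]
    linarith [dist_le_add_two_radius (x := x) hc (hT hc₂) m]
  have h1 : minLinPot p x hS₀ T ≤ 9 * R ^ 2 := by
    refine (minLinPot_le hS₀ (hSS hc) T).trans ?_
    rw [linPot, if_neg hcT]
    refine (maxSqDist_le_of_mem hT hc m).trans ?_
    have : (‖x - c‖ + 2 * R) ^ 2 ≤ (3 * R) ^ 2 := by gcongr; linarith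
    linarith
  -- With `δ ≤ 3 R` and spread at most `4 R` the coefficient is `9 · 3 + 8000 p · 4`, the value of
  -- `ratioBound p`.
  have h2 : minLinPot p x hS₀ T ≤ ratioBound p * δ * R := by
    refine (minLinPot_le hS₀ (hSS (hT hc₂)) T).trans ?_
    rw [linPot, if_pos hc₂, hc₂d]
    have h3 : spread p T ≤ 4 * R := (spread_mono hT).trans (spread_le_four_radius hp hS hcard m)
    calc 9 * δ ^ 2 + 8000 * p * δ * spread p T ≤ 9 * (δ * (3 * R)) + 8000 * p * δ * (4 * R) := by
          rw [sq]; gcongr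
      _ = _ := by rw [ratioBound]; ring
  have hL : 0 < ratioBound p := zero_lt_one.trans_le one_le_ratioBound
  have hRpos : 0 < R := by linarith
  rw [lossBound, le_div_iff₀ (by positivity)]
  have h4 := mul_le_mul_of_nonneg_right h1 (by positivity : 0 ≤ ratioBound p * δ)
  have h5 := mul_le_mul_of_nonneg_right h2 (by positivity : 0 ≤ 9 * R)
  linarith

variable [NeZero d]

/-- A minimum of superharmonic functions is superharmonic. -/
lemma avg_minLinPot_le (hp : p ≠ 0) (hε : 0 ≤ ε) (hε' : ε ≤ 1 / 320) (hS : 1 < S.card)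
    (hm : IsMedian S (med S)) (hcard : S.card ^ 2 ≤ 2 ^ p) (hS₀ : S₀.Nonempty) :
    avg med ε x (minLinPot p x hS₀) S ≤ minLinPot p x hS₀ S :=
  Finset.le_inf' _ _ fun c hc =>
    (avg_mono (Finset.card_pos.1 (by omega)) fun T _ _ => minLinPot_le hS₀ hc T).trans
      (avg_linPot_le hp hε hε' hS hm hcard c)

open Classical in
/-- The expected bound for the cost after the loss of `c`, as a sum over the thresholds. -/
lemma avg_lossBound_le (hε : 0 < ε) (hε' : ε ≤ 1 / 320) (hS : 1 < S.card)
    (hSS : S ⊆ S₀) {c : Point d} (hc : c ∈ S) {L : ℝ} (hL : 0 ≤ L) :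
    avg med ε x (fun T => if c ∉ T then lossBound L (radius S (med S)) (minDist x T) else 0) S ≤
      3 / (ε * d * radius S (med S) ^ 2) * ∑ A ∈ S₀.powerset,
        cutWeight x c S₀ A * lossBound L (radius S (med S)) (minDist x (S ∩ A)) := by
  set R := radius S (med S)
  have hR : 0 < R := radius_pos hS _
  have hpos : ∀ T, 0 ≤ lossBound L R (minDist x T) := fun T => lossBound_nonneg hL hR.le minDist_nonneg
  set κ := 3 / (ε * d * R ^ 2)
  have hκ : 0 ≤ κ := by positivity
  have h1 : ∀ T ∈ S.powerset, stepProb med ε S x T *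
      (if c ∉ T then lossBound L R (minDist x T) else 0) ≤ κ * ∑ A ∈ S₀.powerset,
        if S ∩ A = T then cutWeight x c S₀ A * lossBound L R (minDist x (S ∩ A)) else 0 := by
    intro T _
    by_cases h : c ∉ T
    · rw [if_pos h]
      refine (mul_le_mul_of_nonneg_right (next_prob_le (x := x) hε hε' hS hSS hc h) (hpos T)).trans
        (le_of_eq ?_)
      rw [mul_assoc, Finset.sum_mul, Finset.sum_filter]
      congr 1
      refine Finset.sum_congr rfl fun A _ => ?_
      split_ifs with hA
      · rw [hA]
      · rfl
    · rw [if_neg h, mul_zero]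
      refine mul_nonneg hκ (Finset.sum_nonneg fun A _ => ?_)
      split_ifs
      exacts [mul_nonneg (cutWeight_nonneg _ _ _ _) (hpos _), le_rfl]
  refine (Finset.sum_le_sum h1).trans ?_
  rw [← Finset.mul_sum, Finset.sum_comm]
  gcongr with A _
  rw [Finset.sum_ite_eq]
  split_ifs
  exacts [le_rfl, mul_nonneg (cutWeight_nonneg _ _ _ _) (hpos _)]

open Classical in
/-- The logarithmic potential pays for the loss of `c`. -/
lemma avg_logPot_add_le (hp : p ≠ 0) (hε : 0 < ε) (hε' : ε ≤ 1 / 320) (hS : 1 < S.card)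
    (hm : IsMedian S (med S)) (hcard : S.card ^ 2 ≤ 2 ^ p) (hxS : x ∉ S)
    {c : Point d} (hc : c ∈ S) (hR : ‖x - c‖ ≤ radius S (med S)) (A : Finset (Point d)) :
    64800 * p / ε * avg med ε x (fun T => logPot (ratioBound p) x (spread p T) (T ∩ A)) S +
      3 / (ε * d * radius S (med S) ^ 2) *
        lossBound (ratioBound p) (radius S (med S)) (minDist x (S ∩ A)) ≤
    64800 * p / ε * logPot (ratioBound p) x (spread p S) (S ∩ A) := by
  have hne : S.Nonempty := Finset.card_pos.1 (by omega)
  have hd : (0 : ℝ) < d := by exact_mod_cast Nat.pos_of_ne_zero (NeZero.ne d)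
  have hp0 : (0 : ℝ) < p := by exact_mod_cast Nat.pos_of_ne_zero hp
  have hxA : x ∉ S ∩ A := fun h => hxS (Finset.mem_inter.1 h).1
  set R := radius S (med S)
  set L := ratioBound p with hLdef
  have hL : 1 ≤ L := one_le_ratioBound
  have hR0 : 0 < R := radius_pos hS _
  by_cases hSA : (S ∩ A).Nonempty
  swap
  -- No center of `S` belongs to `A`: the default distance `0` makes the loss bound vanish, and the
  -- potential is `0` too.
  · rw [Finset.not_nonempty_iff_eq_empty.1 hSA, minDist_empty, lossBound]
    simp only [mul_zero, zero_div, add_zero]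
    gcongr
    refine avg_le_of_le hne fun T hT _ => ?_
    have := logPot_mono (M := spread p S) (Finset.inter_subset_inter_right (u := A) hT) hL hxA
      (spread_nonneg T) (spread_mono hT)
    rwa [Finset.not_nonempty_iff_eq_empty.1 hSA] at this
  have hδ : 0 < minDist x (S ∩ A) := minDist_pos hSA hxA
  have hδR : minDist x (S ∩ A) ≤ 3 * R := by
    obtain ⟨c₂, hc₂⟩ := hSA
    refine (minDist_le hc₂).trans ?_
    linarith [dist_le_add_two_radius (x := x) hc (Finset.mem_inter.1 hc₂).1 (med S)]
  set δ := minDist x (S ∩ A)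
  have hM0 := spread_nonneg (p := p) S
  have hMR : spread p S ≤ 4 * R := spread_le_four_radius hp hne hcard _
  have hRM : R ^ 2 ≤ 2 * spread p S ^ 2 := radius_sq_le_spread hp hne hm
  have havg := avg_spread_le (x := x) hp hε.le hε' hS hm hcard
  set M := spread p S
  set g := (L - 1) * δ / ((δ + M) * (L * δ + M))
  have hg : 0 ≤ g := by
    have := sub_nonneg.2 hL
    positivity
  have h1 : avg med ε x (fun T => logPot L x (spread p T) (T ∩ A)) S ≤
      logPot L x M (S ∩ A) - g * (M / (100 * d * p)) := by
    have hpt : ∀ T ⊆ S, T.Nonempty → logPot L x (spread p T) (T ∩ A) ≤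
        (logPot L x M (S ∩ A) - g * M) + g * spread p T := by
      intro T hT _
      refine (logPot_le_tangent (Finset.inter_subset_inter_right hT) hSA hL hxA (spread_nonneg T)
        (spread_mono hT)).trans (le_of_eq ?_)
      ring
    refine (avg_mono hne hpt).trans ?_
    rw [avg_add, avg_const, avg_const_mul]
    have := mul_le_mul_of_nonneg_left havg hg
    have h2 : g * ((1 - 1 / (100 * d * p)) * M) = g * M - g * (M / (100 * d * p)) := by ring
    linarith
  have hMpos : 3 * R ≤ 5 * M := by
    refine abs_le_of_sq_le_sq' (b := 5 * M) ?_ (by positivity) |>.2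
    nlinarith [sq_nonneg M]
  have hLd : 0 < L * δ := by positivity
  -- This uses `L - 1 ≥ L / 2`, then `δ ≤ 3 R ≤ 5 M`, so that `δ + M ≤ 6 M`, and finally `M ≤ 4 R ≤
  -- 9 R`.
  have h2 : L * δ / (12 * (9 * R + L * δ)) ≤ g * M := by
    have h3 : g * M = ((L - 1) * δ * M) / ((δ + M) * (L * δ + M)) := by simp only [g]; ring
    rw [h3, div_le_div_iff₀ (by positivity) (by positivity)]
    have h27 : 2 ≤ L := by
      rw [hLdef, ratioBound]; linarith
    have h4 : L * δ ≤ 2 * ((L - 1) * δ) := by nlinarith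
    have h5 : δ + M ≤ 6 * M := by linarith
    have h6 : L * δ + M ≤ 9 * R + L * δ := by linarith
    calc L * δ * ((δ + M) * (L * δ + M)) ≤ 2 * ((L - 1) * δ) * (6 * M * (9 * R + L * δ)) := by
          have : 0 ≤ (L - 1) * δ := mul_nonneg (sub_nonneg.2 hL) hδ.le
          gcongr
      _ = _ := by ring
  -- The constants balance: `3 · 18 · 12 = 648 = 64800 / 100`, where `1 / 100` is from the
  -- contraction rate.
  have h3 : 3 / (ε * d * R ^ 2) * lossBound L R δ ≤ 64800 * p / ε * (g * (M / (100 * d * p))) := by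
    calc 3 / (ε * d * R ^ 2) * lossBound L R δ =
        648 / (ε * d) * (L * δ / (12 * (9 * R + L * δ))) := by
          rw [lossBound]; field_simp; norm_num
      _ ≤ 648 / (ε * d) * (g * M) := by gcongr
      _ = _ := by field_simp; ring
  have h4 := mul_le_mul_of_nonneg_left h1 (by positivity : 0 ≤ 64800 * (p : ℝ) / ε)
  rw [mul_sub] at h4
  linarith

/-- After the loss of `c` the potential is the best linear one. If `R ≤ ‖x - c‖`, the term `9 ‖x -
c‖²` pays for a loss. Otherwise the expected loss is distributed over the sets `A` according to
`cutWeight`, and for each `A` the drop of its own logarithm pays. -/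
lemma avg_costPot_le (hp : p ≠ 0) (hε : 0 < ε) (hε' : ε ≤ 1 / 320) (hS : 1 < S.card)
    (hm : IsMedian S (med S)) (hSS : S ⊆ S₀) (hcard : S₀.card ^ 2 ≤ 2 ^ p) (hS₀ : S₀.Nonempty)
    (hx : x ∉ S₀) (c : Point d) :
    avg med ε x (costPot ε p x hS₀ c) S ≤ costPot ε p x hS₀ c S := by
  classical
  have hne : S.Nonempty := Finset.card_pos.1 (by omega)
  have hcardS : S.card ^ 2 ≤ 2 ^ p :=
    (Nat.pow_le_pow_left (Finset.card_le_card hSS) 2).trans hcard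
  have hxS : x ∉ S := fun h => hx (hSS h)
  have hL : 1 ≤ ratioBound p := one_le_ratioBound
  by_cases hc : c ∈ S
  swap
  · rw [costPot, if_neg hc]
    refine le_trans (avg_mono hne fun T hT _ => ?_) (avg_minLinPot_le hp hε.le hε' hS hm hcardS hS₀)
    rw [costPot, if_neg fun h => hc (hT h)]
  rw [costPot, if_pos hc]
  set B := 64800 * (p : ℝ) / ε
  have hB : 0 ≤ B := by positivity
  set w := cutWeight x c S₀
  have hw : ∀ A, 0 ≤ w A := cutWeight_nonneg x c S₀
  rcases le_or_gt (radius S (med S)) ‖x - c‖ with hRD | hRD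
  · refine avg_le_of_le hne fun T hT _ => ?_
    rw [costPot]
    split_ifs
    · gcongr with A _
      · exact hw A
      · exact logPot_mono (Finset.inter_subset_inter_right hT) hL
          (fun h => hxS (Finset.mem_inter.1 h).1) (spread_nonneg T) (spread_mono hT)
    · rename_i hcT
      refine (minLinPot_le hS₀ (hSS hc) T).trans ?_
      rw [linPot, if_neg hcT]
      refine (maxSqDist_le_of_mem hT hc (med S)).trans ?_
      have h0 : 0 ≤ radius S (med S) := (radius_pos hS _).le
      have h1 : (‖x - c‖ + 2 * radius S (med S)) ^ 2 ≤ (3 * ‖x - c‖) ^ 2 := by gcongr; linarith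
      have h2 := mul_nonneg hB (sum_logPot_nonneg (p := p) hx c hSS _ (spread_nonneg (p := p) S))
      linarith
  · have hpt : ∀ T ⊆ S, T.Nonempty → costPot ε p x hS₀ c T ≤ 9 * ‖x - c‖ ^ 2 +
        (B * ∑ A ∈ S₀.powerset, w A * logPot (ratioBound p) x (spread p T) (T ∩ A) +
        if c ∉ T then lossBound (ratioBound p) (radius S (med S)) (minDist x T) else 0) := by
      intro T hT hTne
      rw [costPot]
      by_cases hcT : c ∈ T
      · rw [if_pos hcT, if_neg (not_not.2 hcT), add_zero]
      · rw [if_neg hcT, if_pos hcT]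
        have h1 := minLinPot_le_lossBound hp hne hcardS hSS hS₀ hx hc hRD.le hT hTne hcT
        have h2 := mul_nonneg hB
          (sum_logPot_nonneg (p := p) hx c (hT.trans hSS) _ (spread_nonneg (p := p) T))
        have h3 := sq_nonneg ‖x - c‖
        linarith
    refine (avg_mono hne hpt).trans ?_
    rw [avg_add, avg_const, avg_add, avg_const_mul, avg_sum]
    gcongr ?_ + ?_
    · exact le_rfl
    have h1 := avg_lossBound_le (med := med) (x := x) hε hε' hS hSS hc
      (zero_le_one.trans hL)
    refine (add_le_add_right h1 _).trans ?_
    rw [Finset.mul_sum, Finset.mul_sum, Finset.mul_sum, ← Finset.sum_add_distrib]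
    refine Finset.sum_le_sum fun A _ => ?_
    rw [avg_const_mul]
    have h2 := mul_le_mul_of_nonneg_left
      (avg_logPot_add_le hp hε hε' hS hm hcardS hxS hc hRD.le A) (hw A)
    linarith

end CostPotential

end DivideAndShare

namespace DivideAndShare

variable {d : ℕ} {med : Finset (Point d) → Point d} {ε : ℝ} {S : Finset (Point d)} {s : Seed d}

/-! ### The potential for the number of leaves -/

section LeafPotential

/-- The potential of a leaf with `n` centers, which bounds the expected number of leaves below. -/
noncomputable def leafPot (β : ℝ) (n : ℕ) : ℝ := n * (1 + β * Real.log n)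

variable {β : ℝ}

lemma leafPot_nonneg (hβ : 0 ≤ β) (n : ℕ) : 0 ≤ leafPot β n := by
  have := Real.log_natCast_nonneg n
  unfold leafPot
  positivity

lemma one_le_leafPot (hβ : 0 ≤ β) {n : ℕ} (hn : 1 ≤ n) : 1 ≤ leafPot β n := by
  have h1 := Real.log_natCast_nonneg n
  have h2 : (1 : ℝ) ≤ n := by exact_mod_cast hn
  unfold leafPot
  nlinarith [mul_nonneg hβ h1]

/-- Each of the `f` centers on the small side has `log f ≤ log n - log 2` and saves `β log 2`; each
of the `s` duplicated centers adds at most `1 + β log n`. -/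
lemma leafPot_add_le (hβ : 0 ≤ β) {n s y f : ℕ} (hn : 1 ≤ n) (hy : y + f = n + s) (hyn : y ≤ n)
    (hf : 2 * f ≤ n) :
    leafPot β y + leafPot β f ≤
      leafPot β n + ((1 + β * Real.log n) * s - β * Real.log 2 * f) := by
  have hn0 : (0 : ℝ) < n := by exact_mod_cast hn
  have h1 : (y : ℝ) * Real.log y ≤ y * Real.log n := by
    rcases Nat.eq_zero_or_pos y with rfl | hy0
    · simp
    · gcongr
  have h2 : (f : ℝ) * Real.log f ≤ f * (Real.log n - Real.log 2) := by
    rcases Nat.eq_zero_or_pos f with rfl | hf0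
    · simp
    · rw [← Real.log_div hn0.ne' (by norm_num)]
      have : (f : ℝ) ≤ n / 2 := by
        rw [le_div_iff₀ (by norm_num), mul_comm]
        exact_mod_cast hf
      gcongr
  have h3 : (y : ℝ) + f = n + s := by exact_mod_cast hy
  unfold leafPot
  have h4 := mul_le_mul_of_nonneg_left (add_le_add h1 h2) hβ
  have h5 : (y : ℝ) = n + s - f := by linarith
  rw [h5] at h4 ⊢
  linarith

/-- The child on the side of the cut that does not contain the median. -/
noncomputable def farSet (med : Finset (Point d) → Point d) (ε : ℝ) (S : Finset (Point d))
    (s : Seed d) : Finset (Point d) := if s.2.2 then rightSet med ε S s else leftSet med ε S s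

open Classical in
/-- The centers that are given to both children. -/
noncomputable def sharedSet (med : Finset (Point d) → Point d) (ε : ℝ) (S : Finset (Point d))
    (s : Seed d) : Finset (Point d) := leftSet med ε S s ∩ rightSet med ε S s

lemma farSet_subset : farSet med ε S s ⊆ S := by
  unfold farSet
  split_ifs
  exacts [rightSet_subset, leftSet_subset]

lemma sharedSet_subset : sharedSet med ε S s ⊆ S := by
  classical
  exact Finset.inter_subset_left.trans leftSet_subset

lemma leftSet_union_rightSet [DecidableEq (Point d)] (hε : 0 ≤ ε) (hS : 1 < S.card) :
    leftSet med ε S s ∪ rightSet med ε S s = S := by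
  have hw : 0 ≤ width med ε S s := width_nonneg hε hS
  ext c
  rw [Finset.mem_union, mem_leftSet, mem_rightSet, ← and_or_left, and_iff_left_iff_imp]
  intro _
  by_contra! h
  linarith [h.1, h.2]

/-- As `ε < 1` and `θ > 0`, the strip does not reach the median. The far child therefore contains
only centers strictly beyond it, at most half, and any center weakly on the other side of it is in
the near child. -/
lemma card_farSet_and_near (hε : 0 ≤ ε) (hε' : ε < 1) (hS : 1 < S.card) (hm : IsMedian S (med S))
    (hθ : 0 < s.2.1) : 2 * (farSet med ε S s).card ≤ S.card ∧
      (if s.2.2 then leftSet med ε S s else rightSet med ε S s).Nonempty := by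
  classical
  have hR := radius_pos hS (med S)
  have hr : 0 < √s.2.1 * radius S (med S) := mul_pos (Real.sqrt_pos.2 hθ) hR
  have hw : 0 ≤ width med ε S s := width_nonneg hε hS
  have hwr : width med ε S s < √s.2.1 * radius S (med S) := by
    rw [width, mul_assoc]
    nlinarith
  obtain ⟨hm1, hm2⟩ := hm s.1
  have hne : ∀ q : Point d → Prop, 2 * (S.filter q).card ≤ S.card → ∃ c ∈ S, ¬ q c := by
    intro q hq
    by_contra! h
    rw [Finset.filter_true_of_mem h] at hq
    omega
  rcases hσ : s.2.2 with _ | _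
  · have hcut : cut med S s = med S s.1 - √s.2.1 * radius S (med S) := by
      rw [cut, hσ]; simp [sgn]; ring
    constructor
    · refine le_trans ?_ hm1
      gcongr
      intro c hc
      rw [farSet, hσ, if_neg (by simp), mem_leftSet] at hc
      exact Finset.mem_filter.2 ⟨hc.1, by linarith [hc.2]⟩
    · obtain ⟨c, hc, hcm⟩ := hne _ hm1
      rw [if_neg (by simp)]
      exact ⟨c, mem_rightSet.2 ⟨hc, by linarith⟩⟩
  · have hcut : cut med S s = med S s.1 + √s.2.1 * radius S (med S) := by
      rw [cut, hσ]; simp [sgn]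
    constructor
    · refine le_trans ?_ hm2
      gcongr
      intro c hc
      rw [farSet, hσ, if_pos rfl, mem_rightSet] at hc
      exact Finset.mem_filter.2 ⟨hc.1, by linarith [hc.2]⟩
    · obtain ⟨c, hc, hcm⟩ := hne _ hm2
      rw [if_pos rfl]
      exact ⟨c, mem_leftSet.2 ⟨hc, by linarith⟩⟩

lemma sum_leafPot_children_le (hβ : 0 ≤ β) (hε : 0 ≤ ε) (hε' : ε < 1) (hS : 1 < S.card)
    (hm : IsMedian S (med S)) (hθ : 0 < s.2.1) :
    ((divideAndShare med ε s S).leaves.map fun A => leafPot β A.card).sum ≤ leafPot β S.card +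
      ((1 + β * Real.log S.card) * (sharedSet med ε S s).card -
        β * Real.log 2 * (farSet med ε S s).card) := by
  classical
  obtain ⟨hfar, hnear⟩ := card_farSet_and_near hε hε' hS hm hθ
  have hcard := Finset.card_union_add_card_inter (leftSet med ε S s) (rightSet med ε S s)
  rw [leftSet_union_rightSet hε hS] at hcard
  have hL := Finset.card_le_card (leftSet_subset (med := med) (ε := ε) (S := S) (s := s))
  have hR := Finset.card_le_card (rightSet_subset (med := med) (ε := ε) (S := S) (s := s))
  have hsh : sharedSet med ε S s = leftSet med ε S s ∩ rightSet med ε S s := by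
    unfold sharedSet; congr!
  rw [divideAndShare_eq]
  by_cases hsplit : (leftSet med ε S s).Nonempty ∧ (rightSet med ε S s).Nonempty
  · rw [if_pos hsplit]
    simp only [ThresholdTree.leaves, List.singleton_append, List.map_cons, List.map_nil,
      List.sum_cons, List.sum_nil, add_zero]
    rw [hsh]
    unfold farSet at hfar ⊢
    split_ifs at hfar ⊢
    · exact leafPot_add_le hβ (by omega) (by omega) hL hfar
    · rw [add_comm (leafPot β _)]
      exact leafPot_add_le hβ (by omega) (by omega) hR hfar
  · rw [if_neg hsplit]
    -- The near part is never empty, so an unsuccessful cut means that the far part, and with it the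
    -- shared part, is empty.
    have h0 : farSet med ε S s = ∅ ∧ sharedSet med ε S s = ∅ := by
      rw [hsh]
      unfold farSet
      split_ifs at hnear ⊢
      · have : rightSet med ε S s = ∅ := Finset.not_nonempty_iff_eq_empty.1 fun h => hsplit ⟨hnear, h⟩
        simp [this]
      · have : leftSet med ε S s = ∅ := Finset.not_nonempty_iff_eq_empty.1 fun h => hsplit ⟨h, hnear⟩
        simp [this]
    simp [ThresholdTree.leaves, h0.1, h0.2]

/-- Here `α` is the offset of the center from the median in the direction of the cut. Sharing
requires `√θ R` to lie in `[α / (1 + ε), α / (1 - ε)]`, of measure about `4 ε (α / R)²`. Membership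
in the far child is guaranteed once `√θ R < α`, of measure `(α / R)²`. The ratio does not depend on
the scale, by the quadratic law of `√θ`. -/
lemma volume_shared_le {R α κ τ : ℝ} (hR : 0 < R) (hε : 0 ≤ ε) (hε' : ε ≤ 1 / 320) (hα : |α| ≤ R)
    (hκ : 0 ≤ κ) (hτ : 41 / 10 * ε * κ ≤ τ) {B C : Set ℝ}
    (hB : ∀ θ ∈ B ∩ Set.Ioo 0 1, (1 - ε) * (√θ * R) ≤ α ∧ α ≤ (1 + ε) * (√θ * R))
    (hC : ∀ θ ∈ Set.Ioo (0 : ℝ) 1, (1 - ε) * (√θ * R) ≤ α → θ ∈ C) :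
    κ * volume.real (B ∩ Set.Ioo 0 1) ≤ τ * volume.real (C ∩ Set.Ioo 0 1) := by
  have hp : 0 < 1 + ε := by linarith
  have hn : 0 < 1 - ε := by linarith
  have hτ0 : 0 ≤ τ := le_trans (by positivity) hτ
  rcases lt_or_ge α 0 with h | h
  · have : B ∩ Set.Ioo 0 1 = ∅ := by
      refine Set.eq_empty_of_forall_notMem fun θ hθ => ?_
      have h1 := (hB θ hθ).1
      have h2 : 0 ≤ (1 - ε) * (√θ * R) := by positivity
      linarith
    rw [this, measureReal_empty, mul_zero]
    exact mul_nonneg hτ0 measureReal_nonneg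
  · have hαR : α ≤ R := (le_abs_self α).trans hα
    have h1 : volume.real (B ∩ Set.Ioo 0 1) ≤ (α / ((1 - ε) * R)) ^ 2 - (α / ((1 + ε) * R)) ^ 2 := by
      refine volume_le_sq_sub_sq (by positivity) ?_ fun θ hθ => ?_
      · gcongr
        linarith
      · obtain ⟨h2, h3⟩ := hB θ hθ
        rw [div_le_iff₀ (by positivity), le_div_iff₀ (by positivity)]
        constructor <;> linarith
    have h2 : (α / R) ^ 2 ≤ volume.real (C ∩ Set.Ioo 0 1) := by
      have := sq_sub_sq_le_volume (u := -1) (v := α / R) (B := C) ((div_le_one hR).2 hαR)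
        fun θ hθ _ h2 => hC θ hθ (by
          rw [lt_div_iff₀ hR] at h2
          have : 0 ≤ √θ * R := by positivity
          nlinarith)
      rw [max_eq_left (by positivity), max_eq_right (by norm_num)] at this
      linarith
    have h3 : (α / ((1 - ε) * R)) ^ 2 - (α / ((1 + ε) * R)) ^ 2 ≤ 41 / 10 * ε * (α / R) ^ 2 := by
      have h4 : (α / ((1 - ε) * R)) ^ 2 - (α / ((1 + ε) * R)) ^ 2 =
          (α / R) ^ 2 * (4 * ε / ((1 - ε) * (1 + ε)) ^ 2) := by
        field_simp
        ring
      rw [h4, mul_comm]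
      gcongr
      rw [div_le_iff₀ (by positivity)]
      nlinarith [mul_nonneg hε hε, mul_nonneg hε (mul_nonneg hε hε),
        mul_nonneg (mul_nonneg hε hε) (mul_nonneg hε (mul_nonneg hε hε)), mul_nonneg hε (sub_nonneg.2 hε'),
        mul_nonneg (mul_nonneg hε hε) (sub_nonneg.2 hε')]
    calc κ * volume.real (B ∩ Set.Ioo 0 1) ≤ κ * (41 / 10 * ε * (α / R) ^ 2) := by
          gcongr
          exact h1.trans h3
      _ = 41 / 10 * ε * κ * (α / R) ^ 2 := by ring
      _ ≤ τ * volume.real (C ∩ Set.Ioo 0 1) := by gcongr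

lemma measurableSet_mem_farSet (c : Point d) : MeasurableSet {s | c ∈ farSet med ε S s} := by
  have hb : MeasurableSet {s : Seed d | s.2.2 = true} :=
    (measurable_snd.comp measurable_snd) (measurableSet_singleton true)
  have : {s | c ∈ farSet med ε S s} = ({s : Seed d | s.2.2 = true} ∩ {s | c ∈ rightSet med ε S s}) ∪
      ({s : Seed d | s.2.2 = true}ᶜ ∩ {s | c ∈ leftSet med ε S s}) := by
    ext s
    by_cases h : s.2.2 = true <;> simp [farSet, h]
  rw [this]
  exact (hb.inter (measurableSet_sides fun _ B => c ∈ B)).union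
    (hb.compl.inter (measurableSet_sides fun A _ => c ∈ A))

lemma measurableSet_mem_sharedSet (c : Point d) : MeasurableSet {s | c ∈ sharedSet med ε S s} :=
  measurableSet_sides fun A B => by classical exact c ∈ A ∩ B

variable [NeZero d]

lemma shared_prob_le (hε : 0 ≤ ε) (hε' : ε ≤ 1 / 320) (hS : 1 < S.card) {c : Point d} (hc : c ∈ S)
    {κ τ : ℝ} (hκ : 0 ≤ κ) (hτ : 41 / 10 * ε * κ ≤ τ) :
    κ * (seedLaw d).real {s | c ∈ sharedSet med ε S s} ≤
      τ * (seedLaw d).real {s | c ∈ farSet med ε S s} := by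
  classical
  set R := radius S (med S)
  have hR : 0 < R := radius_pos hS _
  rw [seedLaw_real_eq (measurableSet_mem_sharedSet c), seedLaw_real_eq (measurableSet_mem_farSet c),
    mul_left_comm, mul_left_comm τ]
  refine mul_le_mul_of_nonneg_left ?_ (by positivity)
  rw [Finset.mul_sum, Finset.mul_sum]
  refine Finset.sum_le_sum fun i _ => ?_
  rw [Finset.mul_sum, Finset.mul_sum]
  refine Finset.sum_le_sum fun σ _ => ?_
  have habs := abs_coord_sub_le_radius hc (med S) i
  have hsg : sgn σ = 1 ∨ sgn σ = -1 := by cases σ <;> simp [sgn]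
  refine volume_shared_le (α := sgn σ * (c i - med S i)) hR hε hε' ?_ hκ hτ ?_ ?_
  · rcases hsg with h | h <;> simpa [h, abs_sub_comm] using habs
  · rintro θ ⟨hθ, -⟩
    have hθ : c ∈ leftSet med ε S (i, θ, σ) ∩ rightSet med ε S (i, θ, σ) := by
      have : c ∈ sharedSet med ε S (i, θ, σ) := hθ
      unfold sharedSet at this
      convert! this
    rw [Finset.mem_inter, mem_leftSet, mem_rightSet] at hθ
    obtain ⟨⟨-, h1⟩, -, h2⟩ := hθ
    simp only [cut, width] at h1 h2
    rcases hsg with h | h <;> rw [h] at h1 h2 ⊢ <;> constructor <;> linarith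
  · intro θ hθ h1
    change c ∈ farSet med ε S (i, θ, σ)
    unfold farSet
    cases σ
    · rw [if_neg (by simp), mem_leftSet]
      refine ⟨hc, ?_⟩
      simp only [cut, width, sgn] at h1 ⊢
      norm_num at h1 ⊢
      linarith
    · rw [if_pos rfl, mem_rightSet]
      refine ⟨hc, ?_⟩
      simp only [cut, width, sgn] at h1 ⊢
      norm_num at h1 ⊢
      linarith

lemma ae_pos_seed : ∀ᵐ s ∂seedLaw d, 0 < s.2.1 := by
  have hm : MeasurableSet {s : Seed d | ¬ 0 < s.2.1} :=
    (measurableSet_lt measurable_const (measurable_fst.comp measurable_snd)).compl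
  rw [ae_iff, ← measureReal_eq_zero_iff, seedLaw_real_eq hm]
  refine mul_eq_zero_of_right _ (Finset.sum_eq_zero fun i _ => Finset.sum_eq_zero fun σ _ => ?_)
  have : {θ : ℝ | (i, θ, σ) ∈ {s : Seed d | ¬ 0 < s.2.1}} ∩ Set.Ioo 0 1 = ∅ :=
    Set.eq_empty_of_forall_notMem fun θ hθ => hθ.1 hθ.2.1
  rw [this, measureReal_empty]

/-- The leaf potential is superharmonic for one call of Divide-and-Share. -/
lemma lintegral_leafPot_le (hβ : 0 ≤ β) (hε : 0 ≤ ε) (hε' : ε ≤ 1 / 320) (hS : 1 < S.card)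
    (hm : IsMedian S (med S))
    (hεβ : 41 / 10 * ε * (1 + β * Real.log S.card) ≤ β * Real.log 2) :
    ∫⁻ s, ENNReal.ofReal ((divideAndShare med ε s S).leaves.map fun A => leafPot β A.card).sum
      ∂seedLaw d ≤ ENNReal.ofReal (leafPot β S.card) := by
  classical
  set κ := 1 + β * Real.log S.card
  set τ := β * Real.log 2
  have hκ : 0 ≤ κ := by
    have := Real.log_natCast_nonneg S.card
    positivity
  have hcard : ∀ A : Finset (Point d), A ⊆ S →
      (A.card : ℝ) = ∑ c ∈ S, if c ∈ A then (1 : ℝ) else 0 := by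
    intro A hA
    rw [Finset.sum_ite_mem, Finset.inter_eq_right.2 hA]
    simp
  set h : Seed d → ℝ := fun s => leafPot β S.card + ∑ c ∈ S,
    (κ * {s | c ∈ sharedSet med ε S s}.indicator (fun _ => (1 : ℝ)) s -
      τ * {s | c ∈ farSet med ε S s}.indicator (fun _ => (1 : ℝ)) s)
  have hle : ∀ s : Seed d, 0 < s.2.1 →
      ((divideAndShare med ε s S).leaves.map fun A => leafPot β A.card).sum ≤ h s := by
    intro s hs
    refine (sum_leafPot_children_le hβ hε (by linarith) hS hm hs).trans (le_of_eq ?_)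
    simp only [h]
    rw [Finset.sum_sub_distrib, ← Finset.mul_sum, ← Finset.mul_sum, hcard _ sharedSet_subset,
      hcard _ farSet_subset]
    simp only [Set.indicator_apply, Set.mem_ofPred_eq]
    rfl
  have hnn : ∀ s, 0 ≤ ((divideAndShare med ε s S).leaves.map fun A => leafPot β A.card).sum := by
    intro s
    refine List.sum_nonneg fun r hr => ?_
    obtain ⟨A, -, rfl⟩ := List.mem_map.1 hr
    exact leafPot_nonneg hβ _
  have hi : ∀ {B : Set (Seed d)}, MeasurableSet B →
      Integrable (B.indicator fun _ => (1 : ℝ)) (seedLaw d) := fun hB =>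
    (integrable_const _).indicator hB
  have hi' : ∀ c ∈ S, Integrable (fun s =>
      κ * {s | c ∈ sharedSet med ε S s}.indicator (fun _ => (1 : ℝ)) s -
      τ * {s | c ∈ farSet med ε S s}.indicator (fun _ => (1 : ℝ)) s) (seedLaw d) := fun c _ =>
    ((hi (measurableSet_mem_sharedSet c)).const_mul _).sub
      ((hi (measurableSet_mem_farSet c)).const_mul _)
  have hint : Integrable h (seedLaw d) := (integrable_const _).add (integrable_finsetSum _ hi')
  calc _ ≤ ∫⁻ s, ENNReal.ofReal (h s) ∂seedLaw d := by
        refine lintegral_mono_ae ?_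
        filter_upwards [ae_pos_seed] with s hs
        exact ENNReal.ofReal_le_ofReal (hle s hs)
    _ = ENNReal.ofReal (∫ s, h s ∂seedLaw d) := by
        rw [ofReal_integral_eq_lintegral_ofReal hint]
        filter_upwards [ae_pos_seed] with s hs
        exact (hnn s).trans (hle s hs)
    _ ≤ _ := by
        refine ENNReal.ofReal_le_ofReal ?_
        simp only [h]
        rw [integral_add (integrable_const _) (integrable_finsetSum _ hi'), integral_const,
          integral_finsetSum _ hi']
        simp only [probReal_univ, one_smul]
        have : ∀ c ∈ S, ∫ s, (κ * {s | c ∈ sharedSet med ε S s}.indicator (fun _ => (1 : ℝ)) s -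
            τ * {s | c ∈ farSet med ε S s}.indicator (fun _ => (1 : ℝ)) s) ∂seedLaw d ≤ 0 := by
          intro c hc
          rw [integral_sub ((hi (measurableSet_mem_sharedSet c)).const_mul _)
            ((hi (measurableSet_mem_farSet c)).const_mul _), integral_const_mul,
            integral_const_mul, integral_indicator_const _ (measurableSet_mem_sharedSet c),
            integral_indicator_const _ (measurableSet_mem_farSet c)]
          have := shared_prob_le (med := med) hε hε' hS hc hκ hεβ
          simp only [smul_eq_mul, mul_one]
          linarith
        linarith [Finset.sum_nonpos this]

/-- A leaf with at least two centers is split with probability at least `1 / (50 d)`. -/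
lemma le_lintegral_length (hε : 0 ≤ ε) (hε' : ε ≤ 1 / 320) (hS : 1 < S.card)
    (hm : IsMedian S (med S)) :
    1 + ENNReal.ofReal (1 / (50 * d)) ≤
      ∫⁻ s, ((divideAndShare med ε s S).leaves.length : ENNReal) ∂seedLaw d := by
  classical
  have hne : S.Nonempty := Finset.card_pos.1 (by omega)
  obtain ⟨a, ha, b, hb, hab⟩ := exists_max_dist hne
  have hRab : radius S (med S) ^ 2 ≤ 2 * ‖a - b‖ ^ 2 := radius_sq_le hne hm hab
  have h1 := separates_prob (med := med) hε hε' hS ha hb (by nlinarith [sq_nonneg ‖a - b‖])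
  have h2 : ∀ s, 1 + {s | Separates med ε S a b s}.indicator (fun _ => (1 : ENNReal)) s ≤
      ((divideAndShare med ε s S).leaves.length : ENNReal) := by
    intro s
    rw [divideAndShare_eq]
    by_cases hs : Separates med ε S a b s
    · rw [if_pos (hs.nonempty hε hS ha hb), Set.indicator_of_mem (by exact hs)]
      simp [ThresholdTree.leaves, one_add_one_eq_two]
    · rw [Set.indicator_of_notMem (by exact hs)]
      split_ifs <;> simp [ThresholdTree.leaves]
  refine le_trans ?_ (lintegral_mono h2)
  rw [lintegral_add_left measurable_const, lintegral_indicator_const (measurableSet_separates a b)]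
  simp only [lintegral_const, measure_univ, one_mul]
  gcongr
  rw [← ofReal_measureReal]
  exact ENNReal.ofReal_le_ofReal h1

end LeafPotential

end DivideAndShare

namespace DivideAndShare

variable {d : ℕ} {med : Finset (Point d) → Point d} {ε : ℝ} {S S₀ : Finset (Point d)} {s : Seed d}

/-! ### The list of leaves as a Markov chain -/

section Leaves

/-- The leaves that replace a leaf with center set `S` in one iteration. -/
noncomputable def leafStep (med : Finset (Point d) → Point d) (ε : ℝ) (S : Finset (Point d))
    (s : Seed d) : List (Finset (Point d)) :=
  if 1 < S.card then (divideAndShare med ε s S).leaves else [S]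

/-- The effect of one iteration on the list of leaves. -/
noncomputable def listStep (med : Finset (Point d) → Point d) (ε : ℝ)
    (l : List (Finset (Point d))) (s : Seed d) : List (Finset (Point d)) :=
  l.flatMap fun S => leafStep med ε S s

/-- The effect of one iteration on the center set of the cell of `x`. -/
noncomputable def cellStep (med : Finset (Point d) → Point d) (ε : ℝ) (x : Point d)
    (S : Finset (Point d)) (s : Seed d) : Finset (Point d) :=
  if 1 < S.card then next med ε S s x else S

lemma leaves_step (T : ThresholdTree d) :
    (step med ε s T).leaves = listStep med ε T.leaves s := by
  induction T with
  | leaf S =>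
    rw [step, listStep, ThresholdTree.leaves, List.flatMap_singleton, leafStep]
    split_ifs <;> rfl
  | node i ξ l r hl hr =>
    rw [step, ThresholdTree.leaves, ThresholdTree.leaves, hl, hr, listStep, listStep, listStep,
      List.flatMap_append]

lemma centersAt_step (T : ThresholdTree d) (x : Point d) :
    (step med ε s T).centersAt x = cellStep med ε x (T.centersAt x) s := by
  induction T with
  | leaf S =>
    rw [step, ThresholdTree.centersAt, cellStep]
    split_ifs <;> rfl
  | node i ξ l r hl hr =>
    rw [step, ThresholdTree.centersAt, ThresholdTree.centersAt]
    split_ifs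
    exacts [hl, hr]

open Classical in
/-- The finite set of all centers. -/
noncomputable def centerSet {k : ℕ} (c : Fin k → Point d) : Finset (Point d) := Finset.univ.image c

lemma leaves_treeAt {k : ℕ} (med : Finset (Point d) → Point d) (δ : ℝ) (c : Fin k → Point d)
    (ω : ℕ → Seed d) (t : ℕ) : (treeAt med δ c ω t).leaves =
      chain (listStep med (margin k δ)) [centerSet c] ω t := by
  induction t with
  | zero => rfl
  | succ t ih => rw [treeAt, leaves_step, ih, chain]

lemma centersAt_treeAt {k : ℕ} (med : Finset (Point d) → Point d) (δ : ℝ) (c : Fin k → Point d)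
    (ω : ℕ → Seed d) (t : ℕ) (x : Point d) : (treeAt med δ c ω t).centersAt x =
      chain (cellStep med (margin k δ) x) (centerSet c) ω t := by
  induction t with
  | zero => rfl
  | succ t ih => rw [treeAt, centersAt_step, ih, chain]

lemma leafStep_eq [DecidableEq (Point d)] : leafStep med ε S s =
    if 1 < S.card ∧ (leftSet med ε S s).Nonempty ∧ (rightSet med ε S s).Nonempty then
      [leftSet med ε S s, rightSet med ε S s] else [S] := by
  rw [leafStep]
  split_ifs with h1 h2 h2
  · rw [divideAndShare_eq, if_pos h2.2]; rfl
  · rw [divideAndShare_eq, if_neg fun h => h2 ⟨h1, h⟩]; rfl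
  · exact absurd h2.1 h1
  · rfl

/-- The lists of nonempty subsets of `S₀`. -/
def goodLists (S₀ : Finset (Point d)) : Set (List (Finset (Point d))) :=
  {l | ∀ A ∈ l, A ∈ {A : Finset (Point d) | A ⊆ S₀ ∧ A.Nonempty}}

lemma countable_goodSets (S₀ : Finset (Point d)) :
    {A : Finset (Point d) | A ⊆ S₀ ∧ A.Nonempty}.Countable :=
  (S₀.powerset.countable_toSet).mono fun _ hA => Finset.mem_coe.2 (Finset.mem_powerset.2 hA.1)

lemma countable_goodLists (S₀ : Finset (Point d)) : (goodLists S₀).Countable := by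
  have : Countable {A : Finset (Point d) | A ⊆ S₀ ∧ A.Nonempty} := countable_goodSets S₀
  rw [goodLists, ← Set.range_list_map_coe]
  exact Set.countable_range _

lemma leafStep_mem (hS : S ⊆ S₀) (hne : S.Nonempty) : leafStep med ε S s ∈ goodLists S₀ := by
  classical
  intro A hA
  rw [leafStep_eq] at hA
  split_ifs at hA with h
  · rw [List.mem_pair] at hA
    rcases hA with rfl | rfl
    exacts [⟨leftSet_subset.trans hS, h.2.1⟩, ⟨rightSet_subset.trans hS, h.2.2⟩]
  · rw [List.mem_singleton.1 hA]
    exact ⟨hS, hne⟩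

lemma listStep_mem {l : List (Finset (Point d))} (hl : l ∈ goodLists S₀) :
    listStep med ε l s ∈ goodLists S₀ := by
  intro A hA
  obtain ⟨S, hS, hAS⟩ := List.mem_flatMap.1 hA
  exact leafStep_mem (hl S hS).1 (hl S hS).2 A hAS

lemma cellStep_mem {x : Point d} (h : S ⊆ S₀ ∧ S.Nonempty) :
    cellStep med ε x S s ⊆ S₀ ∧ (cellStep med ε x S s).Nonempty := by
  unfold cellStep
  split_ifs
  exacts [⟨(next_subset x).trans h.1, next_nonempty h.2 x⟩, h]

lemma measurable_comp_leafStep {γ : Type*} [MeasurableSpace γ] (g : List (Finset (Point d)) → γ) :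
    Measurable fun s => g (leafStep med ε S s) := fun B _ => by
  classical
  simp only [leafStep_eq]
  exact measurableSet_sides fun L R =>
    g (if 1 < S.card ∧ L.Nonempty ∧ R.Nonempty then [L, R] else [S]) ∈ B

/-- The descendants of the first leaf form a prefix of `l'`; take the union over the countably many
places where that prefix may end. -/
lemma measurableSet_listStep (l l' : List (Finset (Point d))) :
    MeasurableSet {s | listStep med ε l s = l'} := by
  induction l generalizing l' with
  | nil => exact MeasurableSet.const ([] = l')
  | cons S l ih =>
    have : {s | listStep med ε (S :: l) s = l'} =
        ⋃ n : ℕ, {s | leafStep med ε S s = l'.take n} ∩ {s | listStep med ε l s = l'.drop n} := by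
      ext s
      simp only [Set.mem_iUnion, Set.mem_inter_iff, Set.mem_ofPred_eq]
      constructor
      · rintro rfl
        refine ⟨(leafStep med ε S s).length, ?_, ?_⟩ <;> simp [listStep]
      · rintro ⟨n, h1, h2⟩
        rw [← List.take_append_drop n l', ← h1, ← h2]
        simp [listStep]
    rw [this]
    refine MeasurableSet.iUnion fun n => MeasurableSet.inter ?_ (ih _)
    simpa using measurable_comp_leafStep (med := med) (ε := ε) (S := S) (fun l => l = l'.take n)
      (measurableSet_singleton True)

lemma measurableSet_cellStep (x : Point d) (S T : Finset (Point d)) :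
    MeasurableSet {s | cellStep med ε x S s = T} := by
  unfold cellStep
  split_ifs
  exacts [measurableSet_next x fun T' => T' = T, MeasurableSet.const _]

/-- The sum of `h` over the entries of a list. -/
noncomputable def listSum (h : Finset (Point d) → ENNReal) (l : List (Finset (Point d))) :
    ENNReal := (l.map h).sum

lemma listSum_append (h : Finset (Point d) → ENNReal) (l l' : List (Finset (Point d))) :
    listSum h (l ++ l') = listSum h l + listSum h l' := by
  simp [listSum]

lemma listSum_mono {h h' : Finset (Point d) → ENNReal} {l : List (Finset (Point d))}
    (H : ∀ A ∈ l, h A ≤ h' A) : listSum h l ≤ listSum h' l := List.sum_le_sum H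

lemma listSum_add (h h' : Finset (Point d) → ENNReal) (l : List (Finset (Point d))) :
    listSum (fun A => h A + h' A) l = listSum h l + listSum h' l := by
  induction l with
  | nil => simp [listSum]
  | cons A l ih =>
    simp only [listSum, List.map_cons, List.sum_cons] at ih ⊢
    rw [ih]
    ring

lemma listSum_const_mul (r : ENNReal) (h : Finset (Point d) → ENNReal)
    (l : List (Finset (Point d))) : listSum (fun A => r * h A) l = r * listSum h l := by
  simp [listSum, List.sum_map_mul_left]

lemma listSum_ofReal {h : Finset (Point d) → ℝ} (hh : ∀ A, 0 ≤ h A) (l : List (Finset (Point d))) :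
    listSum (fun A => ENNReal.ofReal (h A)) l = ENNReal.ofReal (l.map h).sum := by
  induction l with
  | nil => simp [listSum]
  | cons A l ih =>
    have h0 : 0 ≤ (l.map h).sum := List.sum_nonneg fun r hr => by
      obtain ⟨A, -, rfl⟩ := List.mem_map.1 hr
      exact hh A
    simp only [listSum, List.map_cons, List.sum_cons] at ih ⊢
    rw [ih, ENNReal.ofReal_add (hh A) h0]

lemma listSum_one (l : List (Finset (Point d))) : listSum (fun _ => 1) l = l.length := by
  simp [listSum]

/-- The number of entries with at least two centers. -/
noncomputable def numActive (l : List (Finset (Point d))) : ENNReal :=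
  listSum (fun A => if 1 < A.card then 1 else 0) l

variable [NeZero d]

/-- All leaves use the same seed and are not independent, but additive quantities need only
linearity of the integral. -/
lemma lintegral_listStep (h : Finset (Point d) → ENNReal) (l : List (Finset (Point d))) :
    ∫⁻ s, listSum h (listStep med ε l s) ∂seedLaw d =
      listSum (fun S => ∫⁻ s, listSum h (leafStep med ε S s) ∂seedLaw d) l := by
  induction l with
  | nil => simp [listStep, listSum]
  | cons S l ih =>
    have : ∀ s, listSum h (listStep med ε (S :: l) s) =
        listSum h (leafStep med ε S s) + listSum h (listStep med ε l s) := fun s => by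
      rw [listStep, List.flatMap_cons, listSum_append, listStep]
    simp_rw [this]
    rw [lintegral_add_left (measurable_comp_leafStep _), ih]
    simp [listSum]

section Chain

variable {β : ℝ} (hε : 0 ≤ ε) (hε' : ε ≤ 1 / 320)
  (hmed : ∀ S, S.Nonempty → IsMedian S (med S))
include hε hε' hmed

lemma lintegral_listSum_leafPot_le (hβ : 0 ≤ β)
    (hεβ : 41 / 10 * ε * (1 + β * Real.log S₀.card) ≤ β * Real.log 2)
    {l : List (Finset (Point d))} (hl : l ∈ goodLists S₀) :
    ∫⁻ s, listSum (fun A => ENNReal.ofReal (leafPot β A.card)) (listStep med ε l s) ∂seedLaw d ≤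
      listSum (fun A => ENNReal.ofReal (leafPot β A.card)) l := by
  rw [lintegral_listStep]
  refine listSum_mono fun S hS => ?_
  obtain ⟨hSS, hne⟩ := hl S hS
  by_cases h : 1 < S.card
  · have hcard : 41 / 10 * ε * (1 + β * Real.log S.card) ≤ β * Real.log 2 := by
      refine le_trans ?_ hεβ
      have h0 : (0 : ℝ) < S.card := by exact_mod_cast hne.card_pos
      have h1 : (S.card : ℝ) ≤ S₀.card := by exact_mod_cast Finset.card_le_card hSS
      gcongr
    refine le_trans (le_of_eq ?_) (lintegral_leafPot_le hβ hε hε' h (hmed S hne) hcard)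
    refine lintegral_congr fun s => ?_
    rw [leafStep, if_pos h, listSum_ofReal fun A => leafPot_nonneg hβ A.card]
  · simp [leafStep, h, listSum]

lemma le_lintegral_length_listStep {l : List (Finset (Point d))} (hl : l ∈ goodLists S₀) :
    (l.length : ENNReal) + ENNReal.ofReal (1 / (50 * d)) * numActive l ≤
      ∫⁻ s, ((listStep med ε l s).length : ENNReal) ∂seedLaw d := by
  simp_rw [← listSum_one]
  rw [lintegral_listStep, numActive, ← listSum_const_mul, ← listSum_add]
  refine listSum_mono fun S hS => ?_
  simp_rw [listSum_one]
  by_cases h : 1 < S.card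
  · simp only [leafStep, if_pos h, mul_one]
    exact le_lintegral_length hε hε' h (hmed S (hl S hS).2)
  · simp [leafStep, h]

lemma lintegral_length_le (hβ : 0 ≤ β)
    (hεβ : 41 / 10 * ε * (1 + β * Real.log S₀.card) ≤ β * Real.log 2) (hS₀ : S₀.Nonempty) (t : ℕ) :
    ∫⁻ ω, ((chain (listStep med ε) [S₀] ω t).length : ENNReal) ∂randomness d ≤
      ENNReal.ofReal (leafPot β S₀.card) := by
  have h₀ : [S₀] ∈ goodLists S₀ := by
    intro A hA
    rw [List.mem_singleton.1 hA]
    exact ⟨subset_rfl, hS₀⟩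
  have h1 := lintegral_chain_le (seedLaw d) (countable_goodLists S₀) h₀
    (fun l hl s => listStep_mem (med := med) (ε := ε) hl)
    (fun l _ l' _ => measurableSet_listStep l l')
    (listSum fun A => ENNReal.ofReal (leafPot β A.card))
    (fun l hl => lintegral_listSum_leafPot_le hε hε' hmed hβ hεβ hl) t
  refine le_trans (lintegral_mono fun ω => ?_) (h1.trans (le_of_eq (by simp [listSum])))
  rw [← listSum_one]
  refine listSum_mono fun A hA => ?_
  rw [← ENNReal.ofReal_one]
  refine ENNReal.ofReal_le_ofReal (one_le_leafPot hβ ?_)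
  exact (chain_mem h₀ (fun l hl s => listStep_mem (med := med) (ε := ε) hl) ω t A hA).2.card_pos

/-- Telescoping: each iteration raises the expected number of leaves by at least the expected number
of active leaves divided by `50 d`, while that number never exceeds the initial leaf potential. -/
lemma sum_lintegral_numActive_le (hβ : 0 ≤ β)
    (hεβ : 41 / 10 * ε * (1 + β * Real.log S₀.card) ≤ β * Real.log 2) (hS₀ : S₀.Nonempty) (n : ℕ) :
    ∑ t ∈ Finset.range n, ∫⁻ ω, numActive (chain (listStep med ε) [S₀] ω t) ∂randomness d ≤
      ENNReal.ofReal (50 * d * leafPot β S₀.card) := by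
  have hd : (0 : ℝ) < d := by exact_mod_cast Nat.pos_of_ne_zero (NeZero.ne d)
  have h₀ : [S₀] ∈ goodLists S₀ := by
    intro A hA
    rw [List.mem_singleton.1 hA]
    exact ⟨subset_rfl, hS₀⟩
  set q := ENNReal.ofReal (1 / (50 * d))
  have key : q * ∑ t ∈ Finset.range n,
      ∫⁻ ω, numActive (chain (listStep med ε) [S₀] ω t) ∂randomness d ≤
      ∫⁻ ω, ((chain (listStep med ε) [S₀] ω n).length : ENNReal) ∂randomness d := by
    induction n with
    | zero => simp
    | succ n ih =>
      have hmeas : Measurable fun ω => ((chain (listStep med ε) [S₀] ω n).length : ENNReal) :=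
        measurable_comp_chain (countable_goodLists S₀) h₀
          (fun l hl s => listStep_mem (med := med) (ε := ε) hl)
          (fun l _ l' _ => measurableSet_listStep l l') n (fun l => (l.length : ENNReal))
      have h1 : ∫⁻ ω, ((chain (listStep med ε) [S₀] ω (n + 1)).length : ENNReal) ∂randomness d =
          ∫⁻ ω, ∫⁻ s, ((listStep med ε (chain (listStep med ε) [S₀] ω n) s).length : ENNReal)
            ∂seedLaw d ∂randomness d := by
        refine lintegral_chain (seedLaw d) (countable_goodLists S₀) h₀
          (fun l hl s => listStep_mem (med := med) (ε := ε) hl)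
          (fun l _ l' _ => measurableSet_listStep l l') n
          (fun l s => ((listStep med ε l s).length : ENNReal)) fun l _ => ?_
        clear * -
        induction l with
        | nil => simp [listStep]
        | cons S l ih =>
          have : (fun s => ((listStep med ε (S :: l) s).length : ENNReal)) = fun s =>
              ((leafStep med ε S s).length : ENNReal) + ((listStep med ε l s).length : ENNReal) := by
            ext s
            simp [listStep]
          rw [this]
          exact (measurable_comp_leafStep fun l => (l.length : ENNReal)).add ih
      rw [h1, Finset.sum_range_succ, mul_add]
      refine (add_le_add_left ih _).trans ?_
      rw [← lintegral_const_mul' _ _ ENNReal.ofReal_ne_top, ← lintegral_add_left hmeas]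
      exact lintegral_mono fun ω => le_lintegral_length_listStep hε hε' hmed
        (chain_mem h₀ (fun l hl s => listStep_mem (med := med) (ε := ε) hl) ω n)
  have h2 := key.trans (lintegral_length_le hε hε' hmed hβ hεβ hS₀ n)
  have h3 := mul_le_mul_right h2 (ENNReal.ofReal (50 * d))
  rw [← mul_assoc, ← ENNReal.ofReal_mul (by positivity), ← ENNReal.ofReal_mul (by positivity)] at h3
  rwa [mul_one_div_cancel (by positivity), ENNReal.ofReal_one, one_mul] at h3

end Chain

end Leaves

end DivideAndShare

namespace DivideAndShare

/-! ### The halting time and the operations before it -/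

section Halting

variable {d k : ℕ} {med : Finset (Point d) → Point d} {ε δ : ℝ} {c : Fin k → Point d}
  {ω : ℕ → Seed d}

lemma step_eq_self {s : Seed d} {T : ThresholdTree d} (h : T.Finished) : step med ε s T = T := by
  induction T with
  | leaf S =>
    have : ¬ 1 < S.card := not_lt.2 (h S (List.mem_singleton_self S))
    rw [step, if_neg this]
  | node i ξ l r hl hr =>
    rw [step, hl fun S hS => h S (List.mem_append_left _ hS),
      hr fun S hS => h S (List.mem_append_right _ hS)]

lemma finished_finalTree (h : ∃ t, (treeAt med δ c ω t).Finished) :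
    (finalTree med δ c ω).Finished :=
  Nat.sInf_mem (s := {t | (treeAt med δ c ω t).Finished}) h

lemma treeAt_eq_finalTree (h : ∃ t, (treeAt med δ c ω t).Finished) {t : ℕ}
    (ht : haltTime med δ c ω ≤ t) : treeAt med δ c ω t = finalTree med δ c ω := by
  induction t, ht using Nat.le_induction with
  | base => rfl
  | succ t _ ih => rw [treeAt, ih, step_eq_self (finished_finalTree h)]

lemma finished_treeAt_iff (h : ∃ t, (treeAt med δ c ω t).Finished) (t : ℕ) :
    (treeAt med δ c ω t).Finished ↔ haltTime med δ c ω ≤ t := by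
  constructor
  · intro ht
    exact Nat.sInf_le ht
  · intro ht
    rw [treeAt_eq_finalTree h ht]
    exact finished_finalTree h

lemma numActive_eq (l : List (Finset (Point d))) :
    numActive l = (l.filter fun A => 1 < A.card).length := by
  induction l with
  | nil => simp [numActive, listSum]
  | cons A l ih =>
    simp only [numActive, listSum, List.map_cons, List.sum_cons] at ih ⊢
    rw [ih]
    by_cases h : 1 < A.card
    · simp [h, add_comm]
    · simp [h]

lemma finished_iff (T : ThresholdTree d) : T.Finished ↔ numActive T.leaves = 0 := by
  rw [numActive_eq, Nat.cast_eq_zero, List.length_eq_zero_iff, List.filter_eq_nil_iff]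
  simp [ThresholdTree.Finished]

/-- The operations of one iteration on a tree with the given leaves, and `0` if the algorithm has
stopped. -/
noncomputable def listOps (d : ℕ) (l : List (Finset (Point d))) : ℕ := by
  classical exact if numActive l = 0 then 0 else
    3 + ((l.filter fun S => 1 < S.card).map fun S => callOps d S.card).sum

/-- A finished tree is charged nothing, so the partial sums are eventually constant; this makes the
running time a limit to which Fatou's lemma applies. -/
lemma runningTime_eq (h : ∃ t, (treeAt med δ c ω t).Finished) {n : ℕ}
    (hn : haltTime med δ c ω ≤ n) :
    ∑ t ∈ Finset.range n, listOps d (treeAt med δ c ω t).leaves = runningTime med δ c ω := by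
  rw [runningTime, ← Finset.sum_subset (Finset.range_subset_range.2 hn)]
  · refine Finset.sum_congr rfl fun t ht => ?_
    have : ¬ (treeAt med δ c ω t).Finished := fun hf =>
      absurd ((finished_treeAt_iff h t).1 hf) (not_le.2 (Finset.mem_range.1 ht))
    rw [finished_iff] at this
    rw [listOps, if_neg this, iterationOps]
  · intro t _ ht
    have : (treeAt med δ c ω t).Finished :=
      (finished_treeAt_iff h t).2 (not_lt.1 fun h' => ht (Finset.mem_range.2 h'))
    rw [finished_iff] at this
    rw [listOps, if_pos this]

lemma callOps_mono {d m n : ℕ} (h : m ≤ n) : callOps d m ≤ callOps d n := by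
  unfold callOps
  gcongr

lemma listOps_le {S₀ : Finset (Point d)} {l : List (Finset (Point d))} (hl : l ∈ goodLists S₀) :
    (listOps d l : ENNReal) ≤ (3 + callOps d S₀.card : ℕ) * numActive l := by
  unfold listOps
  split_ifs with h
  · simp
  rw [numActive_eq] at h ⊢
  have h1 : 1 ≤ (l.filter fun A => 1 < A.card).length := by
    rw [Nat.one_le_iff_ne_zero]
    exact fun h' => h (by rw [h', Nat.cast_zero])
  have h2 : ((l.filter fun S => 1 < S.card).map fun S => callOps d S.card).sum ≤
      (l.filter fun A => 1 < A.card).length * callOps d S₀.card := by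
    have := List.sum_le_card_nsmul ((l.filter fun S => 1 < S.card).map fun S => callOps d S.card)
      (callOps d S₀.card) (by
        intro r hr
        obtain ⟨A, hA, rfl⟩ := List.mem_map.1 hr
        exact callOps_mono (Finset.card_le_card (hl A (List.mem_filter.1 hA).1).1))
    simpa using this
  -- At least one leaf is active, so the three random draws can be charged to it.
  have h3 : 3 + ((l.filter fun S => 1 < S.card).map fun S => callOps d S.card).sum ≤
      (3 + callOps d S₀.card) * (l.filter fun A => 1 < A.card).length := by nlinarith
  exact_mod_cast h3

end Halting

/-! ### From superharmonic potentials to expectations at the halting time -/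

section Bounds

variable {d k : ℕ} {med : Finset (Point d) → Point d} {δ : ℝ} {c : Fin k → Point d}
  {S₀ : Finset (Point d)}

lemma singleton_mem_goodLists (hS₀ : S₀.Nonempty) : [S₀] ∈ goodLists S₀ := by
  intro A hA
  rw [List.mem_singleton.1 hA]
  exact ⟨subset_rfl, hS₀⟩

lemma measurable_comp_leaves {ε : ℝ} (hS₀ : S₀.Nonempty) (t : ℕ) {γ : Type*} [MeasurableSpace γ]
    (g : List (Finset (Point d)) → γ) :
    Measurable fun ω => g (chain (listStep med ε) [S₀] ω t) :=
  measurable_comp_chain (countable_goodLists S₀) (singleton_mem_goodLists hS₀)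
    (fun _ hl _ => listStep_mem hl) (fun l _ l' _ => measurableSet_listStep l l') t g

open Classical in
/-- The center chosen from a set of centers. -/
noncomputable def chosen (A : Finset (Point d)) : Point d := if h : A.Nonempty then h.choose else 0

lemma chosen_singleton (a : Point d) : chosen {a} = a := by
  have h : ({a} : Finset (Point d)).Nonempty := Finset.singleton_nonempty a
  rw [chosen, dif_pos h]
  exact Finset.mem_singleton.1 h.choose_spec

variable [NeZero d]

/-- A superharmonic function that dominates the cost at single centers bounds the expected cost. -/
lemma integral_cost_le (hS₀ : (centerSet c).Nonempty)
    (hfin : ∀ᵐ ω ∂randomness d, ∃ t, (treeAt med δ c ω t).Finished) (x : Point d)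
    {V : Finset (Point d) → ℝ} (hV0 : ∀ T ⊆ centerSet c, 0 ≤ V T)
    (hV1 : ∀ a ∈ centerSet c, ‖x - a‖ ^ 2 ≤ V {a})
    (hV : ∀ S ⊆ centerSet c, 1 < S.card → avg med (margin k δ) x V S ≤ V S) :
    Integrable (fun ω => ‖x - (finalTree med δ c ω).assign x‖ ^ 2) (randomness d) ∧
      ∫ ω, ‖x - (finalTree med δ c ω).assign x‖ ^ 2 ∂randomness d ≤
        V (centerSet c) := by
  set S₀ := centerSet c
  set ε := margin k δ
  set I := {A : Finset (Point d) | A ⊆ S₀ ∧ A.Nonempty}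
  have hmem : S₀ ∈ I := ⟨subset_rfl, hS₀⟩
  have hI : ∀ A ∈ I, ∀ s, cellStep med ε x A s ∈ I := fun A hA s => cellStep_mem hA
  have hm : ∀ A ∈ I, ∀ A' ∈ I, MeasurableSet {s | cellStep med ε x A s = A'} :=
    fun A _ A' _ => measurableSet_cellStep x A A'
  -- Set to `0` before the cell is a singleton, so that `f ≤ V` holds at all times; after halting it
  -- equals the cost of `x`.
  set f : Finset (Point d) → ℝ := fun A => if A.card = 1 then ‖x - chosen A‖ ^ 2 else 0
  refine integrable_of_tendsto_of_lintegral_le (hV0 _ subset_rfl)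
    (f := fun t ω => f (chain (cellStep med ε x) S₀ ω t))
    (fun t => measurable_comp_chain (countable_goodSets S₀) hmem hI hm t f)
    (fun ω => by positivity) ?_ fun t => ?_
  · filter_upwards [hfin] with ω hω
    refine tendsto_const_nhds.congr' ?_
    filter_upwards [Filter.eventually_ge_atTop (haltTime med δ c ω)] with t ht
    have h1 := centersAt_treeAt med δ c ω t x
    rw [treeAt_eq_finalTree hω ht] at h1
    have h2 : chain (cellStep med ε x) S₀ ω t = (finalTree med δ c ω).centersAt x := h1.symm
    have h3 : ((finalTree med δ c ω).centersAt x).card = 1 := by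
      refine le_antisymm ?_ ?_
      · refine finished_finalTree hω _ ?_
        generalize finalTree med δ c ω = T
        induction T with
        | leaf S => exact List.mem_singleton_self S
        | node i ξ l r hl hr =>
          rw [ThresholdTree.centersAt, ThresholdTree.leaves]
          split_ifs
          exacts [List.mem_append_left _ hl, List.mem_append_right _ hr]
      · rw [← h2]
        exact (chain_mem hmem hI ω t).2.card_pos
    simp only [f]
    rw [h2, if_pos h3]
    rfl
  · have h1 : ∀ A ∈ I, f A ≤ V A := by
      intro A hA
      simp only [f]
      split_ifs with h
      · obtain ⟨a, rfl⟩ := Finset.card_eq_one.1 h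
        rw [chosen_singleton]
        exact hV1 a (hA.1 (Finset.mem_singleton_self a))
      · exact hV0 A hA.1
    refine le_trans (lintegral_mono fun ω => ENNReal.ofReal_le_ofReal
      (h1 _ (chain_mem hmem hI ω t))) ?_
    refine lintegral_chain_le (seedLaw d) (countable_goodSets S₀) hmem hI hm
      (fun A => ENNReal.ofReal (V A)) (fun A hA => ?_) t
    unfold cellStep
    by_cases h : 1 < A.card
    · simp only [if_pos h]
      rw [lintegral_next fun T hT => hV0 T (hT.trans hA.1)]
      exact ENNReal.ofReal_le_ofReal (hV A hA.1 h)
    · simp only [if_neg h]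
      simp

variable {β : ℝ}

/-- The total number of active leaves over all times has finite expectation, hence is almost surely
finite; if the algorithm never stopped, each iteration would contribute at least `1`. -/
lemma ae_finished (hε : 0 ≤ margin k δ) (hε' : margin k δ ≤ 1 / 320)
    (hmed : ∀ S, S.Nonempty → IsMedian S (med S)) (hβ : 0 ≤ β)
    (hS₀ : (centerSet c).Nonempty)
    (hεβ : 41 / 10 * margin k δ *
      (1 + β * Real.log (centerSet c).card) ≤
        β * Real.log 2) :
    ∀ᵐ ω ∂randomness d, ∃ t, (treeAt med δ c ω t).Finished := by
  set S₀ := centerSet c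
  set X : (ℕ → Seed d) → ℕ → List (Finset (Point d)) := chain (listStep med (margin k δ)) [S₀]
  have hmeas : ∀ t, Measurable fun ω => numActive (X ω t) := fun t =>
    measurable_comp_leaves hS₀ t numActive
  have h1 : ∫⁻ ω, ∑' t, numActive (X ω t) ∂randomness d ≤
      ENNReal.ofReal (50 * d * leafPot β S₀.card) := by
    rw [lintegral_tsum fun t => (hmeas t).aemeasurable]
    refine ENNReal.tsum_le_of_sum_range_le fun n => ?_
    exact sum_lintegral_numActive_le hε hε' hmed hβ hεβ hS₀ n
  have h2 : ∀ᵐ ω ∂randomness d, ∑' t, numActive (X ω t) < ⊤ :=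
    ae_lt_top (Measurable.tsum hmeas) (h1.trans_lt ENNReal.ofReal_lt_top).ne
  filter_upwards [h2] with ω hω
  by_contra! hnot
  have h3 : ∀ t, 1 ≤ numActive (X ω t) := by
    intro t
    have := hnot t
    rw [finished_iff, leaves_treeAt] at this
    rw [numActive_eq] at this ⊢
    rw [Nat.cast_eq_zero] at this
    exact_mod_cast Nat.one_le_iff_ne_zero.2 this
  have h4 : ∑' _ : ℕ, (1 : ENNReal) ≤ ∑' t, numActive (X ω t) := ENNReal.tsum_le_tsum h3
  rw [ENNReal.tsum_const_eq_top_of_ne_zero one_ne_zero] at h4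
  exact absurd hω (not_lt.2 h4)

lemma integral_numLeaves_le (hε : 0 ≤ margin k δ) (hε' : margin k δ ≤ 1 / 320)
    (hmed : ∀ S, S.Nonempty → IsMedian S (med S)) (hβ : 0 ≤ β)
    (hS₀ : (centerSet c).Nonempty)
    (hεβ : 41 / 10 * margin k δ *
      (1 + β * Real.log (centerSet c).card) ≤
        β * Real.log 2)
    (hfin : ∀ᵐ ω ∂randomness d, ∃ t, (treeAt med δ c ω t).Finished) :
    Integrable (fun ω => ((finalTree med δ c ω).numLeaves : ℝ)) (randomness d) ∧
      ∫ ω, ((finalTree med δ c ω).numLeaves : ℝ) ∂randomness d ≤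
        leafPot β (centerSet c).card := by
  set S₀ := centerSet c
  refine integrable_of_tendsto_of_lintegral_le (leafPot_nonneg hβ _)
    (f := fun t ω => ((chain (listStep med (margin k δ)) [S₀] ω t).length : ℝ))
    (fun t => measurable_comp_leaves hS₀ t fun l => (l.length : ℝ))
    (fun ω => by positivity) ?_ fun t => ?_
  · filter_upwards [hfin] with ω hω
    refine tendsto_const_nhds.congr' ?_
    filter_upwards [Filter.eventually_ge_atTop (haltTime med δ c ω)] with t ht
    rw [← leaves_treeAt, treeAt_eq_finalTree hω ht]
    rfl
  · simp only [ENNReal.ofReal_natCast]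
    exact lintegral_length_le hε hε' hmed hβ hεβ hS₀ t

lemma integral_runningTime_le (hε : 0 ≤ margin k δ) (hε' : margin k δ ≤ 1 / 320)
    (hmed : ∀ S, S.Nonempty → IsMedian S (med S)) (hβ : 0 ≤ β)
    (hS₀ : (centerSet c).Nonempty)
    (hεβ : 41 / 10 * margin k δ *
      (1 + β * Real.log (centerSet c).card) ≤
        β * Real.log 2)
    (hfin : ∀ᵐ ω ∂randomness d, ∃ t, (treeAt med δ c ω t).Finished) :
    Integrable (fun ω => (runningTime med δ c ω : ℝ)) (randomness d) ∧
      ∫ ω, (runningTime med δ c ω : ℝ) ∂randomness d ≤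
        (3 + callOps d (centerSet c).card : ℕ) *
        (50 * d * leafPot β (centerSet c).card) := by
  set S₀ := centerSet c
  set X : (ℕ → Seed d) → ℕ → List (Finset (Point d)) := chain (listStep med (margin k δ)) [S₀]
  have hpot := leafPot_nonneg hβ S₀.card
  have hmeas : ∀ t, Measurable fun ω => (listOps d (X ω t) : ENNReal) := fun t =>
    measurable_comp_leaves hS₀ t fun l => (listOps d l : ENNReal)
  refine integrable_of_tendsto_of_lintegral_le (by positivity)
    (f := fun n ω => ((∑ t ∈ Finset.range n, listOps d (X ω t) : ℕ) : ℝ))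
    (fun n => ?_) (fun ω => by positivity) ?_ fun n => ?_
  · push_cast
    exact Finset.measurable_fun_sum _ fun t _ =>
      measurable_comp_leaves hS₀ t fun l => (listOps d l : ℝ)
  · filter_upwards [hfin] with ω hω
    refine tendsto_const_nhds.congr' ?_
    filter_upwards [Filter.eventually_ge_atTop (haltTime med δ c ω)] with t ht
    rw [← runningTime_eq hω ht]
    simp only [X, leaves_treeAt]
    rfl
  · simp only [ENNReal.ofReal_natCast]
    push_cast
    rw [lintegral_finsetSum _ fun t _ => hmeas t]
    calc _ ≤ ∑ t ∈ Finset.range n,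
          ((3 + callOps d S₀.card : ℕ) : ENNReal) * ∫⁻ ω, numActive (X ω t) ∂randomness d := by
          refine Finset.sum_le_sum fun t _ => ?_
          rw [← lintegral_const_mul' _ _ (ENNReal.natCast_ne_top _)]
          exact lintegral_mono fun ω => listOps_le
            (chain_mem (singleton_mem_goodLists hS₀) (fun _ hl _ => listStep_mem hl) ω t)
      _ ≤ (3 + callOps d S₀.card : ℕ) * ENNReal.ofReal (50 * d * leafPot β S₀.card) := by
          rw [← Finset.mul_sum]
          gcongr
          exact sum_lintegral_numActive_le hε hε' hmed hβ hεβ hS₀ n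
      _ = _ := by
          have hcast : (3 + (callOps d S₀.card : ℝ)) = ((3 + callOps d S₀.card : ℕ) : ℝ) := by
            push_cast; rfl
          rw [hcast, ENNReal.ofReal_mul (Nat.cast_nonneg _), ENNReal.ofReal_natCast]

end Bounds

end DivideAndShare

namespace DivideAndShare

/-! ### Numerical constants -/

section Constants

variable {k : ℕ} {δ : ℝ}

lemma log_natCast_gt (hk : 2 ≤ k) : 69 / 100 < Real.log k := by
  have h1 : Real.log 2 ≤ Real.log k := Real.log_le_log (by norm_num) (by exact_mod_cast hk)
  linarith [Real.log_two_gt_d9]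

lemma margin_pos (hk : 2 ≤ k) (hδ : 0 < δ) : 0 < margin k δ := by
  have := log_natCast_gt hk
  have : 0 < Real.log k := by linarith
  exact lt_min (by positivity) (by norm_num)

lemma margin_le (k : ℕ) (δ : ℝ) : margin k δ ≤ 1 / 320 := min_le_right _ _

lemma inv_margin_le (hk : 2 ≤ k) (hδ : 0 < δ) (hδ' : δ < 1) :
    1 / margin k δ ≤ 500 * (1 / δ * Real.log k) := by
  have hlog := log_natCast_gt hk
  have h0 : 0 < Real.log k := by linarith
  have h1 : Real.log k < 1 / δ * Real.log k := by
    rw [one_div_mul_eq_div, lt_div_iff₀ hδ]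
    nlinarith
  rw [margin]
  rcases min_choice (δ / (15 * Real.log k)) (1 / 320) with h | h <;> rw [h]
  · rw [one_div_div]
    have : 15 * Real.log k / δ = 15 * (1 / δ * Real.log k) := by ring
    rw [this]
    linarith
  -- The cap gives `1 / ε = 320`, and `320 ≤ 500 · 0.69`.
  · norm_num
    norm_num at h1
    linarith

/-- The choice `β = δ / log k` gives `β log n ≤ δ < 1`. The first claim then reduces to `4.1 · 2 /
15 < log 2`, which is why `15` occurs in the margin. -/
lemma leafPot_condition (hk : 2 ≤ k) (hδ : 0 < δ) (hδ' : δ < 1) {n : ℕ} (hn : 1 ≤ n) (hnk : n ≤ k) :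
    41 / 10 * margin k δ * (1 + δ / Real.log k * Real.log n) ≤ δ / Real.log k * Real.log 2 ∧
      leafPot (δ / Real.log k) n ≤ (1 + δ) * k := by
  have hlog := log_natCast_gt hk
  have h0 : 0 < Real.log k := by linarith
  have hn0 : (0 : ℝ) < n := by exact_mod_cast hn
  have hnk' : (n : ℝ) ≤ k := by exact_mod_cast hnk
  have h1 : δ / Real.log k * Real.log n ≤ δ := by
    calc δ / Real.log k * Real.log n ≤ δ / Real.log k * Real.log k := by gcongr
      _ = δ := by field_simp
  have h2 : 0 ≤ δ / Real.log k * Real.log n := mul_nonneg (by positivity) (Real.log_natCast_nonneg n)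
  constructor
  · have h3 : margin k δ ≤ δ / Real.log k / 15 := by
      refine (min_le_left _ _).trans (le_of_eq ?_)
      field_simp
    have h4 := (margin_pos hk hδ).le
    have h5 : 0 < δ / Real.log k := by positivity
    have h6 := Real.log_two_gt_d9
    calc 41 / 10 * margin k δ * (1 + δ / Real.log k * Real.log n) ≤
          41 / 10 * (δ / Real.log k / 15) * 2 := by gcongr; linarith
      _ ≤ δ / Real.log k * Real.log 2 := by nlinarith
  · rw [leafPot]
    calc (n : ℝ) * (1 + δ / Real.log k * Real.log n) ≤ k * (1 + δ) := by gcongr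
      _ = _ := mul_comm _ _

/-- An even exponent of order `log k` with `k ^ 2 ≤ 2 ^ p`. -/
noncomputable def exponent (k : ℕ) : ℕ := 2 * (Nat.log 2 k + 1)

lemma exponent_ne_zero : exponent k ≠ 0 := by unfold exponent; omega

lemma sq_le_two_pow_exponent {n : ℕ} (h : n ≤ k) : n ^ 2 ≤ 2 ^ exponent k := by
  rw [exponent, mul_comm, pow_mul]
  exact Nat.pow_le_pow_left (h.trans (Nat.lt_pow_succ_log_self (by norm_num) k).le) 2

lemma exponent_le (hk : 2 ≤ k) : (exponent k : ℝ) ≤ 6 * Real.log k := by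
  have h1 : (2 : ℝ) ^ Nat.log 2 k ≤ k := by
    exact_mod_cast Nat.pow_log_le_self 2 (by omega)
  have h2 := Real.log_le_log (by positivity) h1
  rw [Real.log_pow] at h2
  have h3 := log_natCast_gt hk
  have h4 := Real.log_two_gt_d9
  have h5 : (0 : ℝ) ≤ Nat.log 2 k := Nat.cast_nonneg _
  have h6 : Real.log 2 ≤ Real.log k := Real.log_le_log (by norm_num) (by exact_mod_cast hk)
  unfold exponent
  push_cast
  nlinarith

lemma log_ratioBound_le (hk : 2 ≤ k) :
    Real.log (ratioBound (exponent k)) ≤ 14 * max 1 (Real.log (Real.log k)) := by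
  have hlog := log_natCast_gt hk
  have h0 : 0 < Real.log k := by linarith
  have h1 : ratioBound (exponent k) ≤ 2 ^ 18 * Real.log k := by
    have := exponent_le hk
    unfold ratioBound
    linarith
  have h2 := Real.log_le_log (zero_lt_one.trans_le one_le_ratioBound) h1
  rw [Real.log_mul (by norm_num) h0.ne', Real.log_pow] at h2
  have h3 := Real.log_two_lt_d9
  have h4 := le_max_left 1 (Real.log (Real.log k))
  have h5 := le_max_right 1 (Real.log (Real.log k))
  norm_num at h2
  linarith

lemma cost_constant_le (hk : 2 ≤ k) (hδ : 0 < δ) (hδ' : δ < 1) :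
    9 + 64800 * exponent k / margin k δ * Real.log (ratioBound (exponent k)) ≤
      3000000000 * (1 / δ * Real.log k ^ 2 * max 1 (Real.log (Real.log k))) := by
  have hlog := log_natCast_gt hk
  have h0 : 0 < Real.log k := by linarith
  have hε := margin_pos hk hδ
  have h1 := inv_margin_le hk hδ hδ'
  have h2 := exponent_le hk
  have h3 := log_ratioBound_le hk
  have h4 := le_max_left 1 (Real.log (Real.log k))
  set Y := max 1 (Real.log (Real.log k))
  have hδ1 : 1 ≤ 1 / δ := by rw [le_div_iff₀ hδ]; linarith
  have hL := Real.log_nonneg (one_le_ratioBound (p := exponent k))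
  have h5 : 64800 * exponent k / margin k δ * Real.log (ratioBound (exponent k)) ≤
      -- One factor `log k` comes from the exponent `p`, the other from `1 / ε`; `14 Y` bounds the
      -- logarithm of the scale ratio.
      64800 * (6 * Real.log k) * (500 * (1 / δ * Real.log k)) * (14 * Y) := by
    rw [div_eq_mul_one_div]
    gcongr
  have h6 : 47 / 100 ≤ 1 / δ * Real.log k ^ 2 * Y := by
    have h7 : 47 / 100 ≤ Real.log k ^ 2 := by nlinarith
    calc (47 : ℝ) / 100 = 1 * (47 / 100) * 1 := by ring
      _ ≤ _ := by gcongr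
  have h7 : 64800 * (6 * Real.log k) * (500 * (1 / δ * Real.log k)) * (14 * Y) =
      2721600000 * (1 / δ * Real.log k ^ 2 * Y) := by ring
  linarith

end Constants

/-! ### The final cost and running-time estimates -/

section Cost

variable {d k : ℕ} {med : Finset (Point d) → Point d} {δ : ℝ} {c : Fin k → Point d}

lemma centerSet_nonempty (hk : 2 ≤ k) (c : Fin k → Point d) : (centerSet c).Nonempty := by
  classical
  exact ⟨c ⟨0, by omega⟩, Finset.mem_image_of_mem _ (Finset.mem_univ _)⟩

lemma card_centerSet_le (c : Fin k → Point d) : (centerSet c).card ≤ k := by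
  classical
  simpa [centerSet] using Finset.card_image_le (s := Finset.univ) (f := c)

lemma mem_centerSet {a : Point d} : a ∈ centerSet c ↔ ∃ j, c j = a := by
  simp [centerSet]

variable [NeZero d]

lemma integral_sq_dist_le (hk : 2 ≤ k) (hδ : 0 < δ) (hδ' : δ < 1)
    (hmed : ∀ S, S.Nonempty → IsMedian S (med S))
    (hfin : ∀ᵐ ω ∂randomness d, ∃ t, (treeAt med δ c ω t).Finished) (x : Point d) :
    Integrable (fun ω => ‖x - (finalTree med δ c ω).assign x‖ ^ 2) (randomness d) ∧
      ∫ ω, ‖x - (finalTree med δ c ω).assign x‖ ^ 2 ∂randomness d ≤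
        3000000000 * (1 / δ * Real.log k ^ 2 * max 1 (Real.log (Real.log k))) *
          sqDistToCenters c x := by
  have hS₀ := centerSet_nonempty hk c
  have hε := margin_pos hk hδ
  have hε' := margin_le k δ
  have hcard : (centerSet c).card ^ 2 ≤ 2 ^ exponent k :=
    sq_le_two_pow_exponent (card_centerSet_le c)
  have hmedS : ∀ S : Finset (Point d), 1 < S.card → IsMedian S (med S) := fun S hS =>
    hmed S (Finset.card_pos.1 (by omega))
  have hconst := cost_constant_le hk hδ hδ'
  have hlog := Real.log_nonneg (one_le_ratioBound (p := exponent k))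
  have hconst0 : 0 ≤ 9 + 64800 * exponent k / margin k δ * Real.log (ratioBound (exponent k)) := by
    positivity
  by_cases hx : x ∈ centerSet c
  -- At a center the distance `0` makes the logarithmic potential useless; the linear potential with
  -- `c = x` starts at `0`, so the expected cost is `0`.
  · have h := integral_cost_le (c := c) (V := linPot (exponent k) x x) hS₀ hfin x
      (fun T _ => linPot_nonneg x) (fun a _ => sq_dist_le_linPot x a) fun S hSS hS =>
      avg_linPot_le exponent_ne_zero hε.le hε' hS (hmedS S hS)
        ((Nat.pow_le_pow_left (Finset.card_le_card hSS) 2).trans hcard) x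
    refine ⟨h.1, h.2.trans ?_⟩
    rw [linPot, if_pos hx]
    simp only [sub_self, norm_zero]
    have h0 : 0 ≤ sqDistToCenters c x := Real.iInf_nonneg fun _ => by positivity
    have := mul_nonneg (hconst0.trans hconst) h0
    linarith
  · have : Nonempty (Fin k) := ⟨⟨0, by omega⟩⟩
    obtain ⟨j, hj⟩ := exists_eq_ciInf_of_finite (f := fun j : Fin k => ‖x - c j‖ ^ 2)
    have hcj : c j ∈ centerSet c := mem_centerSet.2 ⟨j, rfl⟩
    have h := integral_cost_le (c := c) (V := costPot (margin k δ) (exponent k) x hS₀ (c j)) hS₀ hfin x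
      (fun T hT => costPot_nonneg hε hS₀ hx (c j) hT)
      (fun a ha => sq_dist_le_costPot hε hS₀ hx (c j) ha) fun S hSS hS =>
      avg_costPot_le exponent_ne_zero hε hε' hS (hmedS S hS) hSS hcard hS₀ hx (c j)
    refine ⟨h.1, h.2.trans ((costPot_le hε hS₀ hx hcj).trans ?_)⟩
    rw [sqDistToCenters, ← hj]
    gcongr

lemma runningTime_bound {n : ℕ} (hk : 2 ≤ k) (hδ' : δ < 1) (hn : n ≤ k) {r : ℝ}
    (hr : r ≤ (1 + δ) * k) :
    ((3 + callOps d n : ℕ) : ℝ) * (50 * d * r) ≤ 3000000000 * ((d : ℝ) * k) ^ 3 := by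
  have hd : (1 : ℝ) ≤ d := by exact_mod_cast Nat.one_le_iff_ne_zero.2 (NeZero.ne d)
  have hk1 : (1 : ℝ) ≤ k := by exact_mod_cast (by omega : 1 ≤ k)
  have h1 : ((3 + callOps d n : ℕ) : ℝ) ≤ 20 * (d * k ^ 2) := by
    have h2 : ((3 + callOps d n : ℕ) : ℝ) ≤ (3 + callOps d k : ℕ) := by
      exact_mod_cast Nat.add_le_add_left (callOps_mono hn) 3
    refine h2.trans ?_
    unfold callOps
    push_cast
    have h3 : (k : ℝ) ≤ k ^ 2 := by nlinarith
    have h4 : (k : ℝ) ^ 2 ≤ d * k ^ 2 := by nlinarith [sq_nonneg (k : ℝ)]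
    have h5 : (k : ℝ) * d ≤ d * k ^ 2 := by nlinarith
    nlinarith
  have h6 : r ≤ 2 * k := by nlinarith
  calc ((3 + callOps d n : ℕ) : ℝ) * (50 * d * r) ≤
        ((3 + callOps d n : ℕ) : ℝ) * (50 * d * (2 * k)) := by gcongr
    _ ≤ 20 * (d * k ^ 2) * (50 * d * (2 * k)) := by gcongr
    _ = 2000 * (d ^ 2 * k ^ 3) := by ring
    _ ≤ 3000000000 * (d ^ 3 * k ^ 3) := by
        have : (d : ℝ) ^ 2 ≤ d ^ 3 := pow_le_pow_right₀ hd (by norm_num)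
        gcongr
        norm_num
    _ = _ := by ring

end Cost

end DivideAndShare

open DivideAndShare in
theorem mainTheorem1 :
    ∃ (K : ℝ) (p : ℕ), ∀ (d : ℕ) [NeZero d] (k : ℕ) (_ : 2 ≤ k) (c : Fin k → Point d)
      (δ : ℝ) (_ : 0 < δ) (_ : δ < 1)
      (med : Finset (Point d) → Point d) (_ : ∀ S, S.Nonempty → IsMedian S (med S)),
      -- the algorithm stops almost surely, and every leaf is labeled with one of the centers
      (∀ᵐ ω ∂randomness d, (∃ t, (treeAt med δ c ω t).Finished) ∧
        ∀ S ∈ (finalTree med δ c ω).leaves, ∃ j, S = {c j}) ∧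
      -- the expected squared distance from every point to its assigned center
      (∀ x : Point d,
        Integrable (fun ω => ‖x - (finalTree med δ c ω).assign x‖ ^ 2) (randomness d) ∧
        ∫ ω, ‖x - (finalTree med δ c ω).assign x‖ ^ 2 ∂randomness d ≤
          K * (1 / δ * Real.log k ^ 2 * max 1 (Real.log (Real.log k))) * sqDistToCenters c x) ∧
      -- the expected cost of every data set
      (∀ X : Finset (Point d),
        Integrable (fun ω => (finalTree med δ c ω).cost X) (randomness d) ∧
        ∫ ω, (finalTree med δ c ω).cost X ∂randomness d ≤
          K * (1 / δ * Real.log k ^ 2 * max 1 (Real.log (Real.log k))) * centersCost X c) ∧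
      -- the expected number of leaves
      (Integrable (fun ω => ((finalTree med δ c ω).numLeaves : ℝ)) (randomness d) ∧
        ∫ ω, ((finalTree med δ c ω).numLeaves : ℝ) ∂randomness d ≤ (1 + δ) * k) ∧
      -- the expected running time is polynomial
      (Integrable (fun ω => (runningTime med δ c ω : ℝ)) (randomness d) ∧
        ∫ ω, (runningTime med δ c ω : ℝ) ∂randomness d ≤ K * ((d : ℝ) * k) ^ p) := by
  -- `K` is dictated by the cost bound and is far larger than the running time needs. The exponent
  -- `3` combines `d k²` operations per call with of order `d k` expected calls, using `d² ≤ d³`.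
  refine ⟨3000000000, 3, fun d _ k hk c δ hδ hδ' med hmed => ?_⟩
  have hS₀ := centerSet_nonempty hk c
  have hε := (margin_pos hk hδ).le
  have hε' := margin_le k δ
  have hβ : 0 ≤ δ / Real.log k := div_nonneg hδ.le (Real.log_natCast_nonneg k)
  obtain ⟨hεβ, hpot⟩ := leafPot_condition hk hδ hδ' hS₀.card_pos (card_centerSet_le c)
  have hfin := ae_finished (c := c) hε hε' hmed hβ hS₀ hεβ
  have hcost := integral_sq_dist_le (c := c) hk hδ hδ' hmed hfin
  have hleaves := integral_numLeaves_le hε hε' hmed hβ hS₀ hεβ hfin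
  have hrun := integral_runningTime_le hε hε' hmed hβ hS₀ hεβ hfin
  refine ⟨?_, hcost, fun X => ⟨?_, ?_⟩, ⟨hleaves.1, hleaves.2.trans hpot⟩,
    ⟨hrun.1, hrun.2.trans (runningTime_bound hk hδ' (card_centerSet_le c) hpot)⟩⟩
  · filter_upwards [hfin] with ω hω
    refine ⟨hω, fun S hS => ?_⟩
    have hcard := finished_finalTree hω S hS
    rw [finalTree, leaves_treeAt] at hS
    obtain ⟨hSS, hne⟩ := chain_mem (singleton_mem_goodLists hS₀)
      (fun _ hl _ => listStep_mem hl) ω _ S hS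
    obtain ⟨a, rfl⟩ := Finset.card_eq_one.1 (le_antisymm hcard hne.card_pos)
    obtain ⟨j, rfl⟩ := mem_centerSet.1 (hSS (Finset.mem_singleton_self a))
    exact ⟨j, rfl⟩
  · exact integrable_finsetSum _ fun x _ => (hcost x).1
  · unfold ThresholdTree.cost centersCost
    rw [integral_finsetSum _ fun x _ => (hcost x).1, Finset.mul_sum]
    exact Finset.sum_le_sum fun x _ => (hcost x).2
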